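/- Let $\Bbbk$ be a field, $B$ a bialgebra over $\Bbbk$, and let $\mathcal V={}^B\mathbf{Vect}$ be the category of left $B$-comodules $(N,\, n\mapsto n_{(-1)}\otimes n_{(0)})$. It is monoidal under $\otimes=\otimes_\Bbbk$ with the codiagonal coaction $m\otimes n\mapsto m_{(-1)}n_{(-1)}\otimes m_{(0)}\otimes n_{(0)}$, and is regarded as a left module category over itself. *Hopf trimodules.* A Hopf trimodule over $B$ is a $B$-$B$-bicomodule $(X,\lambda,\rho)$, $\lambda(x)=x_{(-1)}\otimes x_{(0)}$, $\rho(x)=x_{(0)}\otimes x_{(1)}$, with a left $B$-module structure such that $\lambda(bx)=b_{(1)}x_{(-1)}\otimes b_{(2)}x_{(0)}$ and $\rho(bx)=b_{(1)}x_{(0)}\otimes b_{(2)}x_{(1)}$. Morphisms are the linear maps compatible with $\lambda$, $\rho$ and the action. The cotensor product of a Hopf trimodule $X$ with a Hopf trimodule or left comodule $Y$ is $X\mathbin\square Y=\{t\in X\otimes Y : (\rho\otimes Y)(t)=(X\otimes\lambda_Y)(t)\}$, with left coaction from $X$; if $Y$ is a Hopf trimodule, then $X\mathbin\square Y$ has the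 right coaction from $Y$ and the action $b(x\otimes y)=b_{(1)}x\otimes b_{(2)}y$. The category ${}^B_B\mathbf{Vect}^B$ of Hopf trimodules is monoidal under $\square$, with unit $B$. *Lax module endofunctors.* A lax $\mathcal V$-module endofunctor of $\mathcal V$ is a functor $F:\mathcal V\to\mathcal V$ with a natural transformation $F_{\mathsf a;M,N}: M\otimes F(N)\to F(M\otimes N)$ satisfying the usual associativity and unit axioms. It is finitary if it preserves filtered colimits. Let $\mathrm{LexLax}\mathcal V\mathrm{Mod}(\mathcal V,\mathcal V)$ be the category of left exact finitary lax $\mathcal V$-module endofunctors and $\mathcal V$-module transformations, monoidal under composition, $F\otimes G=F\circ G$. For a Hopf trimodule $X$, the functor $X\mathbin\square-:\mathcal V\to\mathcal V$ is a lax $\mathcal V$-module functor with the interchange morphism $$\chi_{M,N}: M\otimes(X\mathbin\square N)\to X\mathbin\square(M\otimes N),\qquad m\otimes(x\otimes n)\mapsto m_{(-1)}x\otimes(m_{(0)}\otimes n).$$ **Theorem.** For every Hopf trimodule $X$, the lax module functor $(X\mathbin\square-,\chi)$ is left exact and finitary, and the assignment $X\mapsto(X\mathbin\square-,\chi)$,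 $f\mapsto f\mathbin\square-$, is a monoidal equivalence $$\Sigma:\ {}^B_B\mathbf{Vect}^B\ \xrightarrow{\ \simeq\ }\ \mathrm{LexLax}\mathcal V\mathrm{Mod}(\mathcal V,\mathcal V).$$ Its (strong) monoidal structure is given by the canonical isomorphisms $X\mathbin\square(Y\mathbin\square N)\cong(X\mathbin\square Y)\mathbin\square N$, $x\otimes(y\otimes n)\mapsto(x\otimes y)\otimes n$, and $N\cong B\mathbin\square N$, $n\mapsto n_{(-1)}\otimes n_{(0)}$. A quasi-inverse of $\Sigma$ evaluates a functor at $B$: it sends $F$ to a Hopf trimodule whose left comodule is isomorphic to $F(B)$, naturally in $F$. Under this isomorphism the action is $b\cdot x=F(\mathrm{mult})\bigl(F_{\mathsf a;B,B}(b\otimes x)\bigr)$, where $\mathrm{mult}:B\otimes B\to B$ is the multiplication, and the right coaction $\rho$ is the one with $(\mathrm{id}\otimes\varphi)\circ\rho=F\bigl(b\mapsto b_{(1)}\varphi(b_{(2)})\bigr)$ for every linear functional $\varphi:B\to\Bbbk$. -/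

import Mathlib

open CategoryTheory
open scoped TensorProduct

universe u

namespace HopfTri

section LinearAlgebra

variable {k B : Type u} [Field k] [Ring B] [Bialgebra k B]
variable {M N P Q M' N' : Type u} [AddCommGroup M] [Module k M] [AddCommGroup N] [Module k N]
  [AddCommGroup P] [Module k P] [AddCommGroup Q] [Module k Q]
  [AddCommGroup M'] [Module k M'] [AddCommGroup N'] [Module k N']

/-- `δ : M → B ⊗ M` is a coassociative counital left coaction. -/
structure IsLeftCoaction (δ : M →ₗ[k] B ⊗[k] M) : Prop where
  coassoc : ∀ m, TensorProduct.assoc k B B M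
    ((Coalgebra.comul (R := k) (A := B)).rTensor M (δ m)) = δ.lTensor B (δ m)
  counit : ∀ m, TensorProduct.lid k M ((Coalgebra.counit (R := k) (A := B)).rTensor M (δ m)) = m

/-- `ρ : M → M ⊗ B` is a coassociative counital right coaction. -/
structure IsRightCoaction (ρ : M →ₗ[k] M ⊗[k] B) : Prop where
  coassoc : ∀ m, TensorProduct.assoc k M B B (ρ.rTensor B (ρ m)) =
    (Coalgebra.comul (R := k) (A := B)).lTensor M (ρ m)
  counit : ∀ m, TensorProduct.rid k M ((Coalgebra.counit (R := k) (A := B)).lTensor M (ρ m)) = m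

theorem lTensor_inj (A : Type u) [AddCommGroup A] [Module k A] {f : M →ₗ[k] N}
    (hf : Function.Injective f) : Function.Injective (f.lTensor A) :=
  Module.Flat.lTensor_preserves_injective_linearMap f hf

theorem rTensor_inj (A : Type u) [AddCommGroup A] [Module k A] {f : M →ₗ[k] N}
    (hf : Function.Injective f) : Function.Injective (f.rTensor A) :=
  Module.Flat.rTensor_preserves_injective_linearMap f hf

theorem mem_range_lTensor (A : Type u) [AddCommGroup A] [Module k A] (f g : M →ₗ[k] N)
    (t : A ⊗[k] M) (h : f.lTensor A t = g.lTensor A t) :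
    t ∈ LinearMap.range ((LinearMap.eqLocus f g).subtype.lTensor A) := by
  have := (Module.Flat.lTensor_exact A (LinearMap.exact_subtype_ker_map (f - g)) t).1
    (by rw [LinearMap.lTensor_sub]; simp [h])
  rw [LinearMap.eqLocus_eq_ker_sub]
  exact this

theorem mem_range_rTensor (A : Type u) [AddCommGroup A] [Module k A] (f g : M →ₗ[k] N)
    (t : M ⊗[k] A) (h : f.rTensor A t = g.rTensor A t) :
    t ∈ LinearMap.range ((LinearMap.eqLocus f g).subtype.rTensor A) := by
  have := (Module.Flat.rTensor_exact A (LinearMap.exact_subtype_ker_map (f - g)) t).1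
    (by rw [LinearMap.rTensor_sub]; simp [h])
  rw [LinearMap.eqLocus_eq_ker_sub]
  exact this

theorem IsLeftCoaction.of_injective {δ : M →ₗ[k] B ⊗[k] M} {γ : P →ₗ[k] B ⊗[k] P}
    (hδ : IsLeftCoaction δ) (i : P →ₗ[k] M) (hi : Function.Injective i)
    (h : ∀ p, i.lTensor B (γ p) = δ (i p)) : IsLeftCoaction γ where
  coassoc p := by
    apply lTensor_inj B (lTensor_inj B hi)
    have h1 : ∀ t, (i.lTensor B).lTensor B (TensorProduct.assoc k B B P
      ((Coalgebra.comul (R := k) (A := B)).rTensor P t)) = TensorProduct.assoc k B B M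
      ((Coalgebra.comul (R := k) (A := B)).rTensor M (i.lTensor B t)) := by
      intro t
      induction t with
      | zero => simp
      | add x y hx hy => simp only [map_add, hx, hy]
      | tmul b p =>
        simp only [LinearMap.rTensor_tmul, LinearMap.lTensor_tmul]
        generalize (Coalgebra.comul (R := k) b) = d
        induction d with
        | zero => simp
        | add x y hx hy => simp only [TensorProduct.add_tmul, map_add, hx, hy]
        | tmul a b => simp
    have h2 : ∀ t, (i.lTensor B).lTensor B (γ.lTensor B t) = δ.lTensor B (i.lTensor B t) := by
      intro t
      induction t with
      | zero => simp
      | add x y hx hy => simp only [map_add, hx, hy]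
      | tmul b p => simp [h]
    rw [h1, h2, h, hδ.coassoc]
  counit p := by
    apply hi
    have h1 : ∀ t, i (TensorProduct.lid k P ((Coalgebra.counit (R := k) (A := B)).rTensor P t)) =
      TensorProduct.lid k M ((Coalgebra.counit (R := k) (A := B)).rTensor M (i.lTensor B t)) := by
      intro t
      induction t with
      | zero => simp
      | add x y hx hy => simp only [map_add, hx, hy]
      | tmul b p => simp
    rw [h1, h, hδ.counit]

theorem IsRightCoaction.of_injective {δ : M →ₗ[k] M ⊗[k] B} {γ : P →ₗ[k] P ⊗[k] B}
    (hδ : IsRightCoaction δ) (i : P →ₗ[k] M) (hi : Function.Injective i)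
    (h : ∀ p, i.rTensor B (γ p) = δ (i p)) : IsRightCoaction γ where
  coassoc p := by
    apply rTensor_inj (B ⊗[k] B) hi
    have h1 : ∀ t, i.rTensor (B ⊗[k] B) (TensorProduct.assoc k P B B (γ.rTensor B t)) =
        TensorProduct.assoc k M B B (δ.rTensor B (i.rTensor B t)) := by
      intro t
      induction t with
      | zero => simp
      | add x y hx hy => simp only [map_add, hx, hy]
      | tmul p b =>
        simp only [LinearMap.rTensor_tmul, ← h]
        generalize γ p = d
        induction d with
        | zero => simp
        | add x y hx hy => simp only [TensorProduct.add_tmul, map_add, hx, hy]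
        | tmul a b => simp
    have h2 : ∀ t, i.rTensor (B ⊗[k] B) ((Coalgebra.comul (R := k) (A := B)).lTensor P t) =
        (Coalgebra.comul (R := k) (A := B)).lTensor M (i.rTensor B t) := by
      intro t
      induction t with
      | zero => simp
      | add x y hx hy => simp only [map_add, hx, hy]
      | tmul b p => simp
    rw [h1, h2, h, hδ.coassoc]
  counit p := by
    apply hi
    have h1 : ∀ t, i (TensorProduct.rid k P ((Coalgebra.counit (R := k) (A := B)).lTensor P t)) =
      TensorProduct.rid k M ((Coalgebra.counit (R := k) (A := B)).lTensor M (i.rTensor B t)) := by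
      intro t
      induction t with
      | zero => simp
      | add x y hx hy => simp only [map_add, hx, hy]
      | tmul b p => simp
    rw [h1, h, hδ.counit]

/-- The codiagonal left coaction `m ⊗ n ↦ m₋₁ n₋₁ ⊗ (m₀ ⊗ n₀)` on `M ⊗ N`. -/
noncomputable def tensorCoact (δM : M →ₗ[k] B ⊗[k] M) (δN : N →ₗ[k] B ⊗[k] N) :
    M ⊗[k] N →ₗ[k] B ⊗[k] (M ⊗[k] N) :=
  (LinearMap.mul' k B).rTensor (M ⊗[k] N) ∘ₗ
    (TensorProduct.tensorTensorTensorComm k B M B N).toLinearMap ∘ₗ TensorProduct.map δM δN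

/-- The left coaction `x ⊗ n ↦ x₋₁ ⊗ (x₀ ⊗ n)` on `M ⊗ N` through the first factor. -/
noncomputable def outerL (δ : M →ₗ[k] B ⊗[k] M) (N : Type u) [AddCommGroup N] [Module k N] :
    M ⊗[k] N →ₗ[k] B ⊗[k] (M ⊗[k] N) :=
  (TensorProduct.assoc k B M N).toLinearMap ∘ₗ δ.rTensor N

/-- The right coaction `x ⊗ y ↦ (x ⊗ y₀) ⊗ y₁` on `M ⊗ N` through the second factor. -/
noncomputable def outerR (M : Type u) [AddCommGroup M] [Module k M] (ρ : N →ₗ[k] N ⊗[k] B) :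
    M ⊗[k] N →ₗ[k] (M ⊗[k] N) ⊗[k] B :=
  (TensorProduct.assoc k M N B).symm.toLinearMap ∘ₗ ρ.lTensor M

theorem outerL_isLeftCoaction {δ : M →ₗ[k] B ⊗[k] M} (hδ : IsLeftCoaction δ) :
    IsLeftCoaction (outerL δ N) where
  coassoc t := by
    induction t with
    | zero => simp
    | add x y hx hy => simp only [map_add, hx, hy]
    | tmul m n =>
      have h1 : ∀ t : B ⊗[k] M, TensorProduct.assoc k B B (M ⊗[k] N)
          ((Coalgebra.comul (R := k) (A := B)).rTensor (M ⊗[k] N)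
            (TensorProduct.assoc k B M N (t ⊗ₜ n))) =
          (TensorProduct.assoc k B M N).toLinearMap.lTensor B (TensorProduct.assoc k B (B ⊗[k] M) N
          (TensorProduct.assoc k B B M
          ((Coalgebra.comul (R := k) (A := B)).rTensor M t) ⊗ₜ n)) := by
        intro t
        induction t with
        | zero => simp
        | add x y hx hy => simp only [TensorProduct.add_tmul, map_add, hx, hy]
        | tmul b p =>
          simp only [LinearMap.rTensor_tmul, TensorProduct.assoc_tmul]
          generalize (Coalgebra.comul (R := k) b) = d
          induction d with
          | zero => simp
          | add x y hx hy => simp only [TensorProduct.add_tmul, map_add, hx, hy]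
          | tmul a b => simp
      have h2 : ∀ t : B ⊗[k] M, (outerL δ N).lTensor B (TensorProduct.assoc k B M N (t ⊗ₜ n)) =
          (TensorProduct.assoc k B M N).toLinearMap.lTensor B (TensorProduct.assoc k B (B ⊗[k] M) N
          (δ.lTensor B t ⊗ₜ n)) := by
        intro t
        induction t with
        | zero => simp
        | add x y hx hy => simp only [TensorProduct.add_tmul, map_add, hx, hy]
        | tmul b p => simp [outerL]
      have h0 : outerL δ N (m ⊗ₜ n) = TensorProduct.assoc k B M N (δ m ⊗ₜ n) := by simp [outerL]
      rw [h0, h1, h2, hδ.coassoc]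
  counit t := by
    induction t with
    | zero => simp
    | add x y hx hy => simp only [map_add, hx, hy]
    | tmul m n =>
      have h1 : ∀ t : B ⊗[k] M, TensorProduct.lid k (M ⊗[k] N)
          ((Coalgebra.counit (R := k) (A := B)).rTensor (M ⊗[k] N)
            (TensorProduct.assoc k B M N (t ⊗ₜ n))) =
          (TensorProduct.lid k M ((Coalgebra.counit (R := k) (A := B)).rTensor M t)) ⊗ₜ n := by
        intro t
        induction t with
        | zero => simp
        | add x y hx hy => simp only [TensorProduct.add_tmul, map_add, hx, hy]
        | tmul b p => simp [TensorProduct.smul_tmul']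
      have h0 : outerL δ N (m ⊗ₜ n) = TensorProduct.assoc k B M N (δ m ⊗ₜ n) := by simp [outerL]
      rw [h0, h1, hδ.counit]

theorem outerR_isRightCoaction {ρ : N →ₗ[k] N ⊗[k] B} (hρ : IsRightCoaction ρ) :
    IsRightCoaction (outerR M ρ) where
  coassoc t := by
    induction t with
    | zero => simp
    | add x y hx hy => simp only [map_add, hx, hy]
    | tmul m n =>
      have h1 : ∀ t : N ⊗[k] B, TensorProduct.assoc k (M ⊗[k] N) B B
          ((outerR M ρ).rTensor B ((TensorProduct.assoc k M N B).symm (m ⊗ₜ t))) =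
          (TensorProduct.assoc k M N (B ⊗[k] B)).symm (m ⊗ₜ
            (TensorProduct.assoc k N B B (ρ.rTensor B t))) := by
        intro t
        induction t with
        | zero => simp
        | add x y hx hy => simp only [TensorProduct.tmul_add, map_add, hx, hy]
        | tmul n b =>
          simp only [LinearMap.rTensor_tmul, TensorProduct.assoc_symm_tmul, outerR,
            LinearMap.comp_apply, LinearMap.lTensor_tmul, LinearEquiv.coe_coe]
          generalize ρ n = d
          induction d with
          | zero => simp
          | add x y hx hy =>
            simp only [TensorProduct.add_tmul, TensorProduct.tmul_add, map_add, hx, hy]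
          | tmul a b => simp
      have h2 : ∀ t : N ⊗[k] B, (Coalgebra.comul (R := k) (A := B)).lTensor (M ⊗[k] N)
          ((TensorProduct.assoc k M N B).symm (m ⊗ₜ t)) =
          (TensorProduct.assoc k M N (B ⊗[k] B)).symm (m ⊗ₜ
            ((Coalgebra.comul (R := k) (A := B)).lTensor N t)) := by
        intro t
        induction t with
        | zero => simp
        | add x y hx hy => simp only [TensorProduct.tmul_add, map_add, hx, hy]
        | tmul n b => simp
      have h0 : outerR M ρ (m ⊗ₜ n) = (TensorProduct.assoc k M N B).symm (m ⊗ₜ ρ n) := by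
        simp [outerR]
      rw [h0, h1, h2, hρ.coassoc]
  counit t := by
    induction t with
    | zero => simp
    | add x y hx hy => simp only [map_add, hx, hy]
    | tmul m n =>
      have h1 : ∀ t : N ⊗[k] B, TensorProduct.rid k (M ⊗[k] N)
          ((Coalgebra.counit (R := k) (A := B)).lTensor (M ⊗[k] N)
            ((TensorProduct.assoc k M N B).symm (m ⊗ₜ t))) =
          m ⊗ₜ (TensorProduct.rid k N ((Coalgebra.counit (R := k) (A := B)).lTensor N t)) := by
        intro t
        induction t with
        | zero => simp
        | add x y hx hy => simp only [TensorProduct.tmul_add, map_add, hx, hy]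
        | tmul b p => simp
      have h0 : outerR M ρ (m ⊗ₜ n) = (TensorProduct.assoc k M N B).symm (m ⊗ₜ ρ n) := by
        simp [outerR]
      rw [h0, h1, hρ.counit]

theorem tensorCoact_isLeftCoaction {δM : M →ₗ[k] B ⊗[k] M} {δN : N →ₗ[k] B ⊗[k] N}
    (hM : IsLeftCoaction δM) (hN : IsLeftCoaction δN) : IsLeftCoaction (tensorCoact δM δN) where
  coassoc t := by
    induction t with
    | zero => simp
    | add x y hx hy => simp only [map_add, hx, hy]
    | tmul m n =>
      let Φ : (B ⊗[k] (B ⊗[k] M)) ⊗[k] (B ⊗[k] (B ⊗[k] N)) →ₗ[k] B ⊗[k] (B ⊗[k] (M ⊗[k] N)) :=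
        TensorProduct.map (LinearMap.mul' k B) ((LinearMap.mul' k B).rTensor (M ⊗[k] N) ∘ₗ
          (TensorProduct.tensorTensorTensorComm k B M B N).toLinearMap) ∘ₗ
          (TensorProduct.tensorTensorTensorComm k B (B ⊗[k] M) B (B ⊗[k] N)).toLinearMap
      let Ψ : (B ⊗[k] M) ⊗[k] (B ⊗[k] N) →ₗ[k] B ⊗[k] (M ⊗[k] N) :=
        (LinearMap.mul' k B).rTensor (M ⊗[k] N) ∘ₗ
          (TensorProduct.tensorTensorTensorComm k B M B N).toLinearMap
      have h0 : tensorCoact δM δN (m ⊗ₜ n) = Ψ (δM m ⊗ₜ δN n) := by simp [tensorCoact, Ψ]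
      have h1 : ∀ (s : B ⊗[k] M) (t : B ⊗[k] N), TensorProduct.assoc k B B (M ⊗[k] N)
          ((Coalgebra.comul (R := k) (A := B)).rTensor (M ⊗[k] N) (Ψ (s ⊗ₜ t))) =
          Φ ((TensorProduct.assoc k B B M ((Coalgebra.comul (R := k) (A := B)).rTensor M s)) ⊗ₜ
            (TensorProduct.assoc k B B N ((Coalgebra.comul (R := k) (A := B)).rTensor N t))) := by
        intro s t
        induction s with
        | zero => simp
        | add x y hx hy => simp only [TensorProduct.add_tmul, map_add, hx, hy]
        | tmul b m =>
        induction t with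
        | zero => simp
        | add x y hx hy => simp only [TensorProduct.tmul_add, map_add, hx, hy]
        | tmul c n =>
          simp only [Ψ, LinearMap.comp_apply, LinearEquiv.coe_coe,
            TensorProduct.tensorTensorTensorComm_tmul, LinearMap.rTensor_tmul,
            LinearMap.mul'_apply, Bialgebra.comul_mul]
          generalize (Coalgebra.comul (R := k) b) = d
          generalize (Coalgebra.comul (R := k) c) = e
          induction d with
          | zero => simp
          | add x y hx hy => simp only [TensorProduct.add_tmul, add_mul, map_add, hx, hy]
          | tmul d1 d2 =>
          induction e with
          | zero => simp
          | add x y hx hy =>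
            simp only [TensorProduct.add_tmul, TensorProduct.tmul_add, mul_add, map_add, hx, hy]
          | tmul e1 e2 => simp [Φ]
      have h2 : ∀ (s : B ⊗[k] M) (t : B ⊗[k] N), (tensorCoact δM δN).lTensor B (Ψ (s ⊗ₜ t)) =
          Φ (δM.lTensor B s ⊗ₜ δN.lTensor B t) := by
        intro s t
        induction s with
        | zero => simp
        | add x y hx hy => simp only [TensorProduct.add_tmul, map_add, hx, hy]
        | tmul b m =>
        induction t with
        | zero => simp
        | add x y hx hy => simp only [TensorProduct.tmul_add, map_add, hx, hy]
        | tmul c n => simp [Ψ, Φ, tensorCoact]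
      rw [h0, h1, h2, hM.coassoc, hN.coassoc]
  counit t := by
    induction t with
    | zero => simp
    | add x y hx hy => simp only [map_add, hx, hy]
    | tmul m n =>
      let Ψ : (B ⊗[k] M) ⊗[k] (B ⊗[k] N) →ₗ[k] B ⊗[k] (M ⊗[k] N) :=
        (LinearMap.mul' k B).rTensor (M ⊗[k] N) ∘ₗ
          (TensorProduct.tensorTensorTensorComm k B M B N).toLinearMap
      have h0 : tensorCoact δM δN (m ⊗ₜ n) = Ψ (δM m ⊗ₜ δN n) := by simp [tensorCoact, Ψ]
      have h1 : ∀ (s : B ⊗[k] M) (t : B ⊗[k] N), TensorProduct.lid k (M ⊗[k] N)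
          ((Coalgebra.counit (R := k) (A := B)).rTensor (M ⊗[k] N) (Ψ (s ⊗ₜ t))) =
          (TensorProduct.lid k M ((Coalgebra.counit (R := k) (A := B)).rTensor M s)) ⊗ₜ
            (TensorProduct.lid k N ((Coalgebra.counit (R := k) (A := B)).rTensor N t)) := by
        intro s t
        induction s with
        | zero => simp
        | add x y hx hy => simp only [TensorProduct.add_tmul, map_add, hx, hy]
        | tmul b m =>
        induction t with
        | zero => simp
        | add x y hx hy => simp only [TensorProduct.tmul_add, map_add, hx, hy]
        | tmul c n =>
          simp [Ψ, TensorProduct.smul_tmul', TensorProduct.tmul_smul, smul_smul, mul_comm]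
      rw [h0, h1, hM.counit, hN.counit]

/-- The action of `A ⊗ A'` on `M ⊗ N` by an action of `A` on `M` and one of `A'` on `N`. -/
noncomputable def act2 {A A' : Type u} [Ring A] [Algebra k A] [Ring A'] [Algebra k A']
    (f : A →ₐ[k] Module.End k M) (g : A' →ₐ[k] Module.End k N) :
    A ⊗[k] A' →ₐ[k] Module.End k (M ⊗[k] N) :=
  Module.endTensorEndAlgHom.comp (Algebra.TensorProduct.map f g)

@[simp]
theorem act2_tmul {A A' : Type u} [Ring A] [Algebra k A] [Ring A'] [Algebra k A']
    (f : A →ₐ[k] Module.End k M) (g : A' →ₐ[k] Module.End k N) (b : A) (c : A') (m : M) (n : N) :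
    act2 f g (b ⊗ₜ c) (m ⊗ₜ n) = f b m ⊗ₜ g c n := rfl

/-- The diagonal action `b (m ⊗ n) = b₁ m ⊗ b₂ n` of `B` on `M ⊗ N`. -/
noncomputable def diagAct (f : B →ₐ[k] Module.End k M) (g : B →ₐ[k] Module.End k N) :
    B →ₐ[k] Module.End k (M ⊗[k] N) :=
  (act2 f g).comp (Bialgebra.comulAlgHom k B)

theorem diagAct_apply (f : B →ₐ[k] Module.End k M) (g : B →ₐ[k] Module.End k N) (b : B) :
    diagAct f g b = act2 f g (Coalgebra.comul (R := k) b) := rfl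

theorem diagAct_map {f : B →ₐ[k] Module.End k M} {g : B →ₐ[k] Module.End k N}
    {f' : B →ₐ[k] Module.End k M'} {g' : B →ₐ[k] Module.End k N'}
    {φ : M →ₗ[k] M'} {ψ : N →ₗ[k] N'} (hφ : ∀ b m, φ (f b m) = f' b (φ m))
    (hψ : ∀ b n, ψ (g b n) = g' b (ψ n)) (b : B) (t : M ⊗[k] N) :
    TensorProduct.map φ ψ (diagAct f g b t) = diagAct f' g' b (TensorProduct.map φ ψ t) := by
  simp only [diagAct_apply]
  generalize (Coalgebra.comul (R := k) b) = d
  induction d with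
  | zero => simp
  | add x y hx hy => simp only [map_add, LinearMap.add_apply, hx, hy]
  | tmul a c =>
    induction t with
    | zero => simp
    | add x y hx hy => simp only [map_add, hx, hy]
    | tmul m n => simp [act2_tmul, hφ, hψ]

theorem diagAct_assoc (f : B →ₐ[k] Module.End k M) (g : B →ₐ[k] Module.End k N)
    (h : B →ₐ[k] Module.End k P) (b : B) (t : (M ⊗[k] N) ⊗[k] P) :
    TensorProduct.assoc k M N P (diagAct (diagAct f g) h b t) =
      diagAct f (diagAct g h) b (TensorProduct.assoc k M N P t) := by
  have h1 : ∀ d : B ⊗[k] B, TensorProduct.assoc k M N P (act2 (diagAct f g) h d t) =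
      act2 f (act2 g h) (TensorProduct.assoc k B B B
        ((Coalgebra.comul (R := k) (A := B)).rTensor B d)) (TensorProduct.assoc k M N P t) := by
    intro d
    induction d with
    | zero => simp
    | add x y hx hy => simp only [map_add, LinearMap.add_apply, hx, hy]
    | tmul a c =>
      induction t with
      | zero => simp
      | add x y hx hy => simp only [map_add, hx, hy]
      | tmul mn p =>
      induction mn with
      | zero => simp
      | add x y hx hy => simp only [TensorProduct.add_tmul, map_add, hx, hy]
      | tmul m n =>
        simp only [act2_tmul, diagAct_apply, LinearMap.rTensor_tmul, TensorProduct.assoc_tmul]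
        generalize (Coalgebra.comul (R := k) a) = e
        induction e with
        | zero => simp
        | add x y hx hy =>
          simp only [TensorProduct.add_tmul, map_add, LinearMap.add_apply, hx, hy]
        | tmul a b => simp
  have h2 : ∀ (d : B ⊗[k] B) (t : M ⊗[k] (N ⊗[k] P)), act2 f (diagAct g h) d t =
      act2 f (act2 g h) ((Coalgebra.comul (R := k) (A := B)).lTensor B d) t := by
    intro d t
    induction d with
    | zero => simp
    | add x y hx hy => simp only [map_add, LinearMap.add_apply, hx, hy]
    | tmul a c =>
      induction t with
      | zero => simp
      | add x y hx hy => simp only [map_add, hx, hy]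
      | tmul m np => simp only [act2_tmul, diagAct_apply, LinearMap.lTensor_tmul]
  rw [diagAct_apply, h1, Coalgebra.coassoc_apply, diagAct_apply, h2]

/-- The regular left action of `B` on itself. -/
noncomputable def regAct : B →ₐ[k] Module.End k B := Algebra.lmul k B

/-- The cotensor product `X □ N`, the equaliser of `ρ ⊗ N` and `X ⊗ δ` inside `X ⊗ N`. -/
def cotensor (ρ : M →ₗ[k] M ⊗[k] B) (δ : N →ₗ[k] B ⊗[k] N) : Submodule k (M ⊗[k] N) :=
  LinearMap.eqLocus ((TensorProduct.assoc k M B N).toLinearMap ∘ₗ ρ.rTensor N) (δ.lTensor M)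

theorem mem_cotensor {ρ : M →ₗ[k] M ⊗[k] B} {δ : N →ₗ[k] B ⊗[k] N} {t : M ⊗[k] N} :
    t ∈ cotensor ρ δ ↔ TensorProduct.assoc k M B N (ρ.rTensor N t) = δ.lTensor M t :=
  Iff.rfl

theorem outerL_mem {ρ : M →ₗ[k] M ⊗[k] B} {δ : N →ₗ[k] B ⊗[k] N} {l : M →ₗ[k] B ⊗[k] M}
    (hl : ∀ m, TensorProduct.assoc k B M B (l.rTensor B (ρ m)) = ρ.lTensor B (l m))
    {t : M ⊗[k] N} (ht : t ∈ cotensor ρ δ) :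
    outerL l N t ∈ LinearMap.range ((cotensor ρ δ).subtype.lTensor B) := by
  apply mem_range_lTensor
  have h1 : ∀ t : M ⊗[k] N, ((TensorProduct.assoc k M B N).toLinearMap ∘ₗ ρ.rTensor N).lTensor B
      (outerL l N t) = outerL l (B ⊗[k] N) (TensorProduct.assoc k M B N (ρ.rTensor N t)) := by
    intro t
    induction t with
    | zero => simp
    | add x y hx hy => simp only [map_add, hx, hy]
    | tmul m n =>
      have e1 : ∀ s : M ⊗[k] B, outerL l (B ⊗[k] N) (TensorProduct.assoc k M B N (s ⊗ₜ n)) =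
          (TensorProduct.assoc k M B N).toLinearMap.lTensor B (TensorProduct.assoc k B (M ⊗[k] B) N
            (TensorProduct.assoc k B M B (l.rTensor B s) ⊗ₜ n)) := by
        intro s
        induction s with
        | zero => simp
        | add x y hx hy => simp only [TensorProduct.add_tmul, map_add, hx, hy]
        | tmul m b =>
          simp only [outerL, LinearMap.comp_apply, LinearEquiv.coe_coe, TensorProduct.assoc_tmul,
            LinearMap.rTensor_tmul]
          generalize l m = e
          induction e with
          | zero => simp
          | add x y hx hy => simp only [TensorProduct.add_tmul, map_add, hx, hy]
          | tmul a b => simp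
      have e2 : ∀ s : B ⊗[k] M, ((TensorProduct.assoc k M B N).toLinearMap ∘ₗ
          ρ.rTensor N).lTensor B (TensorProduct.assoc k B M N (s ⊗ₜ n)) =
          (TensorProduct.assoc k M B N).toLinearMap.lTensor B (TensorProduct.assoc k B (M ⊗[k] B) N
            (ρ.lTensor B s ⊗ₜ n)) := by
        intro s
        induction s with
        | zero => simp
        | add x y hx hy => simp only [TensorProduct.add_tmul, map_add, hx, hy]
        | tmul b m => simp
      rw [LinearMap.rTensor_tmul, e1, hl, ← e2]
      simp [outerL]
  have h2 : ∀ t : M ⊗[k] N, (δ.lTensor M).lTensor B (outerL l N t) =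
      outerL l (B ⊗[k] N) (δ.lTensor M t) := by
    intro t
    induction t with
    | zero => simp
    | add x y hx hy => simp only [map_add, hx, hy]
    | tmul m n =>
      simp only [outerL, LinearMap.comp_apply, LinearEquiv.coe_coe, LinearMap.lTensor_tmul,
        LinearMap.rTensor_tmul]
      generalize l m = e
      induction e with
      | zero => simp
      | add x y hx hy => simp only [TensorProduct.add_tmul, map_add, hx, hy]
      | tmul a b => simp
  rw [h1, h2, mem_cotensor.1 ht]

theorem outerR_mem {ρ : M →ₗ[k] M ⊗[k] B} {δ : N →ₗ[k] B ⊗[k] N} {r : N →ₗ[k] N ⊗[k] B}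
    (hr : ∀ n, TensorProduct.assoc k B N B (δ.rTensor B (r n)) = r.lTensor B (δ n))
    {t : M ⊗[k] N} (ht : t ∈ cotensor ρ δ) :
    outerR M r t ∈ LinearMap.range ((cotensor ρ δ).subtype.rTensor B) := by
  apply mem_range_rTensor
  let K : M ⊗[k] (B ⊗[k] N) →ₗ[k] (M ⊗[k] (B ⊗[k] N)) ⊗[k] B :=
    (TensorProduct.assoc k M (B ⊗[k] N) B).symm.toLinearMap ∘ₗ
      ((TensorProduct.assoc k B N B).symm.toLinearMap ∘ₗ r.lTensor B).lTensor M
  have h1 : ∀ t : M ⊗[k] N, ((TensorProduct.assoc k M B N).toLinearMap ∘ₗ ρ.rTensor N).rTensor B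
      (outerR M r t) = K (TensorProduct.assoc k M B N (ρ.rTensor N t)) := by
    intro t
    induction t with
    | zero => simp
    | add x y hx hy => simp only [map_add, hx, hy]
    | tmul m n =>
      simp only [outerR, K, LinearMap.comp_apply, LinearEquiv.coe_coe, LinearMap.lTensor_tmul,
        LinearMap.rTensor_tmul]
      have e0 : ∀ s : M ⊗[k] B, (TensorProduct.assoc k M (B ⊗[k] N) B).symm
          (((TensorProduct.assoc k B N B).symm.toLinearMap ∘ₗ r.lTensor B).lTensor M
            (TensorProduct.assoc k M B N (s ⊗ₜ n))) =
          (TensorProduct.assoc k M B N).toLinearMap.rTensor B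
            ((TensorProduct.assoc k (M ⊗[k] B) N B).symm (s ⊗ₜ r n)) := by
        intro s
        induction s with
        | zero => simp
        | add x y hx hy => simp only [TensorProduct.add_tmul, map_add, hx, hy]
        | tmul m b =>
          simp only [TensorProduct.assoc_tmul, LinearMap.lTensor_tmul, LinearMap.comp_apply,
            LinearEquiv.coe_coe]
          generalize r n = e
          induction e with
          | zero => simp
          | add x y hx hy => simp only [TensorProduct.tmul_add, map_add, hx, hy]
          | tmul a b => simp
      rw [e0]
      generalize r n = e
      induction e with
      | zero => simp
      | add x y hx hy => simp only [TensorProduct.tmul_add, map_add, hx, hy]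
      | tmul a b => simp
  have h2 : ∀ t : M ⊗[k] N, (δ.lTensor M).rTensor B (outerR M r t) =
      K (δ.lTensor M t) := by
    intro t
    induction t with
    | zero => simp
    | add x y hx hy => simp only [map_add, hx, hy]
    | tmul m n =>
      simp only [outerR, K, LinearMap.comp_apply, LinearEquiv.coe_coe, LinearMap.lTensor_tmul,
        ← hr, LinearEquiv.symm_apply_apply]
      generalize r n = e
      induction e with
      | zero => simp
      | add x y hx hy => simp only [TensorProduct.tmul_add, map_add, hx, hy]
      | tmul a b => simp
  rw [h1, h2, mem_cotensor.1 ht]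

theorem diagAct_mem {ρ : M →ₗ[k] M ⊗[k] B} {δ : N →ₗ[k] B ⊗[k] N}
    {f : B →ₐ[k] Module.End k M} {g : B →ₐ[k] Module.End k N}
    (hf : ∀ b m, ρ (f b m) = diagAct f regAct b (ρ m))
    (hg : ∀ b n, δ (g b n) = diagAct regAct g b (δ n)) (b : B)
    {t : M ⊗[k] N} (ht : t ∈ cotensor ρ δ) : diagAct f g b t ∈ cotensor ρ δ := by
  rw [mem_cotensor] at ht ⊢
  have h1 := diagAct_map (f := f) (g := g) (f' := diagAct f regAct) (g' := g) (φ := ρ)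
    (ψ := LinearMap.id) hf (fun _ _ => rfl) b t
  have h2 := diagAct_map (f := f) (g := g) (f' := f) (g' := diagAct regAct g)
    (φ := LinearMap.id) (ψ := δ) (fun _ _ => rfl) hg b t
  rw [LinearMap.rTensor, h1, diagAct_assoc, LinearMap.lTensor, h2]
  rw [LinearMap.rTensor, LinearMap.lTensor] at ht
  rw [ht]

theorem tensorCoact_map {δM : M →ₗ[k] B ⊗[k] M} {δN : N →ₗ[k] B ⊗[k] N}
    {δM' : M' →ₗ[k] B ⊗[k] M'} {δN' : N' →ₗ[k] B ⊗[k] N'} {f : M →ₗ[k] M'} {g : N →ₗ[k] N'}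
    (hf : ∀ m, δM' (f m) = f.lTensor B (δM m)) (hg : ∀ n, δN' (g n) = g.lTensor B (δN n))
    (t : M ⊗[k] N) : tensorCoact δM' δN' (TensorProduct.map f g t) =
      (TensorProduct.map f g).lTensor B (tensorCoact δM δN t) := by
  induction t with
  | zero => simp
  | add x y hx hy => simp only [map_add, hx, hy]
  | tmul m n =>
    simp only [tensorCoact, TensorProduct.map_tmul, LinearMap.comp_apply, LinearEquiv.coe_coe,
      hf, hg]
    generalize δM m = s
    generalize δN n = t
    induction s with
    | zero => simp
    | add x y hx hy => simp only [TensorProduct.add_tmul, map_add, hx, hy]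
    | tmul b m =>
    induction t with
    | zero => simp
    | add x y hx hy => simp only [TensorProduct.tmul_add, map_add, hx, hy]
    | tmul c n => simp

theorem tensorCoact_assoc (δM : M →ₗ[k] B ⊗[k] M) (δN : N →ₗ[k] B ⊗[k] N)
    (δP : P →ₗ[k] B ⊗[k] P) (t : (M ⊗[k] N) ⊗[k] P) :
    tensorCoact δM (tensorCoact δN δP) (TensorProduct.assoc k M N P t) =
      (TensorProduct.assoc k M N P).toLinearMap.lTensor B
        (tensorCoact (tensorCoact δM δN) δP t) := by
  induction t with
  | zero => simp
  | add x y hx hy => simp only [map_add, hx, hy]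
  | tmul mn p =>
  induction mn with
  | zero => simp
  | add x y hx hy => simp only [TensorProduct.add_tmul, map_add, hx, hy]
  | tmul m n =>
    simp only [tensorCoact, TensorProduct.assoc_tmul, TensorProduct.map_tmul,
      LinearMap.comp_apply, LinearEquiv.coe_coe]
    generalize δM m = s
    generalize δN n = t
    generalize δP p = r
    induction s with
    | zero => simp
    | add x y hx hy => simp only [TensorProduct.add_tmul, map_add, hx, hy]
    | tmul b m =>
    induction t with
    | zero => simp
    | add x y hx hy =>
      simp only [TensorProduct.add_tmul, TensorProduct.tmul_add, map_add, hx, hy]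
    | tmul c n =>
    induction r with
    | zero => simp
    | add x y hx hy =>
      simp only [TensorProduct.tmul_add, map_add, hx, hy]
    | tmul d p => simp [mul_assoc]

theorem tensorCoact_lid (δ : M →ₗ[k] B ⊗[k] M) (t : k ⊗[k] M) :
    δ (TensorProduct.lid k M t) = (TensorProduct.lid k M).toLinearMap.lTensor B
      (tensorCoact (TensorProduct.mk k B k 1) δ t) := by
  induction t with
  | zero => simp
  | add x y hx hy => simp only [map_add, hx, hy]
  | tmul c m =>
    simp only [tensorCoact, TensorProduct.map_tmul, LinearMap.comp_apply, LinearEquiv.coe_coe,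
      TensorProduct.lid_tmul, map_smul, TensorProduct.mk_apply]
    generalize δ m = s
    induction s with
    | zero => simp
    | add x y hx hy => simp only [TensorProduct.tmul_add, map_add, smul_add, hx, hy]
    | tmul b m => simp

theorem tensorCoact_rid (δ : M →ₗ[k] B ⊗[k] M) (t : M ⊗[k] k) :
    δ (TensorProduct.rid k M t) = (TensorProduct.rid k M).toLinearMap.lTensor B
      (tensorCoact δ (TensorProduct.mk k B k 1) t) := by
  induction t with
  | zero => simp
  | add x y hx hy => simp only [map_add, hx, hy]
  | tmul m c =>
    simp only [tensorCoact, TensorProduct.map_tmul, LinearMap.comp_apply, LinearEquiv.coe_coe,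
      TensorProduct.rid_tmul, map_smul, TensorProduct.mk_apply]
    generalize δ m = s
    induction s with
    | zero => simp
    | add x y hx hy => simp only [TensorProduct.add_tmul, map_add, smul_add, hx, hy]
    | tmul b m => simp

theorem comul_mul' (t : B ⊗[k] B) : Coalgebra.comul (R := k) (LinearMap.mul' k B t) =
    (LinearMap.mul' k B).lTensor B (tensorCoact (Coalgebra.comul (R := k) (A := B))
      (Coalgebra.comul (R := k) (A := B)) t) := by
  induction t with
  | zero => simp
  | add x y hx hy => simp only [map_add, hx, hy]
  | tmul a b =>
    simp only [tensorCoact, TensorProduct.map_tmul, LinearMap.comp_apply, LinearEquiv.coe_coe,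
      LinearMap.mul'_apply, Bialgebra.comul_mul]
    generalize (Coalgebra.comul (R := k) a) = s
    generalize (Coalgebra.comul (R := k) b) = t
    induction s with
    | zero => simp
    | add x y hx hy => simp only [TensorProduct.add_tmul, add_mul, map_add, hx, hy]
    | tmul b m =>
    induction t with
    | zero => simp
    | add x y hx hy => simp only [TensorProduct.tmul_add, mul_add, map_add, hx, hy]
    | tmul c n => simp

/-- For a functional `φ` on `B` and a right coaction `ρ` on `M`, the map `m ↦ m₀ φ(m₁)`. -/
noncomputable def contract (ρ : M →ₗ[k] M ⊗[k] B) (φ : B →ₗ[k] k) : M →ₗ[k] M :=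
  (TensorProduct.rid k M).toLinearMap ∘ₗ φ.lTensor M ∘ₗ ρ

theorem contract_comm {ρ : M →ₗ[k] M ⊗[k] B} {δ : M →ₗ[k] B ⊗[k] M}
    (h : ∀ m, TensorProduct.assoc k B M B (δ.rTensor B (ρ m)) = ρ.lTensor B (δ m))
    (φ : B →ₗ[k] k) (m : M) : δ (contract ρ φ m) = (contract ρ φ).lTensor B (δ m) := by
  have h1 : ∀ t : M ⊗[k] B, δ (TensorProduct.rid k M (φ.lTensor M t)) =
      ((TensorProduct.rid k M).toLinearMap ∘ₗ φ.lTensor M).lTensor B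
        (TensorProduct.assoc k B M B (δ.rTensor B t)) := by
    intro t
    induction t with
    | zero => simp
    | add x y hx hy => simp only [map_add, hx, hy]
    | tmul a b =>
      simp only [LinearMap.lTensor_tmul, TensorProduct.rid_tmul, LinearMap.rTensor_tmul, map_smul]
      generalize δ a = s
      induction s with
      | zero => simp
      | add x y hx hy => simp only [TensorProduct.add_tmul, smul_add, map_add, hx, hy]
      | tmul b m => simp
  simp only [contract, LinearMap.comp_apply, LinearEquiv.coe_coe]
  rw [h1, h, ← LinearMap.comp_apply, ← LinearMap.lTensor_comp]
  rfl

end LinearAlgebra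

section Cotensor

variable {k B : Type u} [Field k] [Ring B] [Bialgebra k B]
variable {X Y Z X' Y' : Type u} [AddCommGroup X] [Module k X] [AddCommGroup Y] [Module k Y]
  [AddCommGroup Z] [Module k Z] [AddCommGroup X'] [Module k X'] [AddCommGroup Y'] [Module k Y']

theorem bicomodule_of_injective {δ : X →ₗ[k] B ⊗[k] X} {ρ : X →ₗ[k] X ⊗[k] B}
    {δ' : Y →ₗ[k] B ⊗[k] Y} {ρ' : Y →ₗ[k] Y ⊗[k] B}
    (h : ∀ x, TensorProduct.assoc k B X B (δ.rTensor B (ρ x)) = ρ.lTensor B (δ x))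
    (i : Y →ₗ[k] X) (hi : Function.Injective i)
    (hl : ∀ y, i.lTensor B (δ' y) = δ (i y)) (hr : ∀ y, i.rTensor B (ρ' y) = ρ (i y)) (y : Y) :
    TensorProduct.assoc k B Y B (δ'.rTensor B (ρ' y)) = ρ'.lTensor B (δ' y) := by
  apply lTensor_inj B (rTensor_inj B hi)
  have h1 : ∀ t : Y ⊗[k] B, (i.rTensor B).lTensor B
      (TensorProduct.assoc k B Y B (δ'.rTensor B t)) =
      TensorProduct.assoc k B X B (δ.rTensor B (i.rTensor B t)) := by
    intro t
    induction t with
    | zero => simp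
    | add x y hx hy => simp only [map_add, hx, hy]
    | tmul y b =>
      simp only [LinearMap.rTensor_tmul, ← hl]
      generalize δ' y = e
      induction e with
      | zero => simp
      | add x y hx hy => simp only [TensorProduct.add_tmul, map_add, hx, hy]
      | tmul a b => simp
  have h2 : ∀ t : B ⊗[k] Y, (i.rTensor B).lTensor B (ρ'.lTensor B t) =
      ρ.lTensor B (i.lTensor B t) := by
    intro t
    induction t with
    | zero => simp
    | add x y hx hy => simp only [map_add, hx, hy]
    | tmul b y => simp [hr]
  rw [h1, h2, hr, hl, h]

theorem outer_bicomodule (δ : X →ₗ[k] B ⊗[k] X) (ρ : Y →ₗ[k] Y ⊗[k] B) (t : X ⊗[k] Y) :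
    TensorProduct.assoc k B (X ⊗[k] Y) B ((outerL δ Y).rTensor B (outerR X ρ t)) =
      (outerR X ρ).lTensor B (outerL δ Y t) := by
  induction t with
  | zero => simp
  | add x y hx hy => simp only [map_add, hx, hy]
  | tmul x y =>
    have e1 : ∀ s : Y ⊗[k] B, TensorProduct.assoc k B (X ⊗[k] Y) B ((outerL δ Y).rTensor B
        ((TensorProduct.assoc k X Y B).symm (x ⊗ₜ s))) =
        (TensorProduct.assoc k X Y B).symm.toLinearMap.lTensor B
          (TensorProduct.assoc k B X (Y ⊗[k] B) (δ x ⊗ₜ s)) := by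
      intro s
      induction s with
      | zero => simp
      | add x y hx hy => simp only [TensorProduct.tmul_add, map_add, hx, hy]
      | tmul y b =>
        simp only [outerL, LinearMap.comp_apply, LinearEquiv.coe_coe, TensorProduct.assoc_symm_tmul,
          LinearMap.rTensor_tmul]
        generalize δ x = e
        induction e with
        | zero => simp
        | add x y hx hy => simp only [TensorProduct.add_tmul, map_add, hx, hy]
        | tmul a b => simp
    have e2 : ∀ s : B ⊗[k] X, (outerR X ρ).lTensor B (TensorProduct.assoc k B X Y (s ⊗ₜ y)) =
        (TensorProduct.assoc k X Y B).symm.toLinearMap.lTensor B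
          (TensorProduct.assoc k B X (Y ⊗[k] B) (s ⊗ₜ ρ y)) := by
      intro s
      induction s with
      | zero => simp
      | add x y hx hy => simp only [TensorProduct.add_tmul, map_add, hx, hy]
      | tmul b x => simp [outerR]
    have h1 : outerR X ρ (x ⊗ₜ y) = (TensorProduct.assoc k X Y B).symm (x ⊗ₜ ρ y) := by
      simp [outerR]
    have h2 : outerL δ Y (x ⊗ₜ y) = TensorProduct.assoc k B X Y (δ x ⊗ₜ y) := by simp [outerL]
    rw [h1, h2, e1, e2]

theorem map_outerL {δ : X →ₗ[k] B ⊗[k] X} {δ' : X' →ₗ[k] B ⊗[k] X'} {f : X →ₗ[k] X'}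
    (hf : ∀ x, δ' (f x) = f.lTensor B (δ x)) (g : Y →ₗ[k] Y') (t : X ⊗[k] Y) :
    outerL δ' Y' (TensorProduct.map f g t) =
      (TensorProduct.map f g).lTensor B (outerL δ Y t) := by
  induction t with
  | zero => simp
  | add x y hx hy => simp only [map_add, hx, hy]
  | tmul x y =>
    simp only [outerL, LinearMap.comp_apply, LinearEquiv.coe_coe, TensorProduct.map_tmul,
      LinearMap.rTensor_tmul, hf]
    generalize δ x = e
    induction e with
    | zero => simp
    | add x y hx hy => simp only [TensorProduct.add_tmul, map_add, hx, hy]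
    | tmul a b => simp

theorem map_outerR {ρ : Y →ₗ[k] Y ⊗[k] B} {ρ' : Y' →ₗ[k] Y' ⊗[k] B} (f : X →ₗ[k] X')
    {g : Y →ₗ[k] Y'} (hg : ∀ y, ρ' (g y) = g.rTensor B (ρ y)) (t : X ⊗[k] Y) :
    outerR X' ρ' (TensorProduct.map f g t) =
      (TensorProduct.map f g).rTensor B (outerR X ρ t) := by
  induction t with
  | zero => simp
  | add x y hx hy => simp only [map_add, hx, hy]
  | tmul x y =>
    simp only [outerR, LinearMap.comp_apply, LinearEquiv.coe_coe, TensorProduct.map_tmul,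
      LinearMap.lTensor_tmul, hg]
    generalize ρ y = e
    induction e with
    | zero => simp
    | add x y hx hy => simp only [TensorProduct.tmul_add, map_add, hx, hy]
    | tmul a b => simp

theorem assoc_outerL (δ : X →ₗ[k] B ⊗[k] X) (t : (X ⊗[k] Y) ⊗[k] Z) :
    outerL δ (Y ⊗[k] Z) (TensorProduct.assoc k X Y Z t) =
      (TensorProduct.assoc k X Y Z).toLinearMap.lTensor B (outerL (outerL δ Y) Z t) := by
  induction t with
  | zero => simp
  | add x y hx hy => simp only [map_add, hx, hy]
  | tmul xy z =>
  induction xy with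
  | zero => simp
  | add x y hx hy => simp only [TensorProduct.add_tmul, map_add, hx, hy]
  | tmul x y =>
    simp only [outerL, LinearMap.comp_apply, LinearEquiv.coe_coe, TensorProduct.assoc_tmul,
      LinearMap.rTensor_tmul]
    generalize δ x = e
    induction e with
    | zero => simp
    | add x y hx hy => simp only [TensorProduct.add_tmul, map_add, hx, hy]
    | tmul a b => simp

theorem assoc_outerR (ρ : Z →ₗ[k] Z ⊗[k] B) (t : (X ⊗[k] Y) ⊗[k] Z) :
    outerR X (outerR Y ρ) (TensorProduct.assoc k X Y Z t) =
      (TensorProduct.assoc k X Y Z).toLinearMap.rTensor B (outerR (X ⊗[k] Y) ρ t) := by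
  induction t with
  | zero => simp
  | add x y hx hy => simp only [map_add, hx, hy]
  | tmul xy z =>
  induction xy with
  | zero => simp
  | add x y hx hy => simp only [TensorProduct.add_tmul, map_add, hx, hy]
  | tmul x y =>
    simp only [outerR, LinearMap.comp_apply, LinearEquiv.coe_coe, TensorProduct.assoc_tmul,
      LinearMap.lTensor_tmul]
    generalize ρ z = e
    induction e with
    | zero => simp
    | add x y hx hy => simp only [TensorProduct.tmul_add, map_add, hx, hy]
    | tmul a b => simp

theorem cotensor_map_eq {ρ : X →ₗ[k] X ⊗[k] B} {ρ' : X' →ₗ[k] X' ⊗[k] B} {f : X →ₗ[k] X'}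
    (hf : ∀ x, ρ' (f x) = f.rTensor B (ρ x)) (g : Y →ₗ[k] Y') (t : X ⊗[k] Y) :
    TensorProduct.assoc k X' B Y' (ρ'.rTensor Y' (TensorProduct.map f g t)) =
      TensorProduct.map f (g.lTensor B) (TensorProduct.assoc k X B Y (ρ.rTensor Y t)) := by
  induction t with
  | zero => simp
  | add x y hx hy => simp only [map_add, hx, hy]
  | tmul x y =>
    simp only [TensorProduct.map_tmul, LinearMap.rTensor_tmul, hf]
    generalize ρ x = e
    induction e with
    | zero => simp
    | add x y hx hy => simp only [TensorProduct.add_tmul, map_add, hx, hy]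
    | tmul a b => simp

theorem cotensor_map_eq' {δ : Y →ₗ[k] B ⊗[k] Y} {δ' : Y' →ₗ[k] B ⊗[k] Y'} (f : X →ₗ[k] X')
    {g : Y →ₗ[k] Y'} (hg : ∀ y, δ' (g y) = g.lTensor B (δ y)) (t : X ⊗[k] Y) :
    δ'.lTensor X' (TensorProduct.map f g t) =
      TensorProduct.map f (g.lTensor B) (δ.lTensor X t) := by
  induction t with
  | zero => simp
  | add x y hx hy => simp only [map_add, hx, hy]
  | tmul x y => simp [hg]

theorem map_mem_cotensor {ρ : X →ₗ[k] X ⊗[k] B} {ρ' : X' →ₗ[k] X' ⊗[k] B}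
    {δ : Y →ₗ[k] B ⊗[k] Y} {δ' : Y' →ₗ[k] B ⊗[k] Y'} {f : X →ₗ[k] X'} {g : Y →ₗ[k] Y'}
    (hf : ∀ x, ρ' (f x) = f.rTensor B (ρ x)) (hg : ∀ y, δ' (g y) = g.lTensor B (δ y))
    {t : X ⊗[k] Y} (ht : t ∈ cotensor ρ δ) : TensorProduct.map f g t ∈ cotensor ρ' δ' := by
  rw [mem_cotensor] at ht ⊢
  rw [cotensor_map_eq hf, ht, cotensor_map_eq' f hg]

theorem map_injective {f : X →ₗ[k] X'} {g : Y →ₗ[k] Y'} (hf : Function.Injective f)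
    (hg : Function.Injective g) : Function.Injective (TensorProduct.map f g) := by
  rw [← LinearMap.rTensor_comp_lTensor]
  exact (rTensor_inj Y' hf).comp (lTensor_inj X hg)

theorem map_mem_cotensor_iff {ρ : X →ₗ[k] X ⊗[k] B} {ρ' : X' →ₗ[k] X' ⊗[k] B}
    {δ : Y →ₗ[k] B ⊗[k] Y} {δ' : Y' →ₗ[k] B ⊗[k] Y'} {f : X →ₗ[k] X'} {g : Y →ₗ[k] Y'}
    (hf : ∀ x, ρ' (f x) = f.rTensor B (ρ x)) (hg : ∀ y, δ' (g y) = g.lTensor B (δ y))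
    (hfi : Function.Injective f) (hgi : Function.Injective g) {t : X ⊗[k] Y} :
    TensorProduct.map f g t ∈ cotensor ρ' δ' ↔ t ∈ cotensor ρ δ := by
  refine ⟨fun h => ?_, map_mem_cotensor hf hg⟩
  rw [mem_cotensor] at h ⊢
  rw [cotensor_map_eq hf, cotensor_map_eq' f hg] at h
  exact map_injective hfi (lTensor_inj B hgi) h

/-- The condition on `(X ⊗ Y) ⊗ Z` at the first spot does not depend on the bracketing. -/
theorem triple_left_iff (ρ : X →ₗ[k] X ⊗[k] B) (δ : Y →ₗ[k] B ⊗[k] Y) (t : (X ⊗[k] Y) ⊗[k] Z) :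
    TensorProduct.assoc k X Y Z t ∈ cotensor ρ (outerL δ Z) ↔
      t ∈ LinearMap.range ((cotensor ρ δ).subtype.rTensor Z) := by
  let e : (X ⊗[k] (B ⊗[k] Y)) ⊗[k] Z ≃ₗ[k] X ⊗[k] (B ⊗[k] (Y ⊗[k] Z)) :=
    TensorProduct.assoc k X (B ⊗[k] Y) Z ≪≫ₗ
      (TensorProduct.assoc k B Y Z).lTensor X
  have h1 : ∀ t : (X ⊗[k] Y) ⊗[k] Z, TensorProduct.assoc k X B (Y ⊗[k] Z)
      (ρ.rTensor (Y ⊗[k] Z) (TensorProduct.assoc k X Y Z t)) =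
      e (((TensorProduct.assoc k X B Y).toLinearMap ∘ₗ ρ.rTensor Y).rTensor Z t) := by
    intro t
    induction t with
    | zero => simp
    | add x y hx hy => simp only [map_add, hx, hy]
    | tmul xy z =>
    induction xy with
    | zero => simp
    | add x y hx hy => simp only [TensorProduct.add_tmul, map_add, hx, hy]
    | tmul x y =>
      simp only [LinearMap.comp_apply, LinearEquiv.coe_coe, TensorProduct.assoc_tmul,
        LinearMap.rTensor_tmul]
      generalize ρ x = s
      induction s with
      | zero => simp
      | add x y hx hy => simp only [TensorProduct.add_tmul, map_add, hx, hy]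
      | tmul a b => simp [e]
  have h2 : ∀ t : (X ⊗[k] Y) ⊗[k] Z, (outerL δ Z).lTensor X (TensorProduct.assoc k X Y Z t) =
      e ((δ.lTensor X).rTensor Z t) := by
    intro t
    induction t with
    | zero => simp
    | add x y hx hy => simp only [map_add, hx, hy]
    | tmul xy z =>
    induction xy with
    | zero => simp
    | add x y hx hy => simp only [TensorProduct.add_tmul, map_add, hx, hy]
    | tmul x y => simp [e, outerL]
  rw [mem_cotensor, h1, h2, e.injective.eq_iff]
  refine ⟨mem_range_rTensor Z _ _ t, ?_⟩
  rintro ⟨s, rfl⟩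
  induction s with
  | zero => simp
  | add x y hx hy => simp only [map_add, hx, hy]
  | tmul a z => simpa using congrArg (· ⊗ₜ[k] z) (mem_cotensor.1 a.2)

/-- The condition on `(X ⊗ Y) ⊗ Z` at the second spot does not depend on the bracketing. -/
theorem triple_right_iff (ρ : Y →ₗ[k] Y ⊗[k] B) (δ : Z →ₗ[k] B ⊗[k] Z)
    (t : (X ⊗[k] Y) ⊗[k] Z) :
    t ∈ cotensor (outerR X ρ) δ ↔ TensorProduct.assoc k X Y Z t ∈
      LinearMap.range ((cotensor ρ δ).subtype.lTensor X) := by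
  let e := TensorProduct.assoc k X Y (B ⊗[k] Z)
  have h1 : ∀ t : (X ⊗[k] Y) ⊗[k] Z, e (TensorProduct.assoc k (X ⊗[k] Y) B Z
      ((outerR X ρ).rTensor Z t)) = ((TensorProduct.assoc k Y B Z).toLinearMap ∘ₗ
        ρ.rTensor Z).lTensor X (TensorProduct.assoc k X Y Z t) := by
    intro t
    induction t with
    | zero => simp
    | add x y hx hy => simp only [map_add, hx, hy]
    | tmul xy z =>
    induction xy with
    | zero => simp
    | add x y hx hy => simp only [TensorProduct.add_tmul, map_add, hx, hy]
    | tmul x y =>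
      simp only [outerR, LinearMap.comp_apply, LinearEquiv.coe_coe, TensorProduct.assoc_tmul,
        LinearMap.rTensor_tmul, LinearMap.lTensor_tmul]
      generalize ρ y = s
      induction s with
      | zero => simp
      | add x y hx hy =>
        simp only [TensorProduct.add_tmul, TensorProduct.tmul_add, map_add, hx, hy]
      | tmul a b => simp [e]
  have h2 : ∀ t : (X ⊗[k] Y) ⊗[k] Z, e (δ.lTensor (X ⊗[k] Y) t) =
      (δ.lTensor Y).lTensor X (TensorProduct.assoc k X Y Z t) := by
    intro t
    induction t with
    | zero => simp
    | add x y hx hy => simp only [map_add, hx, hy]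
    | tmul xy z =>
    induction xy with
    | zero => simp
    | add x y hx hy => simp only [TensorProduct.add_tmul, map_add, hx, hy]
    | tmul x y => simp [e]
  rw [mem_cotensor, ← e.injective.eq_iff, h1, h2]
  refine ⟨mem_range_lTensor X _ _ _, ?_⟩
  rintro ⟨s, hs⟩
  rw [← hs]
  clear hs
  induction s with
  | zero => simp
  | add x y hx hy => simp only [map_add, hx, hy]
  | tmul x a => simpa using congrArg (x ⊗ₜ[k] ·) (mem_cotensor.1 a.2)

theorem coact_mem_cotensor {δ : Y →ₗ[k] B ⊗[k] Y} (h : IsLeftCoaction δ) (y : Y) :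
    δ y ∈ cotensor (Coalgebra.comul (R := k) (A := B)) δ := h.coassoc y

theorem rcoact_mem_cotensor {ρ : X →ₗ[k] X ⊗[k] B} (h : IsRightCoaction ρ) (x : X) :
    ρ x ∈ cotensor ρ (Coalgebra.comul (R := k) (A := B)) := h.coassoc x

theorem coact_counit {δ : Y →ₗ[k] B ⊗[k] Y} {t : B ⊗[k] Y}
    (ht : t ∈ cotensor (Coalgebra.comul (R := k) (A := B)) δ) :
    δ (TensorProduct.lid k Y ((Coalgebra.counit (R := k) (A := B)).rTensor Y t)) = t := by
  have h1 : ∀ t : B ⊗[k] Y,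
      δ (TensorProduct.lid k Y ((Coalgebra.counit (R := k) (A := B)).rTensor Y t)) =
      TensorProduct.lid k (B ⊗[k] Y) ((Coalgebra.counit (R := k) (A := B)).rTensor (B ⊗[k] Y)
        (δ.lTensor B t)) := by
    intro t
    induction t with
    | zero => simp
    | add x y hx hy => simp only [map_add, hx, hy]
    | tmul b y => simp
  have h2 : ∀ t : B ⊗[k] Y,
      TensorProduct.lid k (B ⊗[k] Y) ((Coalgebra.counit (R := k) (A := B)).rTensor (B ⊗[k] Y)
        (TensorProduct.assoc k B B Y ((Coalgebra.comul (R := k) (A := B)).rTensor Y t))) = t := by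
    intro t
    induction t with
    | zero => simp
    | add x y hx hy => simp only [map_add, hx, hy]
    | tmul b y =>
      have h3 : ∀ s : B ⊗[k] B, TensorProduct.lid k (B ⊗[k] Y)
          ((Coalgebra.counit (R := k) (A := B)).rTensor (B ⊗[k] Y)
          (TensorProduct.assoc k B B Y (s ⊗ₜ y))) =
          TensorProduct.lid k B ((Coalgebra.counit (R := k) (A := B)).rTensor B s) ⊗ₜ y := by
        intro s
        induction s with
        | zero => simp
        | add x y hx hy => simp only [TensorProduct.add_tmul, map_add, hx, hy]
        | tmul b c => simp [TensorProduct.smul_tmul']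
      rw [LinearMap.rTensor_tmul, h3]
      simp
  rw [h1, ← mem_cotensor.1 ht, h2]

theorem rcoact_counit {ρ : X →ₗ[k] X ⊗[k] B} {t : X ⊗[k] B}
    (ht : t ∈ cotensor ρ (Coalgebra.comul (R := k) (A := B))) :
    ρ (TensorProduct.rid k X ((Coalgebra.counit (R := k) (A := B)).lTensor X t)) = t := by
  have h1 : ∀ t : X ⊗[k] B,
      ρ (TensorProduct.rid k X ((Coalgebra.counit (R := k) (A := B)).lTensor X t)) =
      ((TensorProduct.rid k B).toLinearMap ∘ₗ
        (Coalgebra.counit (R := k) (A := B)).lTensor B).lTensor X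
        (TensorProduct.assoc k X B B (ρ.rTensor B t)) := by
    intro t
    induction t with
    | zero => simp
    | add x y hx hy => simp only [map_add, hx, hy]
    | tmul x b =>
      simp only [LinearMap.lTensor_tmul, TensorProduct.rid_tmul, LinearMap.rTensor_tmul, map_smul]
      generalize ρ x = s
      induction s with
      | zero => simp
      | add x y hx hy => simp only [TensorProduct.add_tmul, smul_add, map_add, hx, hy]
      | tmul b c => simp
  have h2 : ∀ t : X ⊗[k] B, ((TensorProduct.rid k B).toLinearMap ∘ₗ
        (Coalgebra.counit (R := k) (A := B)).lTensor B).lTensor X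
        ((Coalgebra.comul (R := k) (A := B)).lTensor X t) = t := by
    intro t
    induction t with
    | zero => simp
    | add x y hx hy => simp only [map_add, hx, hy]
    | tmul x b => simp
  rw [h1, mem_cotensor.1 ht, h2]

/-- The map `m ⊗ (x ⊗ n) ↦ m₋₁ x ⊗ (m₀ ⊗ n)`. -/
noncomputable def interchange (δ : Z →ₗ[k] B ⊗[k] Z) (a : B →ₐ[k] Module.End k X)
    (Y : Type u) [AddCommGroup Y] [Module k Y] :
    Z ⊗[k] (X ⊗[k] Y) →ₗ[k] X ⊗[k] (Z ⊗[k] Y) :=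
  TensorProduct.map (TensorProduct.lift a.toLinearMap) LinearMap.id ∘ₗ
    (TensorProduct.tensorTensorTensorComm k B Z X Y).toLinearMap ∘ₗ δ.rTensor (X ⊗[k] Y)

end Cotensor

section Interchange

variable {k B : Type u} [Field k] [Ring B] [Bialgebra k B]
variable {X Y Z X' Y' Z' : Type u} [AddCommGroup X] [Module k X] [AddCommGroup Y] [Module k Y]
  [AddCommGroup Z] [Module k Z] [AddCommGroup X'] [Module k X'] [AddCommGroup Y'] [Module k Y']
  [AddCommGroup Z'] [Module k Z']

theorem interchange_tmul (δ : Z →ₗ[k] B ⊗[k] Z) (a : B →ₐ[k] Module.End k X) (z : Z) (x : X)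
    (y : Y) : interchange δ a Y (z ⊗ₜ (x ⊗ₜ y)) =
      TensorProduct.map (LinearMap.flip a.toLinearMap x) (TensorProduct.mk k Z Y |>.flip y)
        (δ z) := by
  simp only [interchange, LinearMap.comp_apply, LinearEquiv.coe_coe, LinearMap.rTensor_tmul]
  generalize δ z = s
  induction s with
  | zero => simp
  | add x y hx hy => simp only [TensorProduct.add_tmul, map_add, hx, hy]
  | tmul b z => simp

theorem interchange_coact {δZ : Z →ₗ[k] B ⊗[k] Z} (hZ : IsLeftCoaction δZ)
    {δ : X →ₗ[k] B ⊗[k] X} {a : B →ₐ[k] Module.End k X}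
    (ha : ∀ b x, δ (a b x) = diagAct regAct a b (δ x)) (t : Z ⊗[k] (X ⊗[k] Y)) :
    outerL δ (Z ⊗[k] Y) (interchange δZ a Y t) =
      (interchange δZ a Y).lTensor B (tensorCoact δZ (outerL δ Y) t) := by
  let E : (B ⊗[k] (B ⊗[k] Z)) ⊗[k] (B ⊗[k] (X ⊗[k] Y)) →ₗ[k] B ⊗[k] (X ⊗[k] (Z ⊗[k] Y)) :=
    TensorProduct.map (LinearMap.mul' k B)
      (TensorProduct.map (TensorProduct.lift a.toLinearMap) LinearMap.id ∘ₗ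
        (TensorProduct.tensorTensorTensorComm k B Z X Y).toLinearMap) ∘ₗ
      (TensorProduct.tensorTensorTensorComm k B (B ⊗[k] Z) B (X ⊗[k] Y)).toLinearMap
  induction t with
  | zero => simp
  | add x y hx hy => simp only [map_add, hx, hy]
  | tmul z xy =>
  induction xy with
  | zero => simp
  | add x y hx hy => simp only [TensorProduct.tmul_add, map_add, hx, hy]
  | tmul x y =>
    have h1 : ∀ s : B ⊗[k] Z, outerL δ (Z ⊗[k] Y) (TensorProduct.map
        (LinearMap.flip a.toLinearMap x) (TensorProduct.mk k Z Y |>.flip y) s) =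
        E (TensorProduct.assoc k B B Z ((Coalgebra.comul (R := k) (A := B)).rTensor Z s) ⊗ₜ
          (outerL δ Y (x ⊗ₜ y))) := by
      intro s
      induction s with
      | zero => simp
      | add x y hx hy => simp only [TensorProduct.add_tmul, map_add, hx, hy]
      | tmul b z =>
        simp only [outerL, LinearMap.comp_apply, LinearEquiv.coe_coe, TensorProduct.map_tmul,
          LinearMap.rTensor_tmul, LinearMap.flip_apply, AlgHom.toLinearMap_apply, ha,
          diagAct_apply]
        generalize δ x = s
        generalize (Coalgebra.comul (R := k) b) = d
        induction s with
        | zero => simp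
        | add x y hx hy =>
          simp only [TensorProduct.add_tmul, TensorProduct.tmul_add, map_add, hx, hy]
        | tmul b' x =>
        induction d with
        | zero => simp
        | add x y hx hy => simp only [TensorProduct.add_tmul, map_add, LinearMap.add_apply, hx, hy]
        | tmul c d => simp [E, regAct]
    have h2 : ∀ (s : B ⊗[k] Z) (r : B ⊗[k] (X ⊗[k] Y)), (interchange δZ a Y).lTensor B
        ((LinearMap.mul' k B).rTensor (Z ⊗[k] (X ⊗[k] Y))
        (TensorProduct.tensorTensorTensorComm k B Z B (X ⊗[k] Y) (s ⊗ₜ r))) =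
        E (δZ.lTensor B s ⊗ₜ r) := by
      intro s r
      induction s with
      | zero => simp
      | add x y hx hy => simp only [TensorProduct.add_tmul, map_add, hx, hy]
      | tmul b z =>
      induction r with
      | zero => simp
      | add x y hx hy => simp only [TensorProduct.tmul_add, map_add, hx, hy]
      | tmul c xy => simp [E, interchange]
    rw [interchange_tmul, h1, hZ.coassoc, ← h2]
    rfl

theorem interchange_mem {δZ : Z →ₗ[k] B ⊗[k] Z} (hZ : IsLeftCoaction δZ)
    {ρ : X →ₗ[k] X ⊗[k] B} {a : B →ₐ[k] Module.End k X}
    (ha : ∀ b x, ρ (a b x) = diagAct a regAct b (ρ x)) {δ : Y →ₗ[k] B ⊗[k] Y}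
    (t : Z ⊗[k] cotensor ρ δ) :
    interchange δZ a Y ((cotensor ρ δ).subtype.lTensor Z t) ∈ cotensor ρ (tensorCoact δZ δ) := by
  let Ψ : (B ⊗[k] Z) ⊗[k] (B ⊗[k] Y) →ₗ[k] B ⊗[k] (Z ⊗[k] Y) :=
    (LinearMap.mul' k B).rTensor (Z ⊗[k] Y) ∘ₗ
      (TensorProduct.tensorTensorTensorComm k B Z B Y).toLinearMap
  let E : (B ⊗[k] (B ⊗[k] Z)) ⊗[k] (X ⊗[k] (B ⊗[k] Y)) →ₗ[k] X ⊗[k] (B ⊗[k] (Z ⊗[k] Y)) :=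
    TensorProduct.map (TensorProduct.lift a.toLinearMap) Ψ ∘ₗ
      (TensorProduct.tensorTensorTensorComm k B (B ⊗[k] Z) X (B ⊗[k] Y)).toLinearMap
  rw [mem_cotensor]
  have h1 : ∀ (z : Z) (s : X ⊗[k] Y), TensorProduct.assoc k X B (Z ⊗[k] Y)
      (ρ.rTensor (Z ⊗[k] Y) (interchange δZ a Y (z ⊗ₜ s))) =
      E (δZ.lTensor B (δZ z) ⊗ₜ (TensorProduct.assoc k X B Y (ρ.rTensor Y s))) := by
    intro z s
    rw [← hZ.coassoc]
    induction s with
    | zero => simp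
    | add x y hx hy => simp only [TensorProduct.tmul_add, map_add, hx, hy]
    | tmul x y =>
      rw [interchange_tmul]
      generalize δZ z = s
      induction s with
      | zero => simp
      | add x y hx hy => simp only [TensorProduct.add_tmul, map_add, hx, hy]
      | tmul b z =>
        simp only [TensorProduct.map_tmul, LinearMap.rTensor_tmul, LinearMap.flip_apply,
          AlgHom.toLinearMap_apply, ha, diagAct_apply]
        generalize ρ x = s
        generalize (Coalgebra.comul (R := k) b) = d
        induction s with
        | zero => simp
        | add x y hx hy =>
          simp only [TensorProduct.add_tmul, TensorProduct.tmul_add, map_add, hx, hy]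
        | tmul x b' =>
        induction d with
        | zero => simp
        | add x y hx hy => simp only [TensorProduct.add_tmul, map_add, LinearMap.add_apply, hx, hy]
        | tmul c d => simp [E, Ψ, regAct]
  have h2 : ∀ (z : Z) (s : X ⊗[k] Y), (tensorCoact δZ δ).lTensor X
      (interchange δZ a Y (z ⊗ₜ s)) =
      E (δZ.lTensor B (δZ z) ⊗ₜ (δ.lTensor X s)) := by
    intro z s
    induction s with
    | zero => simp
    | add x y hx hy => simp only [TensorProduct.tmul_add, map_add, hx, hy]
    | tmul x y =>
      rw [interchange_tmul]
      generalize δZ z = s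
      induction s with
      | zero => simp
      | add x y hx hy => simp only [TensorProduct.add_tmul, map_add, hx, hy]
      | tmul b z => simp [E, Ψ, tensorCoact]
  induction t with
  | zero => simp
  | add x y hx hy => simp only [map_add, hx, hy]
  | tmul z s =>
    simp only [LinearMap.lTensor_tmul]
    rw [h1, h2, Submodule.subtype_apply, mem_cotensor.1 s.2]

theorem interchange_map {δZ : Z →ₗ[k] B ⊗[k] Z} {δZ' : Z' →ₗ[k] B ⊗[k] Z'}
    {a : B →ₐ[k] Module.End k X} {a' : B →ₐ[k] Module.End k X'} {f : Z →ₗ[k] Z'} {g : X →ₗ[k] X'}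
    (hf : ∀ z, δZ' (f z) = f.lTensor B (δZ z)) (hg : ∀ b x, g (a b x) = a' b (g x))
    (h : Y →ₗ[k] Y') (t : Z ⊗[k] (X ⊗[k] Y)) :
    interchange δZ' a' Y' (TensorProduct.map f (TensorProduct.map g h) t) =
      TensorProduct.map g (TensorProduct.map f h) (interchange δZ a Y t) := by
  induction t with
  | zero => simp
  | add x y hx hy => simp only [map_add, hx, hy]
  | tmul z xy =>
  induction xy with
  | zero => simp
  | add x y hx hy => simp only [TensorProduct.tmul_add, map_add, hx, hy]
  | tmul x y =>
    simp only [TensorProduct.map_tmul, interchange_tmul, hf]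
    generalize δZ z = s
    induction s with
    | zero => simp
    | add x y hx hy => simp only [map_add, hx, hy]
    | tmul b z => simp [hg]

theorem interchange_assoc (δZ : Z →ₗ[k] B ⊗[k] Z) (δZ' : Z' →ₗ[k] B ⊗[k] Z')
    (a : B →ₐ[k] Module.End k X) (t : (Z ⊗[k] Z') ⊗[k] (X ⊗[k] Y)) :
    (TensorProduct.assoc k Z Z' Y).toLinearMap.lTensor X
      (interchange (tensorCoact δZ δZ') a Y t) =
    interchange δZ a (Z' ⊗[k] Y) ((interchange δZ' a Y).lTensor Z
      (TensorProduct.assoc k Z Z' (X ⊗[k] Y) t)) := by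
  induction t with
  | zero => simp
  | add x y hx hy => simp only [map_add, hx, hy]
  | tmul zz xy =>
  induction zz with
  | zero => simp
  | add x y hx hy => simp only [TensorProduct.add_tmul, map_add, hx, hy]
  | tmul z z' =>
  induction xy with
  | zero => simp
  | add x y hx hy => simp only [TensorProduct.tmul_add, map_add, hx, hy]
  | tmul x y =>
    simp only [TensorProduct.assoc_tmul, LinearMap.lTensor_tmul, interchange_tmul, tensorCoact,
      LinearMap.comp_apply, LinearEquiv.coe_coe, TensorProduct.map_tmul]
    generalize δZ' z' = s'
    induction s' with
    | zero => simp
    | add x y hx hy => simp only [TensorProduct.tmul_add, map_add, hx, hy]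
    | tmul b' z' =>
    simp only [TensorProduct.map_tmul, LinearMap.flip_apply, interchange_tmul,
      TensorProduct.mk_apply]
    generalize δZ z = s
    induction s with
    | zero => simp
    | add x y hx hy => simp only [TensorProduct.add_tmul, map_add, hx, hy]
    | tmul b z => simp

theorem interchange_unit (a : B →ₐ[k] Module.End k X) (t : k ⊗[k] (X ⊗[k] Y)) :
    (TensorProduct.lid k Y).toLinearMap.lTensor X
      (interchange (TensorProduct.mk k B k 1) a Y t) = TensorProduct.lid k (X ⊗[k] Y) t := by
  induction t with
  | zero => simp
  | add x y hx hy => simp only [map_add, hx, hy]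
  | tmul c xy =>
  induction xy with
  | zero => simp
  | add x y hx hy => simp only [TensorProduct.tmul_add, map_add, hx, hy]
  | tmul x y => simp [interchange_tmul]

theorem comul_regAct (b x : B) : Coalgebra.comul (R := k) (regAct (k := k) b x) =
    diagAct (k := k) regAct regAct b (Coalgebra.comul (R := k) x) := by
  change Coalgebra.comul (R := k) (b * x) = _
  rw [Bialgebra.comul_mul, diagAct_apply]
  generalize (Coalgebra.comul (R := k) b) = s
  generalize (Coalgebra.comul (R := k) x) = t
  induction s with
  | zero => simp
  | add x y hx hy => simp only [add_mul, map_add, LinearMap.add_apply, hx, hy]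
  | tmul b m =>
  induction t with
  | zero => simp
  | add x y hx hy => simp only [mul_add, map_add, hx, hy]
  | tmul c n => simp [regAct]

end Interchange

/-- A left `B`-comodule over the field `k`. -/
structure LeftComodule (k B : Type u) [Field k] [Ring B] [Bialgebra k B] : Type (u + 1) where
  carrier : Type u
  [addCommGroup : AddCommGroup carrier]
  [module : Module k carrier]
  coact : carrier →ₗ[k] B ⊗[k] carrier
  isLeftCoaction : IsLeftCoaction coact

namespace LeftComodule

attribute [instance] addCommGroup module

variable {k B : Type u} [Field k] [Ring B] [Bialgebra k B]

/-- Morphisms of left comodules: linear maps commuting with the coactions. -/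
@[ext]
structure Hom (M N : LeftComodule k B) where
  toLin : M.carrier →ₗ[k] N.carrier
  comm : ∀ m, N.coact (toLin m) = toLin.lTensor B (M.coact m)

/-- The category `ᴮVect` of left `B`-comodules. -/
instance : Category (LeftComodule k B) where
  Hom M N := Hom M N
  id M := ⟨LinearMap.id, fun m => by simp⟩
  comp f g := ⟨g.toLin ∘ₗ f.toLin, fun m => by
    simp [f.comm, g.comm, LinearMap.lTensor_comp]⟩

@[ext]
theorem hom_ext {M N : LeftComodule k B} {f g : M ⟶ N} (h : f.toLin = g.toLin) : f = g :=
  Hom.ext h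

@[simp] theorem id_toLin (M : LeftComodule k B) : (𝟙 M : M ⟶ M).toLin = LinearMap.id := rfl

@[simp] theorem comp_toLin {M N P : LeftComodule k B} (f : M ⟶ N) (g : N ⟶ P) :
    (f ≫ g).toLin = g.toLin ∘ₗ f.toLin := rfl

/-- A bijective comodule morphism is an isomorphism. -/
noncomputable def isoMk {M N : LeftComodule k B} (e : M.carrier ≃ₗ[k] N.carrier)
    (h : ∀ m, N.coact (e m) = e.toLinearMap.lTensor B (M.coact m)) : M ≅ N where
  hom := ⟨e.toLinearMap, h⟩
  inv := ⟨e.symm.toLinearMap, fun n => by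
    obtain ⟨m, rfl⟩ := e.surjective n
    simp only [LinearEquiv.coe_coe, LinearEquiv.symm_apply_apply, h]
    rw [← LinearMap.comp_apply, ← LinearMap.lTensor_comp]
    simp⟩
  hom_inv_id := by ext; simp
  inv_hom_id := by ext; simp

/-- The tensor product comodule with the codiagonal coaction. -/
noncomputable def tensor (M N : LeftComodule k B) : LeftComodule k B where
  carrier := M.carrier ⊗[k] N.carrier
  coact := tensorCoact M.coact N.coact
  isLeftCoaction := tensorCoact_isLeftCoaction M.isLeftCoaction N.isLeftCoaction

/-- The trivial comodule `k`, with coaction `c ↦ 1 ⊗ c`. -/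
noncomputable def unit (k B : Type u) [Field k] [Ring B] [Bialgebra k B] : LeftComodule k B where
  carrier := k
  coact := TensorProduct.mk k B k 1
  isLeftCoaction :=
    { coassoc := fun c => by simp [Algebra.TensorProduct.one_def]
      counit := fun c => by simp }

/-- The tensor product of two comodule morphisms. -/
noncomputable def tensorMap {M M' N N' : LeftComodule k B} (f : M ⟶ M') (g : N ⟶ N') :
    tensor M N ⟶ tensor M' N' where
  toLin := TensorProduct.map f.toLin g.toLin
  comm t := tensorCoact_map f.comm g.comm t

noncomputable instance : MonoidalCategoryStruct (LeftComodule k B) where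
  tensorObj := tensor
  tensorUnit := unit k B
  tensorHom := tensorMap
  whiskerLeft M _ _ g := tensorMap (𝟙 M) g
  whiskerRight f N := tensorMap f (𝟙 N)
  associator M N P := isoMk (M := tensor (tensor M N) P) (N := tensor M (tensor N P))
    (TensorProduct.assoc k M.carrier N.carrier P.carrier) (fun t =>
      tensorCoact_assoc M.coact N.coact P.coact t)
  leftUnitor M := isoMk (M := tensor (unit k B) M) (N := M)
    (TensorProduct.lid k M.carrier) (fun t => tensorCoact_lid M.coact t)
  rightUnitor M := isoMk (M := tensor M (unit k B)) (N := M)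
    (TensorProduct.rid k M.carrier) (fun t => tensorCoact_rid M.coact t)

open MonoidalCategory

theorem tensorHom_toLin {M M' N N' : LeftComodule k B} (f : M ⟶ M') (g : N ⟶ N') :
    (f ⊗ₘ g).toLin = TensorProduct.map f.toLin g.toLin := rfl

theorem whiskerLeft_toLin (M : LeftComodule k B) {N N' : LeftComodule k B} (g : N ⟶ N') :
    (M ◁ g).toLin = TensorProduct.map LinearMap.id g.toLin := rfl

theorem whiskerRight_toLin {M M' : LeftComodule k B} (f : M ⟶ M') (N : LeftComodule k B) :
    (f ▷ N).toLin = TensorProduct.map f.toLin LinearMap.id := rfl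

theorem associator_toLin (M N P : LeftComodule k B) : (α_ M N P).hom.toLin =
    (TensorProduct.assoc k M.carrier N.carrier P.carrier).toLinearMap := rfl

theorem leftUnitor_toLin (M : LeftComodule k B) : (λ_ M).hom.toLin =
    (TensorProduct.lid k M.carrier).toLinearMap := rfl

theorem rightUnitor_toLin (M : LeftComodule k B) : (ρ_ M).hom.toLin =
    (TensorProduct.rid k M.carrier).toLinearMap := rfl

/-- `ᴮVect` is monoidal under `⊗` over `k` with the codiagonal coaction. -/
noncomputable instance : MonoidalCategory (LeftComodule k B) where
  tensorHom_def _ _ := hom_ext (TensorProduct.ext' fun _ _ => rfl)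
  id_tensorHom_id _ _ := hom_ext (TensorProduct.ext' fun _ _ => rfl)
  tensorHom_comp_tensorHom _ _ _ _ := hom_ext (TensorProduct.ext' fun _ _ => rfl)
  whiskerLeft_id _ _ := hom_ext (TensorProduct.ext' fun _ _ => rfl)
  id_whiskerRight _ _ := hom_ext (TensorProduct.ext' fun _ _ => rfl)
  associator_naturality _ _ _ := hom_ext (TensorProduct.ext_threefold fun _ _ _ => rfl)
  leftUnitor_naturality f := hom_ext (TensorProduct.ext' fun c m => (f.toLin.map_smul c m).symm)
  rightUnitor_naturality f := hom_ext (TensorProduct.ext' fun m c => (f.toLin.map_smul c m).symm)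
  pentagon _ _ _ _ := hom_ext (TensorProduct.ext_fourfold fun _ _ _ _ => rfl)
  triangle _ _ := hom_ext (TensorProduct.ext_threefold fun m (c : k) n =>
    (TensorProduct.smul_tmul c m n).symm)

/-- The regular comodule `B`. -/
noncomputable def regular (k B : Type u) [Field k] [Ring B] [Bialgebra k B] :
    LeftComodule k B where
  carrier := B
  coact := Coalgebra.comul
  isLeftCoaction :=
    { coassoc := fun b => Coalgebra.coassoc_apply b
      counit := fun b => by simp }

/-- The multiplication `B ⊗ B → B` as a morphism of left comodules. -/
noncomputable def mulHom (k B : Type u) [Field k] [Ring B] [Bialgebra k B] :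
    regular k B ⊗ regular k B ⟶ regular k B where
  toLin := LinearMap.mul' k B
  comm t := comul_mul' (k := k) (B := B) t

/-- For a functional `φ` on `B`, the endomorphism `b ↦ b₁ φ(b₂)` of the regular comodule. -/
noncomputable def translate (φ : B →ₗ[k] k) : regular k B ⟶ regular k B where
  toLin := contract (Coalgebra.comul (R := k) (A := B)) φ
  comm b := contract_comm (k := k) (B := B) (M := B) (ρ := Coalgebra.comul) (δ := Coalgebra.comul)
    (fun b => Coalgebra.coassoc_apply b) φ b

end LeftComodule

/-- A Hopf trimodule over `B`: a `B`-`B`-bicomodule with a left `B`-action `a` that is a morphism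
of left and of right comodules, i.e. `λ(b x) = b₁ x₋₁ ⊗ b₂ x₀` and `ρ(b x) = b₁ x₀ ⊗ b₂ x₁`. -/
structure HopfTrimodule (k B : Type u) [Field k] [Ring B] [Bialgebra k B] : Type (u + 1) where
  carrier : Type u
  [addCommGroup : AddCommGroup carrier]
  [module : Module k carrier]
  lcoact : carrier →ₗ[k] B ⊗[k] carrier
  rcoact : carrier →ₗ[k] carrier ⊗[k] B
  act : B →ₐ[k] Module.End k carrier
  isLeftCoaction : IsLeftCoaction lcoact
  isRightCoaction : IsRightCoaction rcoact
  bicomodule : ∀ x, TensorProduct.assoc k B carrier B (lcoact.rTensor B (rcoact x)) =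
    rcoact.lTensor B (lcoact x)
  lcoact_act : ∀ b x, lcoact (act b x) = diagAct regAct act b (lcoact x)
  rcoact_act : ∀ b x, rcoact (act b x) = diagAct act regAct b (rcoact x)

namespace HopfTrimodule

attribute [instance] addCommGroup module

variable {k B : Type u} [Field k] [Ring B] [Bialgebra k B]

/-- Morphisms of Hopf trimodules: linear maps commuting with both coactions and the action. -/
@[ext]
structure Hom (X Y : HopfTrimodule k B) where
  toLin : X.carrier →ₗ[k] Y.carrier
  lcomm : ∀ x, Y.lcoact (toLin x) = toLin.lTensor B (X.lcoact x)
  rcomm : ∀ x, Y.rcoact (toLin x) = toLin.rTensor B (X.rcoact x)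
  acomm : ∀ b x, toLin (X.act b x) = Y.act b (toLin x)

/-- The category of Hopf trimodules. -/
instance : Category (HopfTrimodule k B) where
  Hom X Y := Hom X Y
  id X := ⟨LinearMap.id, fun x => by simp, fun x => by simp, fun _ _ => rfl⟩
  comp f g := ⟨g.toLin ∘ₗ f.toLin,
    fun x => by simp [f.lcomm, g.lcomm, LinearMap.lTensor_comp],
    fun x => by simp [f.rcomm, g.rcomm, LinearMap.rTensor_comp],
    fun b x => by simp [f.acomm, g.acomm]⟩

@[ext]
theorem hom_ext {X Y : HopfTrimodule k B} {f g : X ⟶ Y} (h : f.toLin = g.toLin) : f = g :=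
  Hom.ext h

@[simp] theorem id_toLin (X : HopfTrimodule k B) : (𝟙 X : X ⟶ X).toLin = LinearMap.id := rfl

@[simp] theorem comp_toLin {X Y Z : HopfTrimodule k B} (f : X ⟶ Y) (g : Y ⟶ Z) :
    (f ≫ g).toLin = g.toLin ∘ₗ f.toLin := rfl

/-- An isomorphism from a bijective morphism. -/
noncomputable def isoMk {X Y : HopfTrimodule k B} (f : X ⟶ Y) (e : X.carrier ≃ₗ[k] Y.carrier)
    (h : e.toLinearMap = f.toLin) : X ≅ Y where
  hom := f
  inv := ⟨e.symm.toLinearMap,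
    fun y => by
      obtain ⟨x, rfl⟩ := e.surjective y
      have := f.lcomm x
      rw [← h] at this
      simp only [LinearEquiv.coe_coe, LinearEquiv.symm_apply_apply] at this ⊢
      rw [this, ← LinearMap.comp_apply, ← LinearMap.lTensor_comp]
      simp,
    fun y => by
      obtain ⟨x, rfl⟩ := e.surjective y
      have := f.rcomm x
      rw [← h] at this
      simp only [LinearEquiv.coe_coe, LinearEquiv.symm_apply_apply] at this ⊢
      rw [this, ← LinearMap.comp_apply, ← LinearMap.rTensor_comp]
      simp,
    fun b y => by
      obtain ⟨x, rfl⟩ := e.surjective y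
      have := f.acomm b x
      rw [← h] at this
      simp only [LinearEquiv.coe_coe, LinearEquiv.symm_apply_apply] at this ⊢
      rw [← this, LinearEquiv.symm_apply_apply]⟩
  hom_inv_id := by ext; simp [← h]
  inv_hom_id := by ext; simp [← h]

/-- The underlying left comodule. -/
def toLeftComodule (X : HopfTrimodule k B) : LeftComodule k B where
  carrier := X.carrier
  coact := X.lcoact
  isLeftCoaction := X.isLeftCoaction

/-- A subspace stable under both coactions and the action is a Hopf trimodule. -/
noncomputable def sub (T : HopfTrimodule k B) (S : Submodule k T.carrier)
    (hl : ∀ s ∈ S, T.lcoact s ∈ LinearMap.range (S.subtype.lTensor B))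
    (hr : ∀ s ∈ S, T.rcoact s ∈ LinearMap.range (S.subtype.rTensor B))
    (ha : ∀ b, ∀ s ∈ S, T.act b s ∈ S) : HopfTrimodule k B :=
  let l : S →ₗ[k] B ⊗[k] S := LinearMap.codRestrictOfInjective (T.lcoact ∘ₗ S.subtype)
    (S.subtype.lTensor B) (lTensor_inj B S.injective_subtype) (fun s => hl s s.2)
  let r : S →ₗ[k] S ⊗[k] B := LinearMap.codRestrictOfInjective (T.rcoact ∘ₗ S.subtype)
    (S.subtype.rTensor B) (rTensor_inj B S.injective_subtype) (fun s => hr s s.2)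
  let a : B →ₐ[k] Module.End k S := AlgHom.ofLinearMap
    { toFun := fun b => (T.act b).restrict (ha b)
      map_add' := fun b c => by ext; simp [LinearMap.restrict_apply]
      map_smul' := fun b c => by ext; simp [LinearMap.restrict_apply] }
    (by ext; simp [LinearMap.restrict_apply])
    (fun b c => by ext; simp [LinearMap.restrict_apply])
  have hl' : ∀ s, S.subtype.lTensor B (l s) = T.lcoact (S.subtype s) := fun s =>
    LinearMap.codRestrictOfInjective_comp_apply _ _ _ _ s
  have hr' : ∀ s, S.subtype.rTensor B (r s) = T.rcoact (S.subtype s) := fun s =>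
    LinearMap.codRestrictOfInjective_comp_apply _ _ _ _ s
  have ha' : ∀ b s, S.subtype (a b s) = T.act b (S.subtype s) := fun b s => rfl
  { carrier := S
    lcoact := l
    rcoact := r
    act := a
    isLeftCoaction := T.isLeftCoaction.of_injective S.subtype S.injective_subtype hl'
    isRightCoaction := T.isRightCoaction.of_injective S.subtype S.injective_subtype hr'
    bicomodule := bicomodule_of_injective T.bicomodule S.subtype S.injective_subtype hl' hr'
    lcoact_act := fun b s => by
      apply lTensor_inj B S.injective_subtype
      have := diagAct_map (f := regAct) (g := a) (f' := regAct) (g' := T.act)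
        (φ := LinearMap.id) (ψ := S.subtype) (fun _ _ => rfl) ha' b (l s)
      rw [LinearMap.lTensor, this, ← LinearMap.lTensor, hl', hl', ha', T.lcoact_act]
    rcoact_act := fun b s => by
      apply rTensor_inj B S.injective_subtype
      have := diagAct_map (f := a) (g := regAct) (f' := T.act) (g' := regAct)
        (φ := S.subtype) (ψ := LinearMap.id) ha' (fun _ _ => rfl) b (r s)
      rw [LinearMap.rTensor, this, ← LinearMap.rTensor, hr', hr', ha', T.rcoact_act] }

/-- The inclusion of a sub-trimodule. -/
noncomputable def subIncl (T : HopfTrimodule k B) (S : Submodule k T.carrier)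
    (hl : ∀ s ∈ S, T.lcoact s ∈ LinearMap.range (S.subtype.lTensor B))
    (hr : ∀ s ∈ S, T.rcoact s ∈ LinearMap.range (S.subtype.rTensor B))
    (ha : ∀ b, ∀ s ∈ S, T.act b s ∈ S) : T.sub S hl hr ha ⟶ T where
  toLin := S.subtype
  lcomm s := (LinearMap.codRestrictOfInjective_comp_apply (T.lcoact ∘ₗ S.subtype)
    (S.subtype.lTensor B) (lTensor_inj B S.injective_subtype) (fun s => hl s s.2) s).symm
  rcomm s := (LinearMap.codRestrictOfInjective_comp_apply (T.rcoact ∘ₗ S.subtype)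
    (S.subtype.rTensor B) (rTensor_inj B S.injective_subtype) (fun s => hr s s.2) s).symm
  acomm _ _ := rfl

/-- A morphism whose image lies in the image of an injective morphism factors through it. -/
noncomputable def lift {P S T : HopfTrimodule k B} (i : S ⟶ T) (hi : Function.Injective i.toLin)
    (f : P ⟶ T) (h : ∀ p, f.toLin p ∈ LinearMap.range i.toLin) : P ⟶ S :=
  have h' : ∀ p, i.toLin (LinearMap.codRestrictOfInjective f.toLin i.toLin hi h p) = f.toLin p :=
    fun p => LinearMap.codRestrictOfInjective_comp_apply _ _ _ _ p
  have h'' : i.toLin ∘ₗ (LinearMap.codRestrictOfInjective f.toLin i.toLin hi h) = f.toLin :=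
    LinearMap.ext h'
  { toLin := LinearMap.codRestrictOfInjective f.toLin i.toLin hi h
    lcomm := fun p => by
      apply lTensor_inj B hi
      rw [← i.lcomm, h', f.lcomm, ← LinearMap.lTensor_comp_apply, h'']
    rcomm := fun p => by
      apply rTensor_inj B hi
      rw [← i.rcomm, h', f.rcomm, ← LinearMap.rTensor_comp_apply, h'']
    acomm := fun b p => by
      apply hi
      rw [i.acomm, h', h', f.acomm] }

theorem lift_comp {P S T : HopfTrimodule k B} (i : S ⟶ T) (hi : Function.Injective i.toLin)
    (f : P ⟶ T) (h : ∀ p, f.toLin p ∈ LinearMap.range i.toLin) : lift i hi f h ≫ i = f :=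
  hom_ext (LinearMap.ext fun p => LinearMap.codRestrictOfInjective_comp_apply _ _ _ _ p)

theorem cancel {P S T : HopfTrimodule k B} {i : S ⟶ T} (hi : Function.Injective i.toLin)
    {f g : P ⟶ S} (h : f ≫ i = g ≫ i) : f = g :=
  hom_ext (LinearMap.ext fun p => hi (LinearMap.congr_fun (congrArg Hom.toLin h) p))

/-- The trimodule `X ⊗ Y` with left coaction through `X`, right coaction through `Y` and the
diagonal action. -/
noncomputable def outer (X Y : HopfTrimodule k B) : HopfTrimodule k B where
  carrier := X.carrier ⊗[k] Y.carrier
  lcoact := outerL X.lcoact Y.carrier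
  rcoact := outerR X.carrier Y.rcoact
  act := diagAct X.act Y.act
  isLeftCoaction := outerL_isLeftCoaction X.isLeftCoaction
  isRightCoaction := outerR_isRightCoaction Y.isRightCoaction
  bicomodule := outer_bicomodule X.lcoact Y.rcoact
  lcoact_act b t := by
    have h1 := diagAct_map (f := X.act) (g := Y.act) (f' := diagAct regAct X.act) (g' := Y.act)
      (φ := X.lcoact) (ψ := LinearMap.id) X.lcoact_act (fun _ _ => rfl) b t
    simp only [outerL, LinearMap.comp_apply, LinearEquiv.coe_coe, LinearMap.rTensor]
    rw [h1, diagAct_assoc]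
  rcoact_act b t := by
    have h1 := diagAct_map (f := X.act) (g := Y.act) (f' := X.act) (g' := diagAct Y.act regAct)
      (φ := LinearMap.id) (ψ := Y.rcoact) (fun _ _ => rfl) Y.rcoact_act b t
    simp only [outerR, LinearMap.comp_apply, LinearEquiv.coe_coe, LinearMap.lTensor]
    rw [h1, LinearEquiv.symm_apply_eq, diagAct_assoc, LinearEquiv.apply_symm_apply]

/-- Functoriality of `outer`. -/
noncomputable def outerMap {X X' Y Y' : HopfTrimodule k B} (f : X ⟶ X') (g : Y ⟶ Y') :
    outer X Y ⟶ outer X' Y' where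
  toLin := TensorProduct.map f.toLin g.toLin
  lcomm := map_outerL f.lcomm g.toLin
  rcomm := map_outerR f.toLin g.rcomm
  acomm := diagAct_map f.acomm g.acomm

theorem outerMap_comp {X X' X'' Y Y' Y'' : HopfTrimodule k B} (f : X ⟶ X') (f' : X' ⟶ X'')
    (g : Y ⟶ Y') (g' : Y' ⟶ Y'') :
    outerMap f g ≫ outerMap f' g' = outerMap (f ≫ f') (g ≫ g') :=
  hom_ext (TensorProduct.ext' fun _ _ => rfl)

theorem outerMap_id (X Y : HopfTrimodule k B) : outerMap (𝟙 X) (𝟙 Y) = 𝟙 (outer X Y) :=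
  hom_ext (TensorProduct.ext' fun _ _ => rfl)

theorem outerMap_injective {X X' Y Y' : HopfTrimodule k B} {f : X ⟶ X'} {g : Y ⟶ Y'}
    (hf : Function.Injective f.toLin) (hg : Function.Injective g.toLin) :
    Function.Injective (outerMap f g).toLin := map_injective hf hg

/-- Associativity of `outer`. -/
noncomputable def outerAssoc (X Y Z : HopfTrimodule k B) :
    outer (outer X Y) Z ⟶ outer X (outer Y Z) where
  toLin := (TensorProduct.assoc k X.carrier Y.carrier Z.carrier).toLinearMap
  lcomm := assoc_outerL X.lcoact
  rcomm := assoc_outerR Z.rcoact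
  acomm := diagAct_assoc X.act Y.act Z.act

theorem outerAssoc_naturality {X X' Y Y' Z Z' : HopfTrimodule k B} (f : X ⟶ X') (g : Y ⟶ Y')
    (h : Z ⟶ Z') : outerMap (outerMap f g) h ≫ outerAssoc X' Y' Z' =
      outerAssoc X Y Z ≫ outerMap f (outerMap g h) :=
  hom_ext (TensorProduct.ext_threefold fun _ _ _ => rfl)

theorem outerAssoc_pentagon (W X Y Z : HopfTrimodule k B) :
    outerMap (outerAssoc W X Y) (𝟙 Z) ≫ outerAssoc W (outer X Y) Z ≫
      outerMap (𝟙 W) (outerAssoc X Y Z) =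
    outerAssoc (outer W X) Y Z ≫ outerAssoc W X (outer Y Z) :=
  hom_ext (TensorProduct.ext_fourfold fun _ _ _ _ => rfl)

/-- The cotensor product of two Hopf trimodules, with left coaction through `X`, right coaction
through `Y`, and the diagonal action `b (x ⊗ y) = b₁ x ⊗ b₂ y`. -/
noncomputable def cotens (X Y : HopfTrimodule k B) : HopfTrimodule k B :=
  (outer X Y).sub (cotensor X.rcoact Y.lcoact)
    (fun _ ht => outerL_mem X.bicomodule ht) (fun _ ht => outerR_mem Y.bicomodule ht)
    (fun b _ ht => diagAct_mem X.rcoact_act Y.lcoact_act b ht)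

/-- The inclusion `X □ Y → X ⊗ Y`. -/
noncomputable def incl (X Y : HopfTrimodule k B) : cotens X Y ⟶ outer X Y :=
  (outer X Y).subIncl (cotensor X.rcoact Y.lcoact)
    (fun _ ht => outerL_mem X.bicomodule ht) (fun _ ht => outerR_mem Y.bicomodule ht)
    (fun b _ ht => diagAct_mem X.rcoact_act Y.lcoact_act b ht)

theorem incl_injective (X Y : HopfTrimodule k B) : Function.Injective (incl X Y).toLin :=
  Subtype.val_injective

theorem mem_range_incl {X Y : HopfTrimodule k B} {t : X.carrier ⊗[k] Y.carrier} :
    t ∈ LinearMap.range (incl X Y).toLin ↔ t ∈ cotensor X.rcoact Y.lcoact :=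
  ⟨fun ⟨s, hs⟩ => hs ▸ s.2, fun h => ⟨⟨t, h⟩, rfl⟩⟩

/-- Functoriality of the cotensor product. -/
noncomputable def cotensMap {X X' Y Y' : HopfTrimodule k B} (f : X ⟶ X') (g : Y ⟶ Y') :
    cotens X Y ⟶ cotens X' Y' :=
  lift (incl X' Y') (incl_injective X' Y') (incl X Y ≫ outerMap f g)
    (fun p => mem_range_incl.2 (map_mem_cotensor f.rcomm g.lcomm p.2))

theorem cotensMap_incl {X X' Y Y' : HopfTrimodule k B} (f : X ⟶ X') (g : Y ⟶ Y') :
    cotensMap f g ≫ incl X' Y' = incl X Y ≫ outerMap f g := lift_comp _ _ _ _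

end HopfTrimodule

namespace HopfTrimodule

variable {k B : Type u} [Field k] [Ring B] [Bialgebra k B]

/-- The inclusion `X □ (Y □ Z) → X ⊗ (Y ⊗ Z)`. -/
noncomputable def inclL (X Y Z : HopfTrimodule k B) :
    cotens X (cotens Y Z) ⟶ outer X (outer Y Z) :=
  incl X (cotens Y Z) ≫ outerMap (𝟙 X) (incl Y Z)

/-- The inclusion `(X □ Y) □ Z → (X ⊗ Y) ⊗ Z`. -/
noncomputable def inclR (X Y Z : HopfTrimodule k B) :
    cotens (cotens X Y) Z ⟶ outer (outer X Y) Z :=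
  incl (cotens X Y) Z ≫ outerMap (incl X Y) (𝟙 Z)

theorem inclL_injective (X Y Z : HopfTrimodule k B) : Function.Injective (inclL X Y Z).toLin :=
  (outerMap_injective (f := 𝟙 X) (fun _ _ h => h) (incl_injective Y Z)).comp (incl_injective _ _)

theorem inclR_injective (X Y Z : HopfTrimodule k B) : Function.Injective (inclR X Y Z).toLin :=
  (outerMap_injective (g := 𝟙 Z) (incl_injective X Y) (fun _ _ h => h)).comp (incl_injective _ _)

theorem mem_range_inclL {X Y Z : HopfTrimodule k B}
    {t : X.carrier ⊗[k] (Y.carrier ⊗[k] Z.carrier)} :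
    t ∈ LinearMap.range (inclL X Y Z).toLin ↔ t ∈ cotensor X.rcoact (outerL Y.lcoact Z.carrier) ∧
      t ∈ LinearMap.range ((cotensor Y.rcoact Z.lcoact).subtype.lTensor X.carrier) := by
  have key : ∀ s : X.carrier ⊗[k] (cotens Y Z).carrier,
      TensorProduct.map LinearMap.id (incl Y Z).toLin s ∈
        cotensor X.rcoact (outerL Y.lcoact Z.carrier) ↔
      s ∈ cotensor X.rcoact (cotens Y Z).lcoact := fun s =>
    map_mem_cotensor_iff (f := LinearMap.id) (g := (incl Y Z).toLin) (𝟙 X : X ⟶ X).rcomm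
      (incl Y Z).lcomm (fun _ _ h => h) (incl_injective Y Z)
  constructor
  · rintro ⟨s, rfl⟩
    exact ⟨(key _).2 s.2, ⟨s.1, rfl⟩⟩
  · rintro ⟨h1, ⟨s, rfl⟩⟩
    exact ⟨⟨s, (key s).1 h1⟩, rfl⟩

theorem mem_range_inclR {X Y Z : HopfTrimodule k B}
    {t : (X.carrier ⊗[k] Y.carrier) ⊗[k] Z.carrier} :
    t ∈ LinearMap.range (inclR X Y Z).toLin ↔ t ∈ cotensor (outerR X.carrier Y.rcoact) Z.lcoact ∧
      t ∈ LinearMap.range ((cotensor X.rcoact Y.lcoact).subtype.rTensor Z.carrier) := by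
  have key : ∀ s : (cotens X Y).carrier ⊗[k] Z.carrier,
      TensorProduct.map (incl X Y).toLin LinearMap.id s ∈
        cotensor (outerR X.carrier Y.rcoact) Z.lcoact ↔
      s ∈ cotensor (cotens X Y).rcoact Z.lcoact := fun s =>
    map_mem_cotensor_iff (f := (incl X Y).toLin) (g := LinearMap.id) (incl X Y).rcomm
      (𝟙 Z : Z ⟶ Z).lcomm (incl_injective X Y) (fun _ _ h => h)
  constructor
  · rintro ⟨s, rfl⟩
    exact ⟨(key _).2 s.2, ⟨s.1, rfl⟩⟩
  · rintro ⟨h1, ⟨s, rfl⟩⟩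
    exact ⟨⟨s, (key s).1 h1⟩, rfl⟩

theorem range_assoc {X Y Z : HopfTrimodule k B}
    {t : (X.carrier ⊗[k] Y.carrier) ⊗[k] Z.carrier} :
    TensorProduct.assoc k X.carrier Y.carrier Z.carrier t ∈ LinearMap.range (inclL X Y Z).toLin ↔
      t ∈ LinearMap.range (inclR X Y Z).toLin := by
  rw [mem_range_inclL, mem_range_inclR, triple_left_iff, triple_right_iff, and_comm]

/-- The associativity morphism `(X □ Y) □ Z → X □ (Y □ Z)`. -/
noncomputable def assocHom (X Y Z : HopfTrimodule k B) :
    cotens (cotens X Y) Z ⟶ cotens X (cotens Y Z) :=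
  lift (inclL X Y Z) (inclL_injective X Y Z) (inclR X Y Z ≫ outerAssoc X Y Z)
    (fun p => range_assoc.2 ⟨p, rfl⟩)

theorem assocHom_inclL (X Y Z : HopfTrimodule k B) :
    assocHom X Y Z ≫ inclL X Y Z = inclR X Y Z ≫ outerAssoc X Y Z := lift_comp _ _ _ _

theorem assocHom_bijective (X Y Z : HopfTrimodule k B) :
    Function.Bijective (assocHom X Y Z).toLin := by
  have h := fun p => LinearMap.congr_fun (congrArg Hom.toLin (assocHom_inclL X Y Z)) p
  constructor
  · intro p q hpq
    have := (h p).symm.trans ((congrArg (inclL X Y Z).toLin hpq).trans (h q))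
    exact inclR_injective X Y Z ((TensorProduct.assoc k X.carrier Y.carrier Z.carrier).injective
      this)
  · intro q
    obtain ⟨t, ht⟩ := (TensorProduct.assoc k X.carrier Y.carrier Z.carrier).surjective
      ((inclL X Y Z).toLin q)
    obtain ⟨p, rfl⟩ := range_assoc.1 ⟨q, ht.symm⟩
    exact ⟨p, inclL_injective X Y Z ((h p).trans ht)⟩

/-- The associativity constraint `(x ⊗ y) ⊗ z ↦ x ⊗ (y ⊗ z)` of the cotensor product. -/
noncomputable def assocIso (X Y Z : HopfTrimodule k B) :
    cotens (cotens X Y) Z ≅ cotens X (cotens Y Z) :=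
  isoMk (assocHom X Y Z) (LinearEquiv.ofBijective _ (assocHom_bijective X Y Z)) rfl

/-- The unit trimodule `B`, with its comultiplication and left multiplication. -/
noncomputable def unit (k B : Type u) [Field k] [Ring B] [Bialgebra k B] :
    HopfTrimodule k B where
  carrier := B
  lcoact := Coalgebra.comul
  rcoact := Coalgebra.comul
  act := regAct
  isLeftCoaction :=
    { coassoc := fun b => Coalgebra.coassoc_apply b
      counit := fun b => by simp }
  isRightCoaction :=
    { coassoc := fun b => Coalgebra.coassoc_apply b
      counit := fun b => by simp }
  bicomodule b := Coalgebra.coassoc_apply b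
  lcoact_act := comul_regAct
  rcoact_act := comul_regAct

/-- The left coaction as a trimodule morphism `Y → B ⊗ Y`. -/
noncomputable def lcoactHom (Y : HopfTrimodule k B) : Y ⟶ outer (unit k B) Y where
  toLin := Y.lcoact
  lcomm := Y.isLeftCoaction.coassoc
  rcomm y := (LinearEquiv.symm_apply_eq _).2 (Y.bicomodule y).symm
  acomm := Y.lcoact_act

/-- The right coaction as a trimodule morphism `X → X ⊗ B`. -/
noncomputable def rcoactHom (X : HopfTrimodule k B) : X ⟶ outer X (unit k B) where
  toLin := X.rcoact
  lcomm := X.bicomodule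
  rcomm x := (LinearEquiv.symm_apply_eq _).2 (X.isRightCoaction.coassoc x).symm
  acomm := X.rcoact_act

/-- The left coaction as a morphism `Y → B □ Y`. -/
noncomputable def lunitInv (Y : HopfTrimodule k B) : Y ⟶ cotens (unit k B) Y :=
  lift (incl (unit k B) Y) (incl_injective _ _) (lcoactHom Y)
    (fun y => mem_range_incl.2 (coact_mem_cotensor Y.isLeftCoaction y))

theorem lunitInv_incl (Y : HopfTrimodule k B) : lunitInv Y ≫ incl (unit k B) Y = lcoactHom Y :=
  lift_comp _ _ _ _

/-- The right coaction as a morphism `X → X □ B`. -/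
noncomputable def runitInv (X : HopfTrimodule k B) : X ⟶ cotens X (unit k B) :=
  lift (incl X (unit k B)) (incl_injective _ _) (rcoactHom X)
    (fun y => mem_range_incl.2 (rcoact_mem_cotensor X.isRightCoaction y))

theorem runitInv_incl (X : HopfTrimodule k B) : runitInv X ≫ incl X (unit k B) = rcoactHom X :=
  lift_comp _ _ _ _

theorem lunitInv_bijective (Y : HopfTrimodule k B) : Function.Bijective (lunitInv Y).toLin := by
  have h := fun p => LinearMap.congr_fun (congrArg Hom.toLin (lunitInv_incl Y)) p
  constructor
  · intro p q hpq
    have : Y.lcoact p = Y.lcoact q :=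
      (h p).symm.trans ((congrArg (incl (unit k B) Y).toLin hpq).trans (h q))
    rw [← Y.isLeftCoaction.counit p, this, Y.isLeftCoaction.counit]
  · intro q
    exact ⟨_, incl_injective _ _ ((h _).trans (coact_counit (k := k) (B := B) (δ := Y.lcoact) q.2))⟩

theorem runitInv_bijective (X : HopfTrimodule k B) : Function.Bijective (runitInv X).toLin := by
  have h := fun p => LinearMap.congr_fun (congrArg Hom.toLin (runitInv_incl X)) p
  constructor
  · intro p q hpq
    have : X.rcoact p = X.rcoact q :=
      (h p).symm.trans ((congrArg (incl X (unit k B)).toLin hpq).trans (h q))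
    rw [← X.isRightCoaction.counit p, this, X.isRightCoaction.counit]
  · intro q
    exact ⟨_, incl_injective _ _ ((h _).trans (rcoact_counit (k := k) (B := B) (ρ := X.rcoact) q.2))⟩

/-- The isomorphism `Y ≅ B □ Y` given by the left coaction. -/
noncomputable def lunitIso (Y : HopfTrimodule k B) : Y ≅ cotens (unit k B) Y :=
  isoMk (lunitInv Y) (LinearEquiv.ofBijective _ (lunitInv_bijective Y)) rfl

/-- The isomorphism `X ≅ X □ B` given by the right coaction. -/
noncomputable def runitIso (X : HopfTrimodule k B) : X ≅ cotens X (unit k B) :=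
  isoMk (runitInv X) (LinearEquiv.ofBijective _ (runitInv_bijective X)) rfl

noncomputable instance : MonoidalCategoryStruct (HopfTrimodule k B) where
  tensorObj := cotens
  tensorUnit := unit k B
  tensorHom := cotensMap
  whiskerLeft X _ _ g := cotensMap (𝟙 X) g
  whiskerRight f Y := cotensMap f (𝟙 Y)
  associator := assocIso
  leftUnitor Y := (lunitIso Y).symm
  rightUnitor X := (runitIso X).symm

theorem cotensMap_comp {X X' X'' Y Y' Y'' : HopfTrimodule k B} (f : X ⟶ X') (f' : X' ⟶ X'')
    (g : Y ⟶ Y') (g' : Y' ⟶ Y'') :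
    cotensMap f g ≫ cotensMap f' g' = cotensMap (f ≫ f') (g ≫ g') :=
  cancel (incl_injective _ _) (by
    rw [Category.assoc, cotensMap_incl, reassoc_of% cotensMap_incl, outerMap_comp, cotensMap_incl])

theorem cotensMap_id (X Y : HopfTrimodule k B) : cotensMap (𝟙 X) (𝟙 Y) = 𝟙 (cotens X Y) :=
  cancel (incl_injective _ _) (by
    rw [cotensMap_incl, outerMap_id, Category.id_comp, Category.comp_id])

theorem cotensMap_inclL {X X' Y Y' Z Z' : HopfTrimodule k B} (f : X ⟶ X')
    (g : cotens Y Z ⟶ cotens Y' Z') (h : outer Y Z ⟶ outer Y' Z')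
    (hg : g ≫ incl Y' Z' = incl Y Z ≫ h) :
    cotensMap f g ≫ inclL X' Y' Z' = inclL X Y Z ≫ outerMap f h := by
  rw [inclL, inclL, reassoc_of% cotensMap_incl, Category.assoc, outerMap_comp, outerMap_comp, hg,
    Category.id_comp, Category.comp_id]

theorem cotensMap_inclR {X X' Y Y' Z Z' : HopfTrimodule k B} (g : cotens X Y ⟶ cotens X' Y')
    (f : Z ⟶ Z') (h : outer X Y ⟶ outer X' Y') (hg : g ≫ incl X' Y' = incl X Y ≫ h) :
    cotensMap g f ≫ inclR X' Y' Z' = inclR X Y Z ≫ outerMap h f := by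
  rw [inclR, inclR, reassoc_of% cotensMap_incl, Category.assoc, outerMap_comp, outerMap_comp, hg,
    Category.id_comp, Category.comp_id]

theorem assocHom_naturality {X X' Y Y' Z Z' : HopfTrimodule k B} (f : X ⟶ X') (g : Y ⟶ Y')
    (h : Z ⟶ Z') : cotensMap (cotensMap f g) h ≫ assocHom X' Y' Z' =
      assocHom X Y Z ≫ cotensMap f (cotensMap g h) :=
  cancel (inclL_injective _ _ _) (by
    rw [Category.assoc, assocHom_inclL, Category.assoc,
      cotensMap_inclL f _ _ (cotensMap_incl g h), ← Category.assoc,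
      cotensMap_inclR _ h _ (cotensMap_incl f g), Category.assoc, outerAssoc_naturality,
      ← Category.assoc, ← Category.assoc, assocHom_inclL])

theorem assocHom_incl (X Y Z : HopfTrimodule k B) :
    assocHom X Y Z ≫ incl X (cotens Y Z) ≫ outerMap (𝟙 X) (incl Y Z) =
      incl (cotens X Y) Z ≫ outerMap (incl X Y) (𝟙 Z) ≫ outerAssoc X Y Z := by
  simpa [inclL, inclR] using assocHom_inclL X Y Z

theorem assocHom_pentagon (W X Y Z : HopfTrimodule k B) :
    cotensMap (assocHom W X Y) (𝟙 Z) ≫ assocHom W (cotens X Y) Z ≫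
      cotensMap (𝟙 W) (assocHom X Y Z) =
    assocHom (cotens W X) Y Z ≫ assocHom W X (cotens Y Z) := by
  have hinj : Function.Injective
      (incl W (cotens X (cotens Y Z)) ≫ outerMap (𝟙 W) (inclL X Y Z)).toLin :=
    (outerMap_injective (f := 𝟙 W) (fun _ _ h => h) (inclL_injective X Y Z)).comp
      (incl_injective _ _)
  apply cancel hinj
  have e1 : cotensMap (𝟙 W) (assocHom X Y Z) ≫ incl W (cotens X (cotens Y Z)) ≫
      outerMap (𝟙 W) (inclL X Y Z) = incl W (cotens (cotens X Y) Z) ≫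
        outerMap (𝟙 W) (incl (cotens X Y) Z) ≫ outerMap (𝟙 W) (outerMap (incl X Y) (𝟙 Z)) ≫
        outerMap (𝟙 W) (outerAssoc X Y Z) := by
    rw [reassoc_of% cotensMap_incl, outerMap_comp, assocHom_inclL, inclR]
    simp only [outerMap_comp, Category.assoc, Category.comp_id]
  have e2 : outerMap (𝟙 W) (inclL X Y Z) =
      outerMap (𝟙 W) (incl X (cotens Y Z)) ≫ outerMap (𝟙 W) (outerMap (𝟙 X) (incl Y Z)) := by
    rw [inclL, outerMap_comp, Category.comp_id]
  have a1 := assocHom_incl W (cotens X Y) Z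
  have a2 := assocHom_incl W X (cotens Y Z)
  have a3 := assocHom_incl (cotens W X) Y Z
  have a4 := assocHom_incl W X Y
  simp only [Category.assoc]
  rw [e1, reassoc_of% a1, ← reassoc_of% (outerAssoc_naturality (𝟙 W) (incl X Y) (𝟙 Z)),
    reassoc_of% cotensMap_incl, e2, reassoc_of% a2, ← outerAssoc_naturality, outerMap_id]
  rw [reassoc_of% (outerMap_comp (incl W X) (𝟙 _) (𝟙 (cotens Y Z)) (incl Y Z))]
  have e3 : outerMap (incl W X) (incl Y Z) =
      outerMap (𝟙 (cotens W X)) (incl Y Z) ≫ outerMap (incl W X) (𝟙 (outer Y Z)) := by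
    rw [outerMap_comp]; simp
  rw [e3, Category.assoc, reassoc_of% a3]
  rw [← outerMap_id Y Z, ← reassoc_of% (outerAssoc_naturality (incl W X) (𝟙 Y) (𝟙 Z))]
  rw [← outerAssoc_pentagon]
  simp only [reassoc_of% outerMap_comp, Category.comp_id, a4]

theorem lunitInv_naturality {Y Y' : HopfTrimodule k B} (f : Y ⟶ Y') :
    f ≫ lunitInv Y' = lunitInv Y ≫ cotensMap (𝟙 (unit k B)) f :=
  cancel (incl_injective _ _) (by
    rw [Category.assoc, lunitInv_incl, Category.assoc, cotensMap_incl, ← Category.assoc,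
      lunitInv_incl]
    exact hom_ext (LinearMap.ext f.lcomm))

theorem runitInv_naturality {X X' : HopfTrimodule k B} (f : X ⟶ X') :
    f ≫ runitInv X' = runitInv X ≫ cotensMap f (𝟙 (unit k B)) :=
  cancel (incl_injective _ _) (by
    rw [Category.assoc, runitInv_incl, Category.assoc, cotensMap_incl, ← Category.assoc,
      runitInv_incl]
    exact hom_ext (LinearMap.ext f.rcomm))

theorem unit_triangle (X Y : HopfTrimodule k B) :
    cotensMap (runitInv X) (𝟙 Y) ≫ assocHom X (unit k B) Y = cotensMap (𝟙 X) (lunitInv Y) :=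
  cancel (inclL_injective _ _ _) (by
    rw [Category.assoc, assocHom_inclL, inclR, Category.assoc, reassoc_of% cotensMap_incl,
      reassoc_of% outerMap_comp, runitInv_incl, inclL, reassoc_of% cotensMap_incl, outerMap_comp,
      lunitInv_incl]
    exact hom_ext (LinearMap.ext fun p =>
      (mem_cotensor (k := k) (B := B) (ρ := X.rcoact) (δ := Y.lcoact)).1 p.2))

open MonoidalCategory

/-- Hopf trimodules form a monoidal category under the cotensor product, with unit `B`. -/
noncomputable instance : MonoidalCategory (HopfTrimodule k B) where
  tensorHom_def f g := by
    change cotensMap f g = cotensMap f (𝟙 _) ≫ cotensMap (𝟙 _) g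
    rw [cotensMap_comp, Category.id_comp, Category.comp_id]
  id_tensorHom_id X Y := cotensMap_id X Y
  tensorHom_comp_tensorHom f g f' g' := cotensMap_comp f f' g g'
  whiskerLeft_id X Y := cotensMap_id X Y
  id_whiskerRight X Y := cotensMap_id X Y
  associator_naturality f g h := assocHom_naturality f g h
  leftUnitor_naturality {X Y} f := by
    change cotensMap (𝟙 (unit k B)) f ≫ (lunitIso Y).inv = (lunitIso X).inv ≫ f
    rw [Iso.comp_inv_eq, Category.assoc, Iso.eq_inv_comp]
    exact (lunitInv_naturality f).symm
  rightUnitor_naturality {X Y} f := by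
    change cotensMap f (𝟙 (unit k B)) ≫ (runitIso Y).inv = (runitIso X).inv ≫ f
    rw [Iso.comp_inv_eq, Category.assoc, Iso.eq_inv_comp]
    exact (runitInv_naturality f).symm
  pentagon W X Y Z := assocHom_pentagon W X Y Z
  triangle X Y := by
    change assocHom X (unit k B) Y ≫ cotensMap (𝟙 X) (lunitIso Y).inv =
      cotensMap (runitIso X).inv (𝟙 Y)
    have h1 : cotensMap (runitIso X).hom (𝟙 Y) ≫ cotensMap (runitIso X).inv (𝟙 Y) = 𝟙 _ := by
      rw [cotensMap_comp, Iso.hom_inv_id, Category.comp_id, cotensMap_id]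
    have h2 : cotensMap (runitIso X).inv (𝟙 Y) ≫ cotensMap (runitIso X).hom (𝟙 Y) = 𝟙 _ := by
      rw [cotensMap_comp, Iso.inv_hom_id, Category.comp_id, cotensMap_id]
    have h3 : cotensMap (runitIso X).hom (𝟙 Y) ≫ assocHom X (unit k B) Y =
      cotensMap (𝟙 X) (lunitIso Y).hom := unit_triangle X Y
    rw [← Category.id_comp (assocHom X (unit k B) Y), ← h2, Category.assoc, Category.assoc,
      reassoc_of% h3, cotensMap_comp, Iso.hom_inv_id, Category.comp_id, cotensMap_id,
      Category.comp_id]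

end HopfTrimodule
universe v w

open MonoidalCategory Functor.LaxLeftLinear

/-- A lax `C`-module endofunctor of the regular left `C`-module category `C`. -/
structure LaxModEnd (C : Type w) [Category.{v} C] [MonoidalCategory C] where
  functor : C ⥤ C
  [lax : functor.LaxLeftLinear C]

namespace LaxModEnd

attribute [instance] lax

variable {C : Type w} [Category.{v} C] [MonoidalCategory C]

/-- The structure morphism `x ⊗ F m ⟶ F (x ⊗ m)`. -/
abbrev str (F : LaxModEnd C) (x m : C) : x ⊗ F.functor.obj m ⟶ F.functor.obj (x ⊗ m) :=
  μₗ F.functor x m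

theorem str_left (F : LaxModEnd C) {x y : C} (f : x ⟶ y) (m : C) :
    f ▷ F.functor.obj m ≫ F.str y m = F.str x m ≫ F.functor.map (f ▷ m) :=
  μₗ_naturality_left F.functor f m

theorem str_right (F : LaxModEnd C) (x : C) {m n : C} (f : m ⟶ n) :
    x ◁ F.functor.map f ≫ F.str x n = F.str x m ≫ F.functor.map (x ◁ f) :=
  μₗ_naturality_right F.functor x f

theorem str_assoc (F : LaxModEnd C) (x y m : C) :
    F.str (x ⊗ y) m ≫ F.functor.map (α_ x y m).hom =
      (α_ x y (F.functor.obj m)).hom ≫ x ◁ F.str y m ≫ F.str x (y ⊗ m) :=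
  μₗ_associativity F.functor x y m

theorem str_unit (F : LaxModEnd C) (m : C) :
    (λ_ (F.functor.obj m)).hom = F.str (𝟙_ C) m ≫ F.functor.map (λ_ m).hom :=
  μₗ_unitality (C := C) F.functor m

/-- `C`-module transformations. -/
@[ext]
structure Hom (F G : LaxModEnd C) where
  nat : F.functor ⟶ G.functor
  comm : ∀ x m : C, F.str x m ≫ nat.app (x ⊗ m) = x ◁ nat.app m ≫ G.str x m

/-- The category of lax `C`-module endofunctors and `C`-module transformations. -/
instance : Category (LaxModEnd C) where
  Hom F G := Hom F G
  id F := ⟨𝟙 F.functor, fun x m => by simp⟩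
  comp f g := ⟨f.nat ≫ g.nat, fun x m => by
    rw [NatTrans.comp_app, NatTrans.comp_app, reassoc_of% f.comm, g.comm,
      MonoidalCategory.whiskerLeft_comp, Category.assoc]⟩

@[ext]
theorem hom_ext {F G : LaxModEnd C} {f g : F ⟶ G} (h : f.nat = g.nat) : f = g := Hom.ext h

@[simp] theorem id_nat (F : LaxModEnd C) : (𝟙 F : F ⟶ F).nat = 𝟙 F.functor := rfl

@[simp] theorem comp_nat {F G H : LaxModEnd C} (f : F ⟶ G) (g : G ⟶ H) :
    (f ≫ g).nat = f.nat ≫ g.nat := rfl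

/-- An isomorphism from a natural isomorphism which is a module transformation. -/
def isoMk {F G : LaxModEnd C} (e : F.functor ≅ G.functor)
    (h : ∀ x m : C, F.str x m ≫ e.hom.app (x ⊗ m) = x ◁ e.hom.app m ≫ G.str x m) : F ≅ G where
  hom := ⟨e.hom, h⟩
  inv := ⟨e.inv, fun x m => by
    rw [← cancel_mono (e.hom.app (x ⊗ m)), Category.assoc, Category.assoc, e.inv_hom_id_app,
      h, ← MonoidalCategory.whiskerLeft_comp_assoc, e.inv_hom_id_app]
    simp⟩
  hom_inv_id := hom_ext e.hom_inv_id
  inv_hom_id := hom_ext e.inv_hom_id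

/-- The identity endofunctor. -/
def unit (C : Type w) [Category.{v} C] [MonoidalCategory C] : LaxModEnd C where
  functor := 𝟭 C
  lax :=
    { μₗ := fun x m => 𝟙 (x ⊗ m)
      μₗ_naturality_left := fun f d => by simp
      μₗ_naturality_right := fun c _ _ f => by simp
      μₗ_associativity := fun c c' d => by simp
      μₗ_unitality := fun d => by simp }

/-- The composite `F ∘ G`, with structure morphism
`x ⊗ F (G m) ⟶ F (x ⊗ G m) ⟶ F (G (x ⊗ m))`. -/
def comp (F G : LaxModEnd C) : LaxModEnd C where
  functor := G.functor ⋙ F.functor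
  lax :=
    { μₗ := fun x m => F.str x (G.functor.obj m) ≫ F.functor.map (G.str x m)
      μₗ_naturality_left := fun {c c'} f d => by
        change f ▷ F.functor.obj (G.functor.obj d) ≫ F.str _ _ ≫ F.functor.map (G.str _ _) =
          (F.str _ _ ≫ F.functor.map (G.str _ _)) ≫ F.functor.map (G.functor.map (f ▷ d))
        rw [reassoc_of% str_left, ← F.functor.map_comp, str_left, Category.assoc, F.functor.map_comp]
      μₗ_naturality_right := fun c d d' f => by
        change c ◁ F.functor.map (G.functor.map f) ≫ F.str _ _ ≫ F.functor.map (G.str _ _) =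
          (F.str _ _ ≫ F.functor.map (G.str _ _)) ≫ F.functor.map (G.functor.map (c ◁ f))
        rw [reassoc_of% str_right, ← F.functor.map_comp, str_right, Category.assoc, F.functor.map_comp]
      μₗ_associativity := fun c c' d => by
        change (F.str _ _ ≫ F.functor.map (G.str _ _)) ≫ F.functor.map (G.functor.map (α_ c c' d).hom)
          = (α_ c c' (F.functor.obj (G.functor.obj d))).hom ≫
            c ◁ (F.str c' _ ≫ F.functor.map (G.str c' d)) ≫ F.str c _ ≫ F.functor.map (G.str c _)
        rw [Category.assoc, ← F.functor.map_comp, str_assoc, F.functor.map_comp,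
          F.functor.map_comp, reassoc_of% str_assoc, MonoidalCategory.whiskerLeft_comp, Category.assoc,
          reassoc_of% str_right]
      μₗ_unitality := fun d => by
        change (λ_ (F.functor.obj (G.functor.obj d))).hom =
          (F.str _ _ ≫ F.functor.map (G.str _ _)) ≫ F.functor.map (G.functor.map (λ_ d).hom)
        rw [Category.assoc, ← F.functor.map_comp, ← str_unit, ← str_unit] }

theorem comp_str (F G : LaxModEnd C) (x m : C) : (comp F G).str x m =
    F.str x (G.functor.obj m) ≫ F.functor.map (G.str x m) := rfl

/-- Horizontal composition `f ∘ g` of module transformations. -/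
def compMap {F F' G G' : LaxModEnd C} (f : F ⟶ F') (g : G ⟶ G') : comp F G ⟶ comp F' G' where
  nat := g.nat ◫ f.nat
  comm x m := by
    rw [comp_str, comp_str]
    change (F.str _ _ ≫ F.functor.map (G.str _ _)) ≫ f.nat.app _ ≫ F'.functor.map (g.nat.app _) =
      x ◁ (f.nat.app _ ≫ F'.functor.map (g.nat.app _)) ≫ F'.str _ _ ≫ F'.functor.map (G'.str _ _)
    rw [Category.assoc, f.nat.naturality_assoc, reassoc_of% f.comm, ← F'.functor.map_comp, g.comm,
      F'.functor.map_comp, MonoidalCategory.whiskerLeft_comp, Category.assoc, reassoc_of% str_right]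

theorem compMap_app {F F' G G' : LaxModEnd C} (f : F ⟶ F') (g : G ⟶ G') (m : C) :
    (compMap f g).nat.app m = f.nat.app _ ≫ F'.functor.map (g.nat.app m) := rfl

/-- Lax `C`-module endofunctors form a monoidal category under composition,
`F ⊗ G = F ∘ G`. -/
instance : MonoidalCategoryStruct (LaxModEnd C) where
  tensorObj := comp
  tensorUnit := unit C
  tensorHom := compMap
  whiskerLeft F _ _ g := compMap (𝟙 F) g
  whiskerRight f G := compMap f (𝟙 G)
  associator F G H := isoMk (F := comp (comp F G) H) (G := comp F (comp G H))
    (Iso.refl (H.functor ⋙ G.functor ⋙ F.functor)) (fun x m => by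
      change ((F.str x (G.functor.obj (H.functor.obj m)) ≫
          F.functor.map (G.str x (H.functor.obj m))) ≫ F.functor.map (G.functor.map (H.str x m))) ≫
          𝟙 (F.functor.obj (G.functor.obj (H.functor.obj (x ⊗ m)))) =
        x ◁ 𝟙 (F.functor.obj (G.functor.obj (H.functor.obj m))) ≫
          F.str x (G.functor.obj (H.functor.obj m)) ≫
          F.functor.map (G.str x (H.functor.obj m) ≫ G.functor.map (H.str x m))
      simp)
  leftUnitor F := isoMk (F := comp (unit C) F) (G := F) (Iso.refl F.functor) (fun x m => by
      change (𝟙 _ ≫ F.str _ _) ≫ 𝟙 _ = x ◁ 𝟙 _ ≫ F.str _ _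
      simp)
  rightUnitor F := isoMk (F := comp F (unit C)) (G := F) (Iso.refl F.functor) (fun x m => by
      change (F.str _ _ ≫ F.functor.map (𝟙 _)) ≫ 𝟙 _ = x ◁ 𝟙 _ ≫ F.str _ _
      simp)

theorem hom_ext_app {F G : LaxModEnd C} {f g : F ⟶ G} (h : ∀ m, f.nat.app m = g.nat.app m) :
    f = g := hom_ext (NatTrans.ext (funext h))

theorem comp_app {F G H : LaxModEnd C} (f : F ⟶ G) (g : G ⟶ H) (m : C) :
    (f ≫ g).nat.app m = f.nat.app m ≫ g.nat.app m := rfl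

theorem whiskerLeft_app (F : LaxModEnd C) {G G' : LaxModEnd C} (g : G ⟶ G') (m : C) :
    (F ◁ g).nat.app m = F.functor.map (g.nat.app m) := Category.id_comp _

theorem whiskerRight_app {F F' : LaxModEnd C} (f : F ⟶ F') (G : LaxModEnd C) (m : C) :
    (f ▷ G).nat.app m = f.nat.app (G.functor.obj m) :=
  (congrArg (_ ≫ ·) (F'.functor.map_id _)).trans (Category.comp_id _)

theorem tensorHom_app {F F' G G' : LaxModEnd C} (f : F ⟶ F') (g : G ⟶ G') (m : C) :
    (f ⊗ₘ g).nat.app m = f.nat.app _ ≫ F'.functor.map (g.nat.app m) := rfl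

theorem associator_app (F G H : LaxModEnd C) (m : C) : (α_ F G H).hom.nat.app m = 𝟙 _ := rfl

theorem leftUnitor_app (F : LaxModEnd C) (m : C) : (λ_ F).hom.nat.app m = 𝟙 _ := rfl

theorem rightUnitor_app (F : LaxModEnd C) (m : C) : (ρ_ F).hom.nat.app m = 𝟙 _ := rfl

instance : MonoidalCategory (LaxModEnd C) where
  tensorHom_def f g := hom_ext_app fun m => by
    rw [comp_app, whiskerLeft_app, whiskerRight_app]
    rfl
  id_tensorHom_id F G := hom_ext_app fun m => by
    rw [tensorHom_app]
    change 𝟙 _ ≫ F.functor.map (𝟙 _) = 𝟙 _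
    simp
  tensorHom_comp_tensorHom {F₁ F₂ F₃ G₁ G₂ G₃} f g f' g' := hom_ext_app fun m => by
    change (f.nat.app (G₁.functor.obj m) ≫ F₂.functor.map (g.nat.app m)) ≫
        f'.nat.app (G₂.functor.obj m) ≫ F₃.functor.map (g'.nat.app m) =
      (f.nat.app (G₁.functor.obj m) ≫ f'.nat.app (G₁.functor.obj m)) ≫
        F₃.functor.map (g.nat.app m ≫ g'.nat.app m)
    simp
  whiskerLeft_id F G := hom_ext_app fun m => by
    rw [whiskerLeft_app]
    exact F.functor.map_id _
  id_whiskerRight F G := hom_ext_app fun m => by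
    rw [whiskerRight_app]
    rfl
  associator_naturality {F₁ F₂ F₃ G₁ G₂ G₃} f g h := hom_ext_app fun m => by
    change ((f.nat.app (F₂.functor.obj (F₃.functor.obj m)) ≫
        G₁.functor.map (g.nat.app (F₃.functor.obj m))) ≫
        G₁.functor.map (G₂.functor.map (h.nat.app m))) ≫
        𝟙 (G₁.functor.obj (G₂.functor.obj (G₃.functor.obj m))) =
      𝟙 (F₁.functor.obj (F₂.functor.obj (F₃.functor.obj m))) ≫
        f.nat.app (F₂.functor.obj (F₃.functor.obj m)) ≫
        G₁.functor.map (g.nat.app (F₃.functor.obj m) ≫ G₂.functor.map (h.nat.app m))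
    simp
  leftUnitor_naturality f := hom_ext_app fun m => by
    rw [comp_app, comp_app, leftUnitor_app, leftUnitor_app, whiskerLeft_app]
    exact (Category.comp_id _).trans (Category.id_comp _).symm
  rightUnitor_naturality f := hom_ext_app fun m => by
    rw [comp_app, comp_app, rightUnitor_app, rightUnitor_app, whiskerRight_app]
    exact (Category.comp_id _).trans (Category.id_comp _).symm
  pentagon F G H K := hom_ext_app fun m => by
    simp only [comp_app, associator_app, whiskerLeft_app, whiskerRight_app]
    change 𝟙 (F.functor.obj (G.functor.obj (H.functor.obj (K.functor.obj m)))) ≫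
      𝟙 (F.functor.obj (G.functor.obj (H.functor.obj (K.functor.obj m)))) ≫
      F.functor.map (𝟙 (G.functor.obj (H.functor.obj (K.functor.obj m)))) =
      𝟙 (F.functor.obj (G.functor.obj (H.functor.obj (K.functor.obj m)))) ≫ 𝟙 _
    simp
  triangle F G := hom_ext_app fun m => by
    simp only [comp_app, associator_app, whiskerLeft_app, whiskerRight_app, leftUnitor_app,
      rightUnitor_app]
    change 𝟙 (F.functor.obj (G.functor.obj m)) ≫ F.functor.map (𝟙 (G.functor.obj m)) =
      𝟙 (F.functor.obj (G.functor.obj m))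
    simp

/-- The property of being left exact (preserving finite limits) and finitary (preserving filtered
colimits). -/
def IsLexFinitary : ObjectProperty (LaxModEnd C) := fun F =>
  Limits.PreservesFiniteLimits F.functor ∧ Limits.PreservesFilteredColimits F.functor

instance : (IsLexFinitary (C := C)).IsMonoidal where
  prop_unit := by
    change Limits.PreservesFiniteLimits (𝟭 C) ∧ Limits.PreservesFilteredColimits (𝟭 C)
    exact ⟨inferInstance, inferInstance⟩
  prop_tensor F G hF hG := by
    obtain ⟨_, _⟩ := hF
    obtain ⟨_, _⟩ := hG
    change Limits.PreservesFiniteLimits (G.functor ⋙ F.functor) ∧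
      Limits.PreservesFilteredColimits (G.functor ⋙ F.functor)
    exact ⟨Limits.comp_preservesFiniteLimits _ _, Limits.comp_preservesFilteredColimits _ _⟩

end LaxModEnd

/-- The monoidal category of left exact finitary lax `C`-module endofunctors of `C`. -/
abbrev LexLaxModEnd (C : Type w) [Category.{v} C] [MonoidalCategory C] :=
  (LaxModEnd.IsLexFinitary (C := C)).FullSubcategory

namespace LeftComodule

variable {k B : Type u} [Field k] [Ring B] [Bialgebra k B]

/-- A subspace stable under the coaction is a comodule. -/
noncomputable def sub (T : LeftComodule k B) (S : Submodule k T.carrier)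
    (hl : ∀ s ∈ S, T.coact s ∈ LinearMap.range (S.subtype.lTensor B)) : LeftComodule k B where
  carrier := S
  coact := LinearMap.codRestrictOfInjective (T.coact ∘ₗ S.subtype)
    (S.subtype.lTensor B) (lTensor_inj B S.injective_subtype) (fun s => hl s s.2)
  isLeftCoaction := T.isLeftCoaction.of_injective S.subtype S.injective_subtype
    (fun s => LinearMap.codRestrictOfInjective_comp_apply _ _ _ _ s)

/-- The inclusion of a subcomodule. -/
noncomputable def subIncl (T : LeftComodule k B) (S : Submodule k T.carrier)
    (hl : ∀ s ∈ S, T.coact s ∈ LinearMap.range (S.subtype.lTensor B)) : T.sub S hl ⟶ T where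
  toLin := S.subtype
  comm s := (LinearMap.codRestrictOfInjective_comp_apply (T.coact ∘ₗ S.subtype)
    (S.subtype.lTensor B) (lTensor_inj B S.injective_subtype) (fun s => hl s s.2) s).symm

/-- A morphism whose image lies in the image of an injective morphism factors through it. -/
noncomputable def lift {P S T : LeftComodule k B} (i : S ⟶ T) (hi : Function.Injective i.toLin)
    (f : P ⟶ T) (h : ∀ p, f.toLin p ∈ LinearMap.range i.toLin) : P ⟶ S :=
  have h' : ∀ p, i.toLin (LinearMap.codRestrictOfInjective f.toLin i.toLin hi h p) = f.toLin p :=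
    fun p => LinearMap.codRestrictOfInjective_comp_apply _ _ _ _ p
  have h'' : i.toLin ∘ₗ (LinearMap.codRestrictOfInjective f.toLin i.toLin hi h) = f.toLin :=
    LinearMap.ext h'
  { toLin := LinearMap.codRestrictOfInjective f.toLin i.toLin hi h
    comm := fun p => by
      apply lTensor_inj B hi
      rw [← i.comm, h', f.comm, ← LinearMap.lTensor_comp_apply, h''] }

theorem lift_comp {P S T : LeftComodule k B} (i : S ⟶ T) (hi : Function.Injective i.toLin)
    (f : P ⟶ T) (h : ∀ p, f.toLin p ∈ LinearMap.range i.toLin) : lift i hi f h ≫ i = f :=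
  hom_ext (LinearMap.ext fun p => LinearMap.codRestrictOfInjective_comp_apply _ _ _ _ p)

theorem cancel {P S T : LeftComodule k B} {i : S ⟶ T} (hi : Function.Injective i.toLin)
    {f g : P ⟶ S} (h : f ≫ i = g ≫ i) : f = g :=
  hom_ext (LinearMap.ext fun p => hi (LinearMap.congr_fun (congrArg Hom.toLin h) p))

end LeftComodule

namespace HopfTrimodule

open MonoidalCategory

variable {k B : Type u} [Field k] [Ring B] [Bialgebra k B]

/-- The left comodule `X ⊗ N` with coaction through `X`. -/
noncomputable def outerC (X : HopfTrimodule k B) (N : LeftComodule k B) : LeftComodule k B where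
  carrier := X.carrier ⊗[k] N.carrier
  coact := outerL X.lcoact N.carrier
  isLeftCoaction := outerL_isLeftCoaction X.isLeftCoaction

/-- Functoriality of `outerC`. -/
noncomputable def outerCMap {X X' : HopfTrimodule k B} {N N' : LeftComodule k B} (f : X ⟶ X')
    (g : N ⟶ N') : outerC X N ⟶ outerC X' N' where
  toLin := TensorProduct.map f.toLin g.toLin
  comm := map_outerL f.lcomm g.toLin

theorem outerCMap_comp {X X' X'' : HopfTrimodule k B} {N N' N'' : LeftComodule k B} (f : X ⟶ X')
    (f' : X' ⟶ X'') (g : N ⟶ N') (g' : N' ⟶ N'') :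
    outerCMap f g ≫ outerCMap f' g' = outerCMap (f ≫ f') (g ≫ g') :=
  LeftComodule.hom_ext (TensorProduct.ext' fun _ _ => rfl)

theorem outerCMap_id (X : HopfTrimodule k B) (N : LeftComodule k B) :
    outerCMap (𝟙 X) (𝟙 N) = 𝟙 (outerC X N) :=
  LeftComodule.hom_ext (TensorProduct.ext' fun _ _ => rfl)

/-- The cotensor product `X □ N` of a Hopf trimodule with a left comodule, with left coaction
`x ⊗ n ↦ x₋₁ ⊗ (x₀ ⊗ n)`. -/
noncomputable def cotensC (X : HopfTrimodule k B) (N : LeftComodule k B) : LeftComodule k B :=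
  (outerC X N).sub (cotensor X.rcoact N.coact) (fun _ ht => outerL_mem X.bicomodule ht)

/-- The inclusion `X □ N → X ⊗ N`. -/
noncomputable def inclC (X : HopfTrimodule k B) (N : LeftComodule k B) :
    cotensC X N ⟶ outerC X N :=
  (outerC X N).subIncl (cotensor X.rcoact N.coact) (fun _ ht => outerL_mem X.bicomodule ht)

theorem inclC_injective (X : HopfTrimodule k B) (N : LeftComodule k B) :
    Function.Injective (inclC X N).toLin := Subtype.val_injective

theorem mem_range_inclC {X : HopfTrimodule k B} {N : LeftComodule k B}
    {t : X.carrier ⊗[k] N.carrier} :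
    t ∈ LinearMap.range (inclC X N).toLin ↔ t ∈ cotensor X.rcoact N.coact :=
  ⟨fun ⟨s, hs⟩ => hs ▸ s.2, fun h => ⟨⟨t, h⟩, rfl⟩⟩

/-- Functoriality of the cotensor product. -/
noncomputable def cotensCMap {X X' : HopfTrimodule k B} {N N' : LeftComodule k B} (f : X ⟶ X')
    (g : N ⟶ N') : cotensC X N ⟶ cotensC X' N' :=
  LeftComodule.lift (inclC X' N') (inclC_injective X' N') (inclC X N ≫ outerCMap f g)
    (fun p => mem_range_inclC.2 (map_mem_cotensor f.rcomm g.comm p.2))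

theorem cotensCMap_inclC {X X' : HopfTrimodule k B} {N N' : LeftComodule k B} (f : X ⟶ X')
    (g : N ⟶ N') : cotensCMap f g ≫ inclC X' N' = inclC X N ≫ outerCMap f g :=
  LeftComodule.lift_comp _ _ _ _

theorem cotensCMap_comp {X X' X'' : HopfTrimodule k B} {N N' N'' : LeftComodule k B} (f : X ⟶ X')
    (f' : X' ⟶ X'') (g : N ⟶ N') (g' : N' ⟶ N'') :
    cotensCMap f g ≫ cotensCMap f' g' = cotensCMap (f ≫ f') (g ≫ g') :=
  LeftComodule.cancel (inclC_injective _ _) (by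
    rw [Category.assoc, cotensCMap_inclC, reassoc_of% cotensCMap_inclC, outerCMap_comp,
      cotensCMap_inclC])

theorem cotensCMap_id (X : HopfTrimodule k B) (N : LeftComodule k B) :
    cotensCMap (𝟙 X) (𝟙 N) = 𝟙 (cotensC X N) :=
  LeftComodule.cancel (inclC_injective _ _) (by
    rw [cotensCMap_inclC, outerCMap_id, Category.id_comp, Category.comp_id])

/-- The comodule morphism `M ⊗ (X ⊗ N) → X ⊗ (M ⊗ N)`, `m ⊗ (x ⊗ n) ↦ m₋₁ x ⊗ (m₀ ⊗ n)`. -/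
noncomputable def outerChi (X : HopfTrimodule k B) (M N : LeftComodule k B) :
    M ⊗ outerC X N ⟶ outerC X (M ⊗ N) where
  toLin := interchange M.coact X.act N.carrier
  comm := interchange_coact M.isLeftCoaction X.lcoact_act

/-- The interchange morphism `χ : M ⊗ (X □ N) → X □ (M ⊗ N)`,
the restriction of `m ⊗ (x ⊗ n) ↦ m₋₁ x ⊗ (m₀ ⊗ n)`. -/
noncomputable def chi (X : HopfTrimodule k B) (M N : LeftComodule k B) :
    M ⊗ cotensC X N ⟶ cotensC X (M ⊗ N) :=
  LeftComodule.lift (inclC X (M ⊗ N)) (inclC_injective _ _) (M ◁ inclC X N ≫ outerChi X M N)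
    (fun p => mem_range_inclC.2 (interchange_mem M.isLeftCoaction X.rcoact_act p))

theorem chi_inclC (X : HopfTrimodule k B) (M N : LeftComodule k B) :
    chi X M N ≫ inclC X (M ⊗ N) = M ◁ inclC X N ≫ outerChi X M N :=
  LeftComodule.lift_comp _ _ _ _

theorem outerChi_naturality {X X' : HopfTrimodule k B} {M M' N N' : LeftComodule k B} (f : X ⟶ X')
    (g : M ⟶ M') (h : N ⟶ N') : (g ⊗ₘ outerCMap f h) ≫ outerChi X' M' N' =
      outerChi X M N ≫ outerCMap f (g ⊗ₘ h) :=
  LeftComodule.hom_ext (LinearMap.ext (interchange_map g.comm f.acomm h.toLin))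

theorem outerChi_assoc (X : HopfTrimodule k B) (M M' N : LeftComodule k B) :
    outerChi X (M ⊗ M') N ≫ outerCMap (𝟙 X) (α_ M M' N).hom =
      (α_ M M' (outerC X N)).hom ≫ M ◁ outerChi X M' N ≫ outerChi X M (M' ⊗ N) :=
  LeftComodule.hom_ext (LinearMap.ext (interchange_assoc M.coact M'.coact X.act))

theorem outerChi_unit (X : HopfTrimodule k B) (N : LeftComodule k B) :
    outerChi X (𝟙_ _) N ≫ outerCMap (𝟙 X) (λ_ N).hom = (λ_ (outerC X N)).hom :=
  LeftComodule.hom_ext (LinearMap.ext (interchange_unit X.act))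

theorem chi_naturality {X X' : HopfTrimodule k B} {M M' N N' : LeftComodule k B} (f : X ⟶ X')
    (g : M ⟶ M') (h : N ⟶ N') : (g ⊗ₘ cotensCMap f h) ≫ chi X' M' N' =
      chi X M N ≫ cotensCMap f (g ⊗ₘ h) :=
  LeftComodule.cancel (inclC_injective _ _) (by
    rw [Category.assoc, Category.assoc, chi_inclC, cotensCMap_inclC, reassoc_of% chi_inclC,
      ← outerChi_naturality, ← id_tensorHom, ← id_tensorHom, tensorHom_comp_tensorHom_assoc,
      tensorHom_comp_tensorHom_assoc, cotensCMap_inclC, Category.comp_id, Category.id_comp])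

theorem chi_assoc (X : HopfTrimodule k B) (M M' N : LeftComodule k B) :
    chi X (M ⊗ M') N ≫ cotensCMap (𝟙 X) (α_ M M' N).hom =
      (α_ M M' (cotensC X N)).hom ≫ M ◁ chi X M' N ≫ chi X M (M' ⊗ N) :=
  LeftComodule.cancel (inclC_injective _ _) (by
    rw [Category.assoc, cotensCMap_inclC, reassoc_of% chi_inclC, outerChi_assoc]
    simp only [Category.assoc]
    rw [chi_inclC, ← MonoidalCategory.whiskerLeft_comp_assoc, chi_inclC]
    simp)

theorem chi_unit (X : HopfTrimodule k B) (N : LeftComodule k B) :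
    (λ_ (cotensC X N)).hom = chi X (𝟙_ _) N ≫ cotensCMap (𝟙 X) (λ_ N).hom :=
  LeftComodule.cancel (inclC_injective _ _) (by
    rw [Category.assoc, cotensCMap_inclC, reassoc_of% chi_inclC, outerChi_unit, leftUnitor_naturality])

/-- The lax module endofunctor `(X □ -, χ)` of `ᴮVect`. -/
noncomputable def laxFunctor (X : HopfTrimodule k B) : LaxModEnd (LeftComodule k B) where
  functor :=
    { obj := fun N => cotensC X N
      map := fun g => cotensCMap (𝟙 X) g
      map_id := fun N => cotensCMap_id X N
      map_comp := fun g h => by rw [cotensCMap_comp, Category.comp_id] }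
  lax :=
    { μₗ := fun M N => chi X M N
      μₗ_naturality_left := fun {M M'} g N => by
        have := chi_naturality (𝟙 X) g (𝟙 N)
        rw [cotensCMap_id, tensorHom_id, tensorHom_id] at this
        exact this
      μₗ_naturality_right := fun M {N N'} g => by
        have := chi_naturality (𝟙 X) (𝟙 M) g
        rw [id_tensorHom, id_tensorHom] at this
        exact this
      μₗ_associativity := fun M M' N => chi_assoc X M M' N
      μₗ_unitality := fun N => chi_unit X N }

/-- The functor `X ↦ (X □ -, χ)` from Hopf trimodules to lax module endofunctors of `ᴮVect`. -/
noncomputable def sigma (k B : Type u) [Field k] [Ring B] [Bialgebra k B] :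
    HopfTrimodule k B ⥤ LaxModEnd (LeftComodule k B) where
  obj X := laxFunctor X
  map {X Y} f :=
    { nat :=
        { app := fun N => cotensCMap f (𝟙 N)
          naturality := fun N N' g => by
            change cotensCMap (𝟙 X) g ≫ cotensCMap f (𝟙 N') =
              cotensCMap f (𝟙 N) ≫ cotensCMap (𝟙 Y) g
            simp [cotensCMap_comp] }
      comm := fun M N => by
        have := chi_naturality f (𝟙 M) (𝟙 N)
        rw [id_tensorHom, id_tensorHom, MonoidalCategory.whiskerLeft_id] at this
        exact this.symm }
  map_id X := LaxModEnd.hom_ext_app fun N => cotensCMap_id X N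
  map_comp f g := LaxModEnd.hom_ext_app fun N => by
    change cotensCMap (f ≫ g) (𝟙 N) = cotensCMap f (𝟙 N) ≫ cotensCMap g (𝟙 N)
    rw [cotensCMap_comp, Category.comp_id]

/-- The forgetful functor from Hopf trimodules to left comodules. -/
noncomputable def forgetC (k B : Type u) [Field k] [Ring B] [Bialgebra k B] :
    HopfTrimodule k B ⥤ LeftComodule k B where
  obj X := X.toLeftComodule
  map f := ⟨f.toLin, f.lcomm⟩

end HopfTrimodule

/-- Evaluation of a left exact finitary lax module endofunctor at the comodule `B`. -/
noncomputable def evalB (k B : Type u) [Field k] [Ring B] [Bialgebra k B] :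
    LexLaxModEnd (LeftComodule k B) ⥤ LeftComodule k B where
  obj F := F.obj.functor.obj (LeftComodule.regular k B)
  map f := f.hom.nat.app (LeftComodule.regular k B)

/-- The composite inclusion `X □ (Y □ N) → X ⊗ (Y ⊗ N)`. -/
noncomputable def nestL {k B : Type u} [Field k] [Ring B] [Bialgebra k B]
    (X Y : HopfTrimodule k B) (N : LeftComodule k B) :
    (HopfTrimodule.cotensC X (HopfTrimodule.cotensC Y N)).carrier →ₗ[k]
      X.carrier ⊗[k] (Y.carrier ⊗[k] N.carrier) :=
  ((HopfTrimodule.inclC Y N).toLin.lTensor X.carrier) ∘ₗ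
    (HopfTrimodule.inclC X (HopfTrimodule.cotensC Y N)).toLin

/-- The composite inclusion `(X □ Y) □ N → (X ⊗ Y) ⊗ N`. -/
noncomputable def nestR {k B : Type u} [Field k] [Ring B] [Bialgebra k B]
    (X Y : HopfTrimodule k B) (N : LeftComodule k B) :
    (HopfTrimodule.cotensC (HopfTrimodule.cotens X Y) N).carrier →ₗ[k]
      (X.carrier ⊗[k] Y.carrier) ⊗[k] N.carrier :=
  ((HopfTrimodule.incl X Y).toLin.rTensor N.carrier) ∘ₗ
    (HopfTrimodule.inclC (HopfTrimodule.cotens X Y) N).toLin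

/-- For a lax module endofunctor `F` of `ᴮVect` and `b` in `B`, the map
`F(B) → B ⊗ F(B) → F(B ⊗ B) → F(B)` built from `b ⊗ -`, the lax structure and the
multiplication of `B`. -/
noncomputable def evalAct {k B : Type u} [Field k] [Ring B] [Bialgebra k B]
    (F : LaxModEnd (LeftComodule k B)) (b : B) :
    (F.functor.obj (LeftComodule.regular k B)).carrier →ₗ[k]
      (F.functor.obj (LeftComodule.regular k B)).carrier :=
  (F.functor.map (LeftComodule.mulHom k B)).toLin ∘ₗ
    (F.str (LeftComodule.regular k B) (LeftComodule.regular k B)).toLin ∘ₗ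
      TensorProduct.mk k B (F.functor.obj (LeftComodule.regular k B)).carrier b

end HopfTri

/-!
The functor `X □ -` is the kernel of a map between exact filtered-colimit-preserving functors
`X ⊗ -` and `X ⊗ B ⊗ -`, so it is left exact and finitary (`HopfTrimodule.sigma_isLexFinitary`).
Every compatibility of the monoidal structure is checked after the injections of the iterated
cotensor products into the tensor products (`HopfTrimodule.sigma_monoidal`).

The converse reconstructs a left exact finitary lax module functor `F` from the value `F(B)`. Two
facts make this possible.

* A vector space `V` is a comodule with trivial coaction, and the structure morphism
  `V ⊗ F(N) → F(V ⊗ N)` is then invertible (`LaxModEnd.strTriv_bijective`). On elements it is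
  `v ⊗ x ↦ F(n ↦ v ⊗ n)(x)`; it is injective because linear functionals on `V` separate elements,
  and surjective for finite dimensional `V` by additivity of `F`, hence for all `V` because `F`
  preserves the filtered colimit of the finite dimensional subspaces.
* Every comodule `M` is the equaliser of two morphisms `M ⊗ B ⇉ (M ⊗ B) ⊗ B` in which only the last
  factor `B` has a nontrivial coaction (`LeftComodule.spread_exact`).

Applying `F` to the equaliser and commuting `F` with the trivial factors gives an injection
`F(M) → F(B) ⊗ M` (`LaxModEnd.coord`). For `M = B` it is a right coaction on `F(B)`, and for
general `M` its image is the cotensor product `F(B) □ M` (`LaxModEnd.mem_range_coord`). The lax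
structure on `B` and the multiplication of `B` give an action of `B` on `F(B)`. Since
`M → M ⊗ B` is multiplicative in `M`, the structure morphism `M ⊗ F(N) → F(M ⊗ N)` becomes the
interchange map in these coordinates (`LaxModEnd.coord_strMap`). This identity gives the remaining
Hopf trimodule axiom for `F(B)` and shows that `F ≅ F(B) □ -` as module functors
(`LaxModEnd.comparisonIso`).

A module transformation is determined by its component at `B` (`LaxModEnd.hom_ext_valB`), and under
`X ≅ X □ B` that component is a morphism of trimodules: it commutes with `evalAct`, which is the
action, and with `F(b ↦ b₁ φ(b₂))` for every functional `φ`, and these endomorphisms determine the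
right coaction. So the functor is fully faithful, and the same compatibilities, applied to the
counit of the equivalence, describe its quasi-inverse as evaluation at `B`.
-/

/-! ### Kernels and finite products of comodules -/

namespace HopfTri

namespace LeftComodule

open Limits

variable {k B : Type u} [Field k] [Ring B] [Bialgebra k B]

theorem congr_hom {M N : LeftComodule k B} {f g : M ⟶ N} (h : f = g) (m : M.carrier) :
    f.toLin m = g.toLin m := by rw [h]

instance (M N : LeftComodule k B) : Zero (M ⟶ N) := ⟨⟨0, fun m => by simp⟩⟩

instance (M N : LeftComodule k B) : Add (M ⟶ N) :=
  ⟨fun f g => ⟨f.toLin + g.toLin, fun m => by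
    simp [f.comm, g.comm, LinearMap.lTensor_add]⟩⟩

instance (M N : LeftComodule k B) : Neg (M ⟶ N) :=
  ⟨fun f => ⟨-f.toLin, fun m => by simp [f.comm, LinearMap.lTensor_neg]⟩⟩

@[simp] theorem zero_toLin (M N : LeftComodule k B) : (0 : M ⟶ N).toLin = 0 := rfl

@[simp] theorem add_toLin {M N : LeftComodule k B} (f g : M ⟶ N) :
    (f + g).toLin = f.toLin + g.toLin := rfl

instance (M N : LeftComodule k B) : AddCommGroup (M ⟶ N) where
  add_assoc f g h := hom_ext (add_assoc _ _ _)
  zero_add f := hom_ext (zero_add _)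
  add_zero f := hom_ext (add_zero _)
  add_comm f g := hom_ext (add_comm _ _)
  neg_add_cancel f := hom_ext (neg_add_cancel _)
  nsmul := nsmulRec
  zsmul := zsmulRec

/-- The category of comodules is preadditive, with pointwise addition of morphisms. -/
instance : Preadditive (LeftComodule k B) where
  add_comp _ _ _ f f' g := hom_ext (LinearMap.comp_add _ _ _)
  comp_add _ _ _ f g g' := hom_ext (LinearMap.add_comp _ _ _)

theorem sum_toLin {M N : LeftComodule k B} {ι : Type*} (s : Finset ι) (f : ι → (M ⟶ N)) :
    (∑ i ∈ s, f i).toLin = ∑ i ∈ s, (f i).toLin := by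
  classical
  induction s using Finset.induction_on with
  | empty => simp
  | insert a s ha h => rw [Finset.sum_insert ha, Finset.sum_insert ha, add_toLin, h]

/-- The zero comodule. -/
def zero (k B : Type u) [Field k] [Ring B] [Bialgebra k B] : LeftComodule k B where
  carrier := PUnit
  coact := 0
  isLeftCoaction := { coassoc := fun _ => by simp, counit := fun _ => rfl }

instance : HasZeroObject (LeftComodule k B) :=
  ⟨⟨zero k B, (IsZero.iff_id_eq_zero _).2 (hom_ext (LinearMap.ext fun _ => rfl))⟩⟩

/-- The direct sum of two comodules. -/
noncomputable def prod (M N : LeftComodule k B) : LeftComodule k B where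
  carrier := M.carrier × N.carrier
  coact := ((LinearMap.inl k M.carrier N.carrier).lTensor B ∘ₗ M.coact).coprod
    ((LinearMap.inr k M.carrier N.carrier).lTensor B ∘ₗ N.coact)
  isLeftCoaction :=
    { coassoc := by
        have h1 : ∀ {P Q : Type u} [AddCommGroup P] [Module k P] [AddCommGroup Q] [Module k Q]
            (j : P →ₗ[k] Q) (t : B ⊗[k] P), TensorProduct.assoc k B B Q
            ((Coalgebra.comul (R := k) (A := B)).rTensor Q (j.lTensor B t)) =
            (j.lTensor B).lTensor B (TensorProduct.assoc k B B P
              ((Coalgebra.comul (R := k) (A := B)).rTensor P t)) := by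
          intro P Q _ _ _ _ j t
          induction t with
          | zero => simp
          | add x y hx hy => simp only [map_add, hx, hy]
          | tmul b p =>
            simp only [LinearMap.rTensor_tmul, LinearMap.lTensor_tmul]
            generalize (Coalgebra.comul (R := k) b) = d
            induction d with
            | zero => simp
            | add x y hx hy => simp only [TensorProduct.add_tmul, map_add, hx, hy]
            | tmul a b => simp
        rintro ⟨m, n⟩
        simp only [LinearMap.coprod_apply, LinearMap.comp_apply, map_add, h1,
          M.isLeftCoaction.coassoc, N.isLeftCoaction.coassoc, ← LinearMap.lTensor_comp_apply,
          LinearMap.coprod_inl, LinearMap.coprod_inr]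
      counit := by
        have h1 : ∀ {P Q : Type u} [AddCommGroup P] [Module k P] [AddCommGroup Q] [Module k Q]
            (j : P →ₗ[k] Q) (t : B ⊗[k] P), TensorProduct.lid k Q
            ((Coalgebra.counit (R := k) (A := B)).rTensor Q (j.lTensor B t)) =
            j (TensorProduct.lid k P
              ((Coalgebra.counit (R := k) (A := B)).rTensor P t)) := by
          intro P Q _ _ _ _ j t
          induction t with
          | zero => simp
          | add x y hx hy => simp only [map_add, hx, hy]
          | tmul b p => simp
        rintro ⟨m, n⟩
        simp only [LinearMap.coprod_apply, LinearMap.comp_apply, map_add, h1,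
          M.isLeftCoaction.counit, N.isLeftCoaction.counit]
        simp }

/-- The direct sum as a binary bicone. -/
noncomputable def prodBicone (M N : LeftComodule k B) : BinaryBicone M N where
  pt := prod M N
  fst := ⟨LinearMap.fst k M.carrier N.carrier, fun p => by
    change M.coact p.1 = (LinearMap.fst k M.carrier N.carrier).lTensor B
      ((LinearMap.inl k M.carrier N.carrier).lTensor B (M.coact p.1) +
        (LinearMap.inr k M.carrier N.carrier).lTensor B (N.coact p.2))
    rw [map_add, ← LinearMap.lTensor_comp_apply, ← LinearMap.lTensor_comp_apply,
      LinearMap.fst_comp_inl, LinearMap.fst_comp_inr]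
    simp⟩
  snd := ⟨LinearMap.snd k M.carrier N.carrier, fun p => by
    change N.coact p.2 = (LinearMap.snd k M.carrier N.carrier).lTensor B
      ((LinearMap.inl k M.carrier N.carrier).lTensor B (M.coact p.1) +
        (LinearMap.inr k M.carrier N.carrier).lTensor B (N.coact p.2))
    rw [map_add, ← LinearMap.lTensor_comp_apply, ← LinearMap.lTensor_comp_apply,
      LinearMap.snd_comp_inl, LinearMap.snd_comp_inr]
    simp⟩
  inl := ⟨LinearMap.inl k M.carrier N.carrier, fun m => by
    change (LinearMap.inl k M.carrier N.carrier).lTensor B (M.coact m) +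
      (LinearMap.inr k M.carrier N.carrier).lTensor B (N.coact 0) = _
    rw [map_zero, map_zero, add_zero]
    rfl⟩
  inr := ⟨LinearMap.inr k M.carrier N.carrier, fun n => by
    change (LinearMap.inl k M.carrier N.carrier).lTensor B (M.coact 0) +
      (LinearMap.inr k M.carrier N.carrier).lTensor B (N.coact n) = _
    rw [map_zero, map_zero, zero_add]
    rfl⟩
  inl_fst := hom_ext (LinearMap.ext fun _ => rfl)
  inl_snd := hom_ext (LinearMap.ext fun _ => rfl)
  inr_fst := hom_ext (LinearMap.ext fun _ => rfl)
  inr_snd := hom_ext (LinearMap.ext fun _ => rfl)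

instance : HasBinaryBiproducts (LeftComodule k B) where
  has_binary_biproduct M N := hasBinaryBiproduct_of_total (prodBicone M N) (by
    refine hom_ext (LinearMap.ext ?_)
    rintro ⟨m, n⟩
    exact Prod.ext (add_zero m) (zero_add n))

instance : HasFiniteProducts (LeftComodule k B) :=
  have := HasZeroObject.hasTerminal (C := LeftComodule k B)
  hasFiniteProducts_of_has_binary_and_terminal

/-- The equaliser of two comodule morphisms, as a subcomodule of the source. -/
noncomputable def equalizerSub {M N : LeftComodule k B} (f g : M ⟶ N) : LeftComodule k B :=
  M.sub (LinearMap.eqLocus f.toLin g.toLin) (fun s hs => mem_range_lTensor B _ _ _ (by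
    rw [← f.comm, ← g.comm, LinearMap.mem_eqLocus.1 hs]))

/-- The inclusion of the equaliser. -/
noncomputable def equalizerIncl {M N : LeftComodule k B} (f g : M ⟶ N) : equalizerSub f g ⟶ M :=
  M.subIncl (LinearMap.eqLocus f.toLin g.toLin) (fun s hs => mem_range_lTensor B _ _ _ (by
    rw [← f.comm, ← g.comm, LinearMap.mem_eqLocus.1 hs]))

theorem equalizerIncl_condition {M N : LeftComodule k B} (f g : M ⟶ N) :
    equalizerIncl f g ≫ f = equalizerIncl f g ≫ g :=
  hom_ext (LinearMap.ext fun s => s.2)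

/-- A fork of comodules which is an equaliser of vector spaces is an equaliser of comodules. -/
noncomputable def isLimitFork {K M N : LeftComodule k B} {f g : M ⟶ N} (i : K ⟶ M)
    (w : i ≫ f = i ≫ g) (hi : Function.Injective i.toLin)
    (h : ∀ m, f.toLin m = g.toLin m → m ∈ LinearMap.range i.toLin) :
    IsLimit (Fork.ofι i w) :=
  Fork.IsLimit.mk' _ fun s =>
    ⟨lift i hi s.ι fun p => h _ (congr_hom s.condition p), lift_comp _ _ _ _,
      fun hm => cancel hi (hm.trans (lift_comp i hi s.ι
        fun p => h _ (congr_hom s.condition p)).symm)⟩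

instance : HasEqualizers (LeftComodule k B) :=
  have : ∀ {M N : LeftComodule k B} {f g : M ⟶ N}, HasLimit (parallelPair f g) :=
    fun {_ _ f g} => ⟨⟨_, isLimitFork (equalizerIncl f g) (equalizerIncl_condition f g)
      Subtype.val_injective (fun m hm => ⟨⟨m, hm⟩, rfl⟩)⟩⟩
  hasEqualizers_of_hasLimit_parallelPair _

/-- An equaliser of comodules is an equaliser of vector spaces. -/
theorem fork_exact {M N : LeftComodule k B} {f g : M ⟶ N} {s : Fork f g} (hs : IsLimit s) :
    Function.Injective s.ι.toLin ∧
      ∀ m, f.toLin m = g.toLin m → m ∈ LinearMap.range s.ι.toLin := by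
  have h1 : (Fork.IsLimit.lift hs (equalizerIncl f g) (equalizerIncl_condition f g)) ≫ s.ι =
      equalizerIncl f g := Fork.IsLimit.lift_ι hs
  have h2 : ∀ x, f.toLin (s.ι.toLin x) = g.toLin (s.ι.toLin x) := congr_hom s.condition
  let j : s.pt ⟶ equalizerSub f g := lift (equalizerIncl f g) Subtype.val_injective s.ι
    (fun x => ⟨⟨_, h2 x⟩, rfl⟩)
  have hj : j ≫ equalizerIncl f g = s.ι := lift_comp _ _ _ _
  have h3 : j ≫ Fork.IsLimit.lift hs (equalizerIncl f g) (equalizerIncl_condition f g) = 𝟙 _ := by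
    refine Fork.IsLimit.hom_ext hs ?_
    rw [Category.assoc, h1, hj, Category.id_comp]
  refine ⟨fun x y hxy => ?_, fun m hm => ⟨_, congr_hom h1 ⟨m, hm⟩⟩⟩
  have : j.toLin x = j.toLin y := Subtype.val_injective
    (((congr_hom hj x).trans hxy).trans (congr_hom hj y).symm)
  exact ((congr_hom h3 x).symm.trans (congrArg (Fork.IsLimit.lift hs (equalizerIncl f g)
    (equalizerIncl_condition f g)).toLin this)).trans (congr_hom h3 y)

theorem injective_of_mono {M N : LeftComodule k B} (f : M ⟶ N) [Mono f] :
    Function.Injective f.toLin := by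
  have h : equalizerIncl f 0 = 0 := by
    rw [← cancel_mono f, equalizerIncl_condition, Limits.comp_zero, Limits.zero_comp]
  exact (injective_iff_map_eq_zero _).2 fun m hm => congr_hom h ⟨m, hm⟩

theorem mono_of_injective {M N : LeftComodule k B} (f : M ⟶ N)
    (hf : Function.Injective f.toLin) : Mono f := ⟨fun _ _ h => cancel hf h⟩

section Lex

variable (F : LeftComodule k B ⥤ LeftComodule k B)

theorem map_injective [PreservesFiniteLimits F] {M N : LeftComodule k B} (f : M ⟶ N)
    (hf : Function.Injective f.toLin) : Function.Injective (F.map f).toLin :=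
  have := mono_of_injective f hf
  injective_of_mono (F.map f)

/-- A left exact functor preserves equalisers of the underlying vector spaces. -/
theorem map_exact [PreservesFiniteLimits F] {K M N : LeftComodule k B} {f g : M ⟶ N} (i : K ⟶ M)
    (w : i ≫ f = i ≫ g) (hi : Function.Injective i.toLin)
    (h : ∀ m, f.toLin m = g.toLin m → m ∈ LinearMap.range i.toLin) (y : (F.obj M).carrier)
    (hy : (F.map f).toLin y = (F.map g).toLin y) : y ∈ LinearMap.range (F.map i).toLin :=
  (fork_exact (isLimitForkMapOfIsLimit F w (isLimitFork i w hi h))).2 y hy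

theorem additive_of_lex [PreservesFiniteLimits F] : F.Additive :=
  have : F.PreservesZeroMorphisms :=
    Functor.preservesZeroMorphisms_of_preserves_terminal_object
  F.additive_of_preserves_binary_products

/-- An additive endofunctor preserving kernels of the underlying vector spaces is left exact. -/
theorem preservesFiniteLimits_of_exact [F.Additive]
    (h : ∀ {K M N : LeftComodule k B} (f : M ⟶ N) (i : K ⟶ M), i ≫ f = 0 →
      Function.Injective i.toLin → (∀ m, f.toLin m = 0 → m ∈ LinearMap.range i.toLin) →
      Function.Injective (F.map i).toLin ∧
        ∀ y, (F.map f).toLin y = 0 → y ∈ LinearMap.range (F.map i).toLin) :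
    PreservesFiniteLimits F := by
  have : ∀ {M N : LeftComodule k B} (f : M ⟶ N), PreservesLimit (parallelPair f 0) F := by
    intro M N f
    have w := equalizerIncl_condition f 0
    refine preservesLimit_of_preserves_limit_cone (isLimitFork (equalizerIncl f 0) w
      Subtype.val_injective (fun m hm => ⟨⟨m, hm⟩, rfl⟩)) ?_
    refine (isLimitMapConeForkEquiv F w).symm ?_
    obtain ⟨h1, h2⟩ := h f (equalizerIncl f 0) (w.trans Limits.comp_zero) Subtype.val_injective
      (fun m hm => ⟨⟨m, hm⟩, rfl⟩)
    refine isLimitFork _ _ h1 (fun m hm => h2 m ?_)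
    rw [hm, F.map_zero]
    rfl
  exact Functor.preservesFiniteLimits_of_preservesKernels F

end Lex

end LeftComodule

end HopfTri

/-! ### Filtered colimits of comodules, and exactness of the cotensor product -/

namespace HopfTri

namespace LeftComodule

open Limits

variable {k B : Type u} [Field k] [Ring B] [Bialgebra k B]

/-- The forgetful functor from comodules to vector spaces. -/
def forgetV (k B : Type u) [Field k] [Ring B] [Bialgebra k B] :
    LeftComodule k B ⥤ ModuleCat.{u} k where
  obj M := ModuleCat.of k M.carrier
  map f := ModuleCat.ofHom f.toLin

/-- The cofree comodule `B ⊗ V`. -/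
noncomputable def cofree (V : Type u) [AddCommGroup V] [Module k V] : LeftComodule k B where
  carrier := B ⊗[k] V
  coact := outerL (Coalgebra.comul (R := k) (A := B)) V
  isLeftCoaction := outerL_isLeftCoaction (regular k B).isLeftCoaction

/-- The cofree comodule functor. -/
noncomputable def cofreeFunctor (k B : Type u) [Field k] [Ring B] [Bialgebra k B] :
    ModuleCat.{u} k ⥤ LeftComodule k B where
  obj V := cofree V
  map f := ⟨f.hom.lTensor B, map_outerL (fun x => by simp) f.hom⟩
  map_id V := hom_ext (LinearMap.lTensor_id B V)
  map_comp f g := hom_ext (LinearMap.lTensor_comp B g.hom f.hom)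

theorem lid_counit_lTensor {V W : Type u} [AddCommGroup V] [Module k V] [AddCommGroup W]
    [Module k W] (f : V →ₗ[k] W) (t : B ⊗[k] V) :
    TensorProduct.lid k W ((Coalgebra.counit (R := k) (A := B)).rTensor W (f.lTensor B t)) =
      f (TensorProduct.lid k V ((Coalgebra.counit (R := k) (A := B)).rTensor V t)) := by
  induction t with
  | zero => simp
  | add x y hx hy => simp only [map_add, hx, hy]
  | tmul b p => simp

theorem cofreeLift_coact {M V : Type u} [AddCommGroup M] [Module k M] [AddCommGroup V] [Module k V]
    {δ : M →ₗ[k] B ⊗[k] M} (hδ : IsLeftCoaction δ) (f : M →ₗ[k] V) (m : M) :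
    outerL (Coalgebra.comul (R := k)) V ((f.lTensor B ∘ₗ δ) m) =
      (f.lTensor B ∘ₗ δ).lTensor B (δ m) := by
  have h1 := map_outerL (B := B) (δ := Coalgebra.comul (R := k)) (δ' := Coalgebra.comul (R := k))
    (f := LinearMap.id) (fun x => by simp) f (δ m)
  refine h1.trans ?_
  rw [LinearMap.lTensor_comp_apply, ← hδ.coassoc m]
  rfl

/-- The morphism into a cofree comodule given by a linear map. -/
noncomputable def cofreeLift {M : LeftComodule k B} {V : Type u} [AddCommGroup V] [Module k V]
    (f : M.carrier →ₗ[k] V) : M ⟶ cofree (B := B) V where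
  toLin := f.lTensor B ∘ₗ M.coact
  comm := cofreeLift_coact M.isLeftCoaction f

theorem cofree_counit {V : Type u} [AddCommGroup V] [Module k V] (t : B ⊗[k] V) :
    ((TensorProduct.lid k V).toLinearMap ∘ₗ
      (Coalgebra.counit (R := k) (A := B)).rTensor V).lTensor B
        (outerL (Coalgebra.comul (R := k)) V t) = t := by
  induction t with
  | zero => simp
  | add x y hx hy => simp only [map_add, hx, hy]
  | tmul b v =>
    have h3 : ∀ s : B ⊗[k] B, (((TensorProduct.lid k V).toLinearMap ∘ₗ
        (Coalgebra.counit (R := k) (A := B)).rTensor V)).lTensor B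
        (TensorProduct.assoc k B B V (s ⊗ₜ v)) = TensorProduct.rid k B
        ((Coalgebra.counit (R := k) (A := B)).lTensor B s) ⊗ₜ v := by
      intro s
      induction s with
      | zero => simp
      | add x y hx hy => simp only [TensorProduct.add_tmul, map_add, hx, hy]
      | tmul b c => simp [TensorProduct.smul_tmul']
    refine (h3 _).trans ?_
    simp

theorem cofreeLift_counit {M : LeftComodule k B} {V : Type u} [AddCommGroup V] [Module k V]
    (g : M.carrier →ₗ[k] B ⊗[k] V)
    (hg : ∀ m, outerL (Coalgebra.comul (R := k)) V (g m) = g.lTensor B (M.coact m)) :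
    (((TensorProduct.lid k V).toLinearMap ∘ₗ
      (Coalgebra.counit (R := k) (A := B)).rTensor V) ∘ₗ g).lTensor B ∘ₗ M.coact = g := by
  ext m
  rw [LinearMap.comp_apply, LinearMap.lTensor_comp_apply, ← hg, cofree_counit]

/-- The cofree comodule is right adjoint to the forgetful functor. -/
noncomputable def cofreeAdj (k B : Type u) [Field k] [Ring B] [Bialgebra k B] :
    forgetV k B ⊣ cofreeFunctor k B :=
  Adjunction.mkOfHomEquiv
    { homEquiv := fun M V =>
        { toFun := fun f => cofreeLift f.hom
          invFun := fun g => ModuleCat.ofHom (((TensorProduct.lid k V).toLinearMap ∘ₗ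
            (Coalgebra.counit (R := k) (A := B)).rTensor V) ∘ₗ g.toLin)
          left_inv := fun f => ModuleCat.hom_ext (LinearMap.ext fun m =>
            (lid_counit_lTensor f.hom (M.coact m)).trans
              (congrArg f.hom (M.isLeftCoaction.counit m)))
          right_inv := fun g => hom_ext (cofreeLift_counit g.toLin g.comm) }
      homEquiv_naturality_left_symm := fun _ _ => rfl
      homEquiv_naturality_right := fun _ _ => hom_ext (LinearMap.ext fun _ =>
        LinearMap.lTensor_comp_apply B _ _ _) }

instance : (forgetV k B).IsLeftAdjoint := (cofreeAdj k B).isLeftAdjoint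

section Filtered

variable {J : Type u} [SmallCategory J] [IsFiltered J] {D : J ⥤ LeftComodule k B} {c : Cocone D}

/-- The elements of `A ⊗ -` of a filtered colimit of comodules come from a finite stage. -/
theorem exists_rep (hc : IsColimit c) (A : Type u) [AddCommGroup A] [Module k A]
    (t : A ⊗[k] c.pt.carrier) :
    ∃ (j : J) (s : A ⊗[k] (D.obj j).carrier), (c.ι.app j).toLin.lTensor A s = t :=
  Concrete.isColimit_exists_rep ((D ⋙ forgetV k B) ⋙ MonoidalCategory.tensorLeft
    (ModuleCat.of k A)) (isColimitOfPreserves (MonoidalCategory.tensorLeft (ModuleCat.of k A))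
      (isColimitOfPreserves (forgetV k B) hc)) (show (MonoidalCategory.tensorObj
        (ModuleCat.of k A) ((forgetV k B).obj c.pt) : ModuleCat k) from t)

/-- The elements of a filtered colimit of comodules come from a finite stage. -/
theorem exists_rep_apply (hc : IsColimit c) (t : c.pt.carrier) :
    ∃ (j : J) (s : (D.obj j).carrier), (c.ι.app j).toLin s = t :=
  Concrete.isColimit_exists_rep (D ⋙ forgetV k B) (isColimitOfPreserves (forgetV k B) hc)
    (show ((forgetV k B).obj c.pt : ModuleCat k) from t)

/-- An element of `A ⊗ -` vanishing in a filtered colimit of comodules vanishes at some stage. -/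
theorem exists_eq_zero (hc : IsColimit c) (A : Type u) [AddCommGroup A] [Module k A] {j : J}
    (s : A ⊗[k] (D.obj j).carrier) (hs : (c.ι.app j).toLin.lTensor A s = 0) :
    ∃ (j' : J) (f : j ⟶ j'), (D.map f).toLin.lTensor A s = 0 := by
  obtain ⟨j', f, g, h⟩ := Concrete.isColimit_exists_of_rep_eq _ (isColimitOfPreserves
    (MonoidalCategory.tensorLeft (ModuleCat.of k A)) (isColimitOfPreserves (forgetV k B) hc))
    (i := j) (j := j) s (0 : A ⊗[k] (D.obj j).carrier) (hs.trans (map_zero _).symm)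
  exact ⟨j', f, h.trans (map_zero _)⟩

/-- A cocone of comodules which is a filtered colimit elementwise is a colimit. -/
theorem isColimit_of_elements (h1 : ∀ x : c.pt.carrier, ∃ (j : J) (y : (D.obj j).carrier),
    (c.ι.app j).toLin y = x) (h2 : ∀ (j : J) (y : (D.obj j).carrier), (c.ι.app j).toLin y = 0 →
      ∃ (j' : J) (f : j ⟶ j'), (D.map f).toLin y = 0) : Nonempty (IsColimit c) := by
  have hU : IsColimit ((forgetV k B).mapCocone c) := by
    refine isColimitOfReflects (forget (ModuleCat k)) (Types.FilteredColimit.isColimitOf _ _ ?_ ?_)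
    · intro x
      obtain ⟨j, y, h⟩ := h1 x
      exact ⟨j, y, h.symm⟩
    · intro i j (x : (D.obj i).carrier) (y : (D.obj j).carrier) h
      have w : ∀ {i j : J} (f : i ⟶ j) (x : (D.obj i).carrier),
          (c.ι.app j).toLin ((D.map f).toLin x) = (c.ι.app i).toLin x :=
        fun f x => congr_hom (c.w f) x
      have w' : ∀ {i j l : J} (f : i ⟶ j) (g : j ⟶ l) (x : (D.obj i).carrier),
          (D.map g).toLin ((D.map f).toLin x) = (D.map (f ≫ g)).toLin x :=
        fun f g x => congr_hom (D.map_comp f g).symm x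
      change (c.ι.app i).toLin x = (c.ι.app j).toLin y at h
      let l := IsFiltered.max i j
      let f : i ⟶ l := IsFiltered.leftToMax i j
      let g : j ⟶ l := IsFiltered.rightToMax i j
      obtain ⟨m, e, he⟩ := h2 l ((D.map f).toLin x - (D.map g).toLin y) (by
        rw [map_sub, w, w, h, sub_self])
      rw [map_sub, sub_eq_zero, w', w'] at he
      exact ⟨m, f ≫ e, g ≫ e, he⟩
  have fac : ∀ (s : Cocone D) (j : J) (y : (D.obj j).carrier),
      (hU.desc ((forgetV k B).mapCocone s)).hom ((c.ι.app j).toLin y) = (s.ι.app j).toLin y :=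
    fun s j y => LinearMap.congr_fun
      (congrArg ModuleCat.Hom.hom (hU.fac ((forgetV k B).mapCocone s) j)) y
  refine ⟨{ desc := fun s => ⟨(hU.desc ((forgetV k B).mapCocone s)).hom, fun x => ?_⟩,
            fac := fun s j => hom_ext (LinearMap.ext (fac s j)), uniq := fun s m hm => ?_ }⟩
  · obtain ⟨j, y, rfl⟩ := h1 x
    let d : c.pt.carrier →ₗ[k] s.pt.carrier := (hU.desc ((forgetV k B).mapCocone s)).hom
    let i : D.obj j ⟶ c.pt := c.ι.app j
    let i' : D.obj j ⟶ s.pt := s.ι.app j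
    have h3 : d ∘ₗ i.toLin = i'.toLin := LinearMap.ext (fac s j)
    change s.pt.coact (d (i.toLin y)) = d.lTensor B (c.pt.coact (i.toLin y))
    rw [i.comm, ← LinearMap.lTensor_comp_apply, h3, ← i'.comm, ← h3, LinearMap.comp_apply]
  · refine hom_ext (LinearMap.ext fun x => ?_)
    obtain ⟨j, y, rfl⟩ := h1 x
    exact (congr_hom (hm j) y).trans (fac s j y).symm

end Filtered

end LeftComodule

namespace HopfTrimodule

open Limits LeftComodule

variable {k B : Type u} [Field k] [Ring B] [Bialgebra k B]

theorem inclC_cotensCMap {X X' : HopfTrimodule k B} {N N' : LeftComodule k B} (f : X ⟶ X')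
    (g : N ⟶ N') (t : (cotensC X N).carrier) : (inclC X' N').toLin ((cotensCMap f g).toLin t) =
      TensorProduct.map f.toLin g.toLin ((inclC X N).toLin t) :=
  congr_hom (cotensCMap_inclC f g) t

theorem inclC_eq (X : HopfTrimodule k B) (N : LeftComodule k B) (t : (cotensC X N).carrier) :
    (inclC X N).toLin t = t.1 := rfl

instance (X : HopfTrimodule k B) : (laxFunctor X).functor.Additive where
  map_add {M N f g} := LeftComodule.cancel (inclC_injective X N)
   (LeftComodule.hom_ext (LinearMap.ext fun (t : (cotensC X M).carrier) => by
    change (inclC X N).toLin ((cotensCMap (𝟙 X) (f + g)).toLin t) = (inclC X N).toLin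
      ((cotensCMap (𝟙 X) f).toLin t + (cotensCMap (𝟙 X) g).toLin t)
    rw [map_add, inclC_cotensCMap, inclC_cotensCMap, inclC_cotensCMap, add_toLin,
      TensorProduct.map_add_right]
    rfl))

theorem cotensC_preservesFiniteLimits (X : HopfTrimodule k B) :
    PreservesFiniteLimits (laxFunctor X).functor := by
  refine preservesFiniteLimits_of_exact _ fun {K M N} f i w hi h => ?_
  change Function.Injective (cotensCMap (𝟙 X) i).toLin ∧ ∀ y, (cotensCMap (𝟙 X) f).toLin y = 0 →
    y ∈ LinearMap.range (cotensCMap (𝟙 X) i).toLin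
  constructor
  · intro s t hst
    have := congrArg (inclC X M).toLin hst
    rw [inclC_cotensCMap, inclC_cotensCMap] at this
    exact inclC_injective X K (lTensor_inj X.carrier hi this)
  · intro y hy
    have h1 := congrArg (inclC X N).toLin hy
    rw [inclC_cotensCMap, map_zero] at h1
    have hex : Function.Exact i.toLin f.toLin := fun m =>
      ⟨h m, fun ⟨x, hx⟩ => hx ▸ congr_hom w x⟩
    obtain ⟨s, hs⟩ := (Module.Flat.lTensor_exact X.carrier hex _).1 h1
    have hs' : s ∈ cotensor X.rcoact K.coact :=
      (map_mem_cotensor_iff (f := LinearMap.id) (ρ' := X.rcoact) (δ' := M.coact)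
        (𝟙 X : X ⟶ X).rcomm i.comm (fun _ _ h => h) hi).1
        (hs.symm ▸ y.2 : i.toLin.lTensor X.carrier s ∈ cotensor X.rcoact M.coact)
    exact ⟨⟨s, hs'⟩, inclC_injective X M ((inclC_cotensCMap (𝟙 X) i ⟨s, hs'⟩).trans hs)⟩

theorem cotensC_preservesFilteredColimits (X : HopfTrimodule k B) :
    PreservesFilteredColimits (laxFunctor X).functor where
  preserves_filtered_colimits J _ _ := ⟨fun {D} => ⟨fun {c} hc => by
    have hcomm : ∀ {M N : LeftComodule k B} (f : M ⟶ N) (t : X.carrier ⊗[k] M.carrier),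
        TensorProduct.assoc k X.carrier B N.carrier
          (X.rcoact.rTensor N.carrier (f.toLin.lTensor X.carrier t)) -
          N.coact.lTensor X.carrier (f.toLin.lTensor X.carrier t) =
        (f.toLin.lTensor B).lTensor X.carrier (TensorProduct.assoc k X.carrier B M.carrier
          (X.rcoact.rTensor M.carrier t) - M.coact.lTensor X.carrier t) := by
      intro M N f t
      rw [map_sub]
      exact congrArg₂ (· - ·) (cotensor_map_eq (f := LinearMap.id) (𝟙 X : X ⟶ X).rcomm f.toLin t)
        (cotensor_map_eq' LinearMap.id f.comm t)
    have hassoc : ∀ {M N : LeftComodule k B} (f : M ⟶ N)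
        (t : X.carrier ⊗[k] (B ⊗[k] M.carrier)),
        f.toLin.lTensor (X.carrier ⊗[k] B) ((TensorProduct.assoc k X.carrier B M.carrier).symm t) =
        (TensorProduct.assoc k X.carrier B N.carrier).symm
          ((f.toLin.lTensor B).lTensor X.carrier t) := by
      intro M N f t
      obtain ⟨t, rfl⟩ := (TensorProduct.assoc k X.carrier B M.carrier).surjective t
      rw [LinearEquiv.symm_apply_apply, LinearEquiv.eq_symm_apply]
      induction t with
      | zero => simp
      | add x y hx hy => simp only [map_add, hx, hy]
      | tmul xb m =>
        induction xb with
        | zero => simp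
        | add x y hx hy => simp only [TensorProduct.add_tmul, map_add, hx, hy]
        | tmul x b => simp
    refine isColimit_of_elements ?_ ?_
    · intro (x : (cotensC X c.pt).carrier)
      change ∃ (j : J) (y : (cotensC X (D.obj j)).carrier),
        (cotensCMap (𝟙 X) (c.ι.app j)).toLin y = x
      obtain ⟨j, s, hs⟩ := exists_rep hc X.carrier ((inclC X c.pt).toLin x)
      -- the defect of the equaliser condition on `s` vanishes in the colimit, so at a later stage
      obtain ⟨j', f, hf⟩ := exists_eq_zero hc (X.carrier ⊗[k] B) (j := j)
        ((TensorProduct.assoc k X.carrier B _).symm (TensorProduct.assoc k X.carrier B _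
          (X.rcoact.rTensor _ s) - (D.obj j).coact.lTensor X.carrier s)) (by
          let i : D.obj j ⟶ c.pt := c.ι.app j
          refine (hassoc i _).trans ?_
          rw [← hcomm i, show i.toLin.lTensor X.carrier s = _ from hs, inclC_eq,
            sub_eq_zero.2 (mem_cotensor.1 x.2), map_zero])
      rw [hassoc, LinearEquiv.map_eq_zero_iff, ← hcomm, sub_eq_zero] at hf
      refine ⟨j', ⟨_, hf⟩, inclC_injective X c.pt ((inclC_cotensCMap (𝟙 X) (c.ι.app j') _).trans ?_)⟩
      change (c.ι.app j').toLin.lTensor X.carrier ((D.map f).toLin.lTensor X.carrier s) = _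
      rw [← LinearMap.lTensor_comp_apply]
      exact (congrArg (fun g : D.obj j ⟶ c.pt => g.toLin.lTensor X.carrier s) (c.w f)).trans hs
    · intro j (y : (cotensC X (D.obj j)).carrier) hy
      change (cotensCMap (𝟙 X) (c.ι.app j)).toLin y = 0 at hy
      change ∃ (j' : J) (f : j ⟶ j'), (cotensCMap (𝟙 X) (D.map f)).toLin y = 0
      have h1 := ((inclC_cotensCMap (𝟙 X) (c.ι.app j) y).symm.trans
        (congrArg (inclC X c.pt).toLin hy)).trans (map_zero _)
      obtain ⟨j', f, hf⟩ := exists_eq_zero hc X.carrier (j := j) ((inclC X _).toLin y) h1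
      refine ⟨j', f, inclC_injective X _ ?_⟩
      rw [inclC_cotensCMap, map_zero]
      exact hf⟩⟩

/-- The functor `X □ -` is left exact and finitary. -/
theorem sigma_isLexFinitary (X : HopfTrimodule k B) :
    LaxModEnd.IsLexFinitary ((sigma k B).obj X) :=
  ⟨cotensC_preservesFiniteLimits X, cotensC_preservesFilteredColimits X⟩

end HopfTrimodule

end HopfTri

/-! ### The monoidal structure of the functor `X ↦ X □ -` -/

namespace HopfTri

section LinearAlgebra

variable {k B : Type u} [Field k] [Ring B] [Bialgebra k B]
variable {X Y Z W : Type u} [AddCommGroup X] [Module k X] [AddCommGroup Y] [Module k Y]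
  [AddCommGroup Z] [Module k Z] [AddCommGroup W] [Module k W]

/-- The interchange map for the diagonal action on `X ⊗ Y` is the iterate of the interchange maps
for `X` and for `Y`. -/
theorem interchange_diagAct {δ : Z →ₗ[k] B ⊗[k] Z} (hδ : IsLeftCoaction δ)
    (a : B →ₐ[k] Module.End k X) (b : B →ₐ[k] Module.End k Y)
    (t : Z ⊗[k] ((X ⊗[k] Y) ⊗[k] W)) :
    TensorProduct.assoc k X Y (Z ⊗[k] W) (interchange δ (diagAct a b) W t) =
      (interchange δ b W).lTensor X (interchange δ a (Y ⊗[k] W)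
        ((TensorProduct.assoc k X Y W).toLinearMap.lTensor Z t)) := by
  induction t with
  | zero => simp
  | add x y hx hy => simp only [map_add, hx, hy]
  | tmul z s =>
  induction s with
  | zero => simp
  | add x y hx hy => simp only [TensorProduct.tmul_add, map_add, hx, hy]
  | tmul xy w =>
  induction xy with
  | zero => simp
  | add x y hx hy =>
    simp only [TensorProduct.tmul_add, TensorProduct.add_tmul, map_add, hx, hy]
  | tmul x y =>
    -- both sides are this map applied to the iterated coaction of `z`
    let E : B ⊗[k] (B ⊗[k] Z) →ₗ[k] X ⊗[k] (Y ⊗[k] (Z ⊗[k] W)) :=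
      TensorProduct.map (LinearMap.flip a.toLinearMap x)
        (TensorProduct.map (LinearMap.flip b.toLinearMap y) ((TensorProduct.mk k Z W).flip w))
    have h1 : ∀ s : B ⊗[k] Z, TensorProduct.assoc k X Y (Z ⊗[k] W) (TensorProduct.map
        (LinearMap.flip (diagAct a b).toLinearMap (x ⊗ₜ y)) ((TensorProduct.mk k Z W).flip w) s) =
        E (TensorProduct.assoc k B B Z ((Coalgebra.comul (R := k) (A := B)).rTensor Z s)) := by
      intro s
      induction s with
      | zero => simp
      | add x y hx hy => simp only [map_add, hx, hy]
      | tmul c z =>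
        simp only [TensorProduct.map_tmul, LinearMap.flip_apply, AlgHom.toLinearMap_apply,
          diagAct_apply, LinearMap.rTensor_tmul]
        generalize (Coalgebra.comul (R := k) c) = d
        induction d with
        | zero => simp
        | add x y hx hy => simp only [TensorProduct.add_tmul, map_add, LinearMap.add_apply, hx, hy]
        | tmul c d => simp [E]
    have h2 : ∀ s : B ⊗[k] Z, (interchange δ b W).lTensor X (TensorProduct.map
        (LinearMap.flip a.toLinearMap x) ((TensorProduct.mk k Z (Y ⊗[k] W)).flip (y ⊗ₜ w)) s) =
        E (δ.lTensor B s) := by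
      intro s
      induction s with
      | zero => simp
      | add x y hx hy => simp only [map_add, hx, hy]
      | tmul c z => simp [E, interchange_tmul]
    rw [interchange_tmul, h1, hδ.coassoc, LinearMap.lTensor_tmul, LinearEquiv.coe_coe,
      TensorProduct.assoc_tmul, interchange_tmul, h2]

/-- The interchange map for the regular action turns `m ⊗ n₋₁ ⊗ n₀` into the codiagonal
coaction. -/
theorem interchange_regAct (δ : Z →ₗ[k] B ⊗[k] Z) (γ : Y →ₗ[k] B ⊗[k] Y) (t : Z ⊗[k] Y) :
    interchange δ regAct Y (γ.lTensor Z t) = tensorCoact δ γ t := by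
  induction t with
  | zero => simp
  | add x y hx hy => simp only [map_add, hx, hy]
  | tmul z y =>
    simp only [LinearMap.lTensor_tmul, tensorCoact, TensorProduct.map_tmul, LinearMap.comp_apply,
      LinearEquiv.coe_coe]
    generalize γ y = s
    induction s with
    | zero => simp
    | add x y hx hy => simp only [TensorProduct.tmul_add, map_add, hx, hy]
    | tmul b y =>
      rw [interchange_tmul]
      generalize δ z = r
      induction r with
      | zero => simp
      | add x y hx hy => simp only [TensorProduct.add_tmul, map_add, hx, hy]
      | tmul c z => simp [regAct]

end LinearAlgebra

namespace HopfTrimodule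

open MonoidalCategory LeftComodule

variable {k B : Type u} [Field k] [Ring B] [Bialgebra k B]

theorem outerCMap_injective {X X' : HopfTrimodule k B} {N N' : LeftComodule k B} {f : X ⟶ X'}
    {g : N ⟶ N'} (hf : Function.Injective f.toLin) (hg : Function.Injective g.toLin) :
    Function.Injective (outerCMap f g).toLin := map_injective hf hg

/-- Associativity of `outerC`. -/
noncomputable def outerCAssoc (X Y : HopfTrimodule k B) (N : LeftComodule k B) :
    outerC (outer X Y) N ⟶ outerC X (outerC Y N) where
  toLin := (TensorProduct.assoc k X.carrier Y.carrier N.carrier).toLinearMap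
  comm := assoc_outerL X.lcoact

theorem outerCAssoc_naturality {X X' Y Y' : HopfTrimodule k B} {N N' : LeftComodule k B}
    (f : X ⟶ X') (g : Y ⟶ Y') (h : N ⟶ N') :
    outerCMap (outerMap f g) h ≫ outerCAssoc X' Y' N' =
      outerCAssoc X Y N ≫ outerCMap f (outerCMap g h) :=
  LeftComodule.hom_ext (TensorProduct.ext_threefold fun _ _ _ => rfl)

theorem outerCAssoc_pentagon (W X Y : HopfTrimodule k B) (N : LeftComodule k B) :
    outerCMap (outerAssoc W X Y) (𝟙 N) ≫ outerCAssoc W (outer X Y) N ≫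
      outerCMap (𝟙 W) (outerCAssoc X Y N) =
    outerCAssoc (outer W X) Y N ≫ outerCAssoc W X (outerC Y N) :=
  LeftComodule.hom_ext (TensorProduct.ext_fourfold fun _ _ _ _ => rfl)

/-- The inclusion `X □ (Y □ N) → X ⊗ (Y ⊗ N)`. -/
noncomputable def inclCL (X Y : HopfTrimodule k B) (N : LeftComodule k B) :
    cotensC X (cotensC Y N) ⟶ outerC X (outerC Y N) :=
  inclC X (cotensC Y N) ≫ outerCMap (𝟙 X) (inclC Y N)

/-- The inclusion `(X □ Y) □ N → (X ⊗ Y) ⊗ N`. -/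
noncomputable def inclCR (X Y : HopfTrimodule k B) (N : LeftComodule k B) :
    cotensC (cotens X Y) N ⟶ outerC (outer X Y) N :=
  inclC (cotens X Y) N ≫ outerCMap (incl X Y) (𝟙 N)

theorem inclCL_injective (X Y : HopfTrimodule k B) (N : LeftComodule k B) :
    Function.Injective (inclCL X Y N).toLin :=
  (outerCMap_injective (f := 𝟙 X) (fun _ _ h => h) (inclC_injective Y N)).comp
    (inclC_injective _ _)

theorem inclCR_injective (X Y : HopfTrimodule k B) (N : LeftComodule k B) :
    Function.Injective (inclCR X Y N).toLin :=
  (outerCMap_injective (g := 𝟙 N) (incl_injective X Y) (fun _ _ h => h)).comp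
    (inclC_injective _ _)

theorem mem_range_inclCL {X Y : HopfTrimodule k B} {N : LeftComodule k B}
    {t : X.carrier ⊗[k] (Y.carrier ⊗[k] N.carrier)} :
    t ∈ LinearMap.range (inclCL X Y N).toLin ↔
      t ∈ cotensor X.rcoact (outerL Y.lcoact N.carrier) ∧
      t ∈ LinearMap.range ((cotensor Y.rcoact N.coact).subtype.lTensor X.carrier) := by
  have key : ∀ s : X.carrier ⊗[k] (cotensC Y N).carrier,
      TensorProduct.map LinearMap.id (inclC Y N).toLin s ∈
        cotensor X.rcoact (outerL Y.lcoact N.carrier) ↔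
      s ∈ cotensor X.rcoact (cotensC Y N).coact := fun s =>
    map_mem_cotensor_iff (f := LinearMap.id) (g := (inclC Y N).toLin) (𝟙 X : X ⟶ X).rcomm
      (inclC Y N).comm (fun _ _ h => h) (inclC_injective Y N)
  constructor
  · rintro ⟨s, rfl⟩
    exact ⟨(key _).2 s.2, ⟨s.1, rfl⟩⟩
  · rintro ⟨h1, ⟨s, rfl⟩⟩
    exact ⟨⟨s, (key s).1 h1⟩, rfl⟩

theorem mem_range_inclCR {X Y : HopfTrimodule k B} {N : LeftComodule k B}
    {t : (X.carrier ⊗[k] Y.carrier) ⊗[k] N.carrier} :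
    t ∈ LinearMap.range (inclCR X Y N).toLin ↔
      t ∈ cotensor (outerR X.carrier Y.rcoact) N.coact ∧
      t ∈ LinearMap.range ((cotensor X.rcoact Y.lcoact).subtype.rTensor N.carrier) := by
  have key : ∀ s : (cotens X Y).carrier ⊗[k] N.carrier,
      TensorProduct.map (incl X Y).toLin LinearMap.id s ∈
        cotensor (outerR X.carrier Y.rcoact) N.coact ↔
      s ∈ cotensor (cotens X Y).rcoact N.coact := fun s =>
    map_mem_cotensor_iff (f := (incl X Y).toLin) (g := LinearMap.id) (incl X Y).rcomm
      (𝟙 N : N ⟶ N).comm (incl_injective X Y) (fun _ _ h => h)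
  constructor
  · rintro ⟨s, rfl⟩
    exact ⟨(key _).2 s.2, ⟨s.1, rfl⟩⟩
  · rintro ⟨h1, ⟨s, rfl⟩⟩
    exact ⟨⟨s, (key s).1 h1⟩, rfl⟩

theorem rangeC_assoc {X Y : HopfTrimodule k B} {N : LeftComodule k B}
    {t : (X.carrier ⊗[k] Y.carrier) ⊗[k] N.carrier} :
    TensorProduct.assoc k X.carrier Y.carrier N.carrier t ∈
      LinearMap.range (inclCL X Y N).toLin ↔ t ∈ LinearMap.range (inclCR X Y N).toLin := by
  rw [mem_range_inclCL, mem_range_inclCR, triple_left_iff, triple_right_iff, and_comm]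

/-- The associativity morphism `(X □ Y) □ N → X □ (Y □ N)`. -/
noncomputable def assocC (X Y : HopfTrimodule k B) (N : LeftComodule k B) :
    cotensC (cotens X Y) N ⟶ cotensC X (cotensC Y N) :=
  LeftComodule.lift (inclCL X Y N) (inclCL_injective X Y N) (inclCR X Y N ≫ outerCAssoc X Y N)
    (fun p => rangeC_assoc.2 ⟨p, rfl⟩)

theorem assocC_inclCL (X Y : HopfTrimodule k B) (N : LeftComodule k B) :
    assocC X Y N ≫ inclCL X Y N = inclCR X Y N ≫ outerCAssoc X Y N :=
  LeftComodule.lift_comp _ _ _ _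

theorem assocC_bijective (X Y : HopfTrimodule k B) (N : LeftComodule k B) :
    Function.Bijective (assocC X Y N).toLin := by
  have h := fun p => congr_hom (assocC_inclCL X Y N) p
  constructor
  · intro p q hpq
    have := (h p).symm.trans ((congrArg (inclCL X Y N).toLin hpq).trans (h q))
    exact inclCR_injective X Y N ((TensorProduct.assoc k X.carrier Y.carrier N.carrier).injective
      this)
  · intro q
    obtain ⟨t, ht⟩ := (TensorProduct.assoc k X.carrier Y.carrier N.carrier).surjective
      ((inclCL X Y N).toLin q)
    obtain ⟨p, rfl⟩ := rangeC_assoc.1 ⟨q, ht.symm⟩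
    exact ⟨p, inclCL_injective X Y N ((h p).trans ht)⟩

/-- A bijective morphism of comodules as an isomorphism. -/
noncomputable def _root_.HopfTri.LeftComodule.isoOfBijective {M N : LeftComodule k B} (f : M ⟶ N)
    (h : Function.Bijective f.toLin) : M ≅ N where
  hom := f
  inv := (LeftComodule.isoMk (LinearEquiv.ofBijective f.toLin h) f.comm).inv
  hom_inv_id := (LeftComodule.isoMk (LinearEquiv.ofBijective f.toLin h) f.comm).hom_inv_id
  inv_hom_id := (LeftComodule.isoMk (LinearEquiv.ofBijective f.toLin h) f.comm).inv_hom_id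

theorem cotensCMap_inclCL {X X' Y Y' : HopfTrimodule k B} {N N' : LeftComodule k B} (f : X ⟶ X')
    (g : cotensC Y N ⟶ cotensC Y' N') (h : outerC Y N ⟶ outerC Y' N')
    (hg : g ≫ inclC Y' N' = inclC Y N ≫ h) :
    cotensCMap f g ≫ inclCL X' Y' N' = inclCL X Y N ≫ outerCMap f h := by
  rw [inclCL, inclCL, reassoc_of% cotensCMap_inclC, Category.assoc, outerCMap_comp,
    outerCMap_comp, hg, Category.id_comp, Category.comp_id]

theorem cotensCMap_inclCR {X X' Y Y' : HopfTrimodule k B} {N N' : LeftComodule k B}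
    (g : cotens X Y ⟶ cotens X' Y') (f : N ⟶ N') (h : outer X Y ⟶ outer X' Y')
    (hg : g ≫ incl X' Y' = incl X Y ≫ h) :
    cotensCMap g f ≫ inclCR X' Y' N' = inclCR X Y N ≫ outerCMap h f := by
  rw [inclCR, inclCR, reassoc_of% cotensCMap_inclC, Category.assoc, outerCMap_comp,
    outerCMap_comp, hg, Category.id_comp, Category.comp_id]

theorem assocC_naturality {X X' Y Y' : HopfTrimodule k B} {N N' : LeftComodule k B} (f : X ⟶ X')
    (g : Y ⟶ Y') (h : N ⟶ N') : cotensCMap (cotensMap f g) h ≫ assocC X' Y' N' =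
      assocC X Y N ≫ cotensCMap f (cotensCMap g h) :=
  LeftComodule.cancel (inclCL_injective _ _ _) (by
    rw [Category.assoc, assocC_inclCL, Category.assoc,
      cotensCMap_inclCL f _ _ (cotensCMap_inclC g h), ← Category.assoc,
      cotensCMap_inclCR _ h _ (cotensMap_incl f g), Category.assoc, outerCAssoc_naturality,
      ← Category.assoc, ← Category.assoc, assocC_inclCL])

theorem assocC_inclC (X Y : HopfTrimodule k B) (N : LeftComodule k B) :
    assocC X Y N ≫ inclC X (cotensC Y N) ≫ outerCMap (𝟙 X) (inclC Y N) =
      inclC (cotens X Y) N ≫ outerCMap (incl X Y) (𝟙 N) ≫ outerCAssoc X Y N := by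
  simpa [inclCL, inclCR] using assocC_inclCL X Y N

theorem assocC_pentagon (W X Y : HopfTrimodule k B) (N : LeftComodule k B) :
    cotensCMap (assocHom W X Y) (𝟙 N) ≫ assocC W (cotens X Y) N ≫
      cotensCMap (𝟙 W) (assocC X Y N) =
    assocC (cotens W X) Y N ≫ assocC W X (cotensC Y N) := by
  have hinj : Function.Injective
      (inclC W (cotensC X (cotensC Y N)) ≫ outerCMap (𝟙 W) (inclCL X Y N)).toLin :=
    (outerCMap_injective (f := 𝟙 W) (fun _ _ h => h) (inclCL_injective X Y N)).comp
      (inclC_injective _ _)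
  apply LeftComodule.cancel hinj
  have e1 : cotensCMap (𝟙 W) (assocC X Y N) ≫ inclC W (cotensC X (cotensC Y N)) ≫
      outerCMap (𝟙 W) (inclCL X Y N) = inclC W (cotensC (cotens X Y) N) ≫
        outerCMap (𝟙 W) (inclC (cotens X Y) N) ≫
        outerCMap (𝟙 W) (outerCMap (incl X Y) (𝟙 N)) ≫
        outerCMap (𝟙 W) (outerCAssoc X Y N) := by
    rw [reassoc_of% cotensCMap_inclC, outerCMap_comp, assocC_inclCL, inclCR]
    simp only [outerCMap_comp, Category.assoc, Category.comp_id]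
  have e2 : outerCMap (𝟙 W) (inclCL X Y N) =
      outerCMap (𝟙 W) (inclC X (cotensC Y N)) ≫
        outerCMap (𝟙 W) (outerCMap (𝟙 X) (inclC Y N)) := by
    rw [inclCL, outerCMap_comp, Category.comp_id]
  have a1 := assocC_inclC W (cotens X Y) N
  have a2 := assocC_inclC W X (cotensC Y N)
  have a3 := assocC_inclC (cotens W X) Y N
  have a4 := assocHom_incl W X Y
  simp only [Category.assoc]
  rw [e1, reassoc_of% a1, ← reassoc_of% (outerCAssoc_naturality (𝟙 W) (incl X Y) (𝟙 N)),
    reassoc_of% cotensCMap_inclC, e2, reassoc_of% a2, ← outerCAssoc_naturality, outerMap_id]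
  rw [reassoc_of% (outerCMap_comp (incl W X) (𝟙 _) (𝟙 (cotensC Y N)) (inclC Y N))]
  have e3 : outerCMap (incl W X) (inclC Y N) =
      outerCMap (𝟙 (cotens W X)) (inclC Y N) ≫ outerCMap (incl W X) (𝟙 (outerC Y N)) := by
    rw [outerCMap_comp]; simp
  rw [e3, Category.assoc, reassoc_of% a3]
  rw [← outerCMap_id Y N, ← reassoc_of% (outerCAssoc_naturality (incl W X) (𝟙 Y) (𝟙 N))]
  rw [← outerCAssoc_pentagon]
  simp only [reassoc_of% outerCMap_comp, Category.comp_id, a4]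

theorem outerChi_assocC (X Y : HopfTrimodule k B) (M N : LeftComodule k B) :
    outerChi (outer X Y) M N ≫ outerCAssoc X Y (M ⊗ N) =
      M ◁ outerCAssoc X Y N ≫ outerChi X M (outerC Y N) ≫
        outerCMap (𝟙 X) (outerChi Y M N) :=
  LeftComodule.hom_ext (LinearMap.ext (interchange_diagAct M.isLeftCoaction X.act Y.act))

theorem chi_assocC (X Y : HopfTrimodule k B) (M N : LeftComodule k B) :
    chi (cotens X Y) M N ≫ assocC X Y (M ⊗ N) =
      M ◁ assocC X Y N ≫ chi X M (cotensC Y N) ≫ cotensCMap (𝟙 X) (chi Y M N) :=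
  LeftComodule.cancel (inclCL_injective _ _ _) (by
    have e1 := outerChi_naturality (incl X Y) (𝟙 M) (𝟙 N)
    have e2 := outerChi_naturality (𝟙 X) (𝟙 M) (inclC Y N)
    simp only [id_tensorHom, MonoidalCategory.whiskerLeft_id] at e1 e2
    have e3 : cotensCMap (𝟙 X) (chi Y M N) ≫ inclCL X Y (M ⊗ N) =
        inclC X (M ⊗ cotensC Y N) ≫ outerCMap (𝟙 X) (M ◁ inclC Y N) ≫
          outerCMap (𝟙 X) (outerChi Y M N) := by
      rw [inclCL, reassoc_of% cotensCMap_inclC, outerCMap_comp, outerCMap_comp, chi_inclC]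
    rw [Category.assoc, assocC_inclCL, inclCR, Category.assoc, reassoc_of% chi_inclC,
      ← reassoc_of% e1, outerChi_assocC, Category.assoc, Category.assoc, e3,
      reassoc_of% chi_inclC, ← reassoc_of% e2]
    simp only [← MonoidalCategory.whiskerLeft_comp_assoc, assocC_inclC])

/-- The left coaction as a morphism `N → B ⊗ N`. -/
noncomputable def coactOuter (N : LeftComodule k B) : N ⟶ outerC (unit k B) N where
  toLin := N.coact
  comm := N.isLeftCoaction.coassoc

/-- The left coaction as a morphism `N → B □ N`. -/
noncomputable def coactC (N : LeftComodule k B) : N ⟶ cotensC (unit k B) N :=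
  LeftComodule.lift (inclC (unit k B) N) (inclC_injective _ _) (coactOuter N)
    (fun y => mem_range_inclC.2 (coact_mem_cotensor N.isLeftCoaction y))

theorem coactC_inclC (N : LeftComodule k B) : coactC N ≫ inclC (unit k B) N = coactOuter N :=
  LeftComodule.lift_comp _ _ _ _

theorem coactC_bijective (N : LeftComodule k B) : Function.Bijective (coactC N).toLin := by
  have h := fun p => congr_hom (coactC_inclC N) p
  constructor
  · intro p q hpq
    have : N.coact p = N.coact q :=
      (h p).symm.trans ((congrArg (inclC (unit k B) N).toLin hpq).trans (h q))
    rw [← N.isLeftCoaction.counit p, this, N.isLeftCoaction.counit]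
  · intro q
    exact ⟨_, inclC_injective _ _ ((h _).trans (coact_counit (k := k) (B := B) (δ := N.coact) q.2))⟩

theorem coactC_naturality {N N' : LeftComodule k B} (f : N ⟶ N') :
    f ≫ coactC N' = coactC N ≫ cotensCMap (𝟙 (unit k B)) f :=
  LeftComodule.cancel (inclC_injective _ _) (by
    rw [Category.assoc, coactC_inclC, Category.assoc, cotensCMap_inclC, ← Category.assoc,
      coactC_inclC]
    exact LeftComodule.hom_ext (LinearMap.ext f.comm))

theorem coactC_chi (M N : LeftComodule k B) :
    coactC (M ⊗ N) = M ◁ coactC N ≫ chi (unit k B) M N :=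
  LeftComodule.cancel (inclC_injective _ _) (by
    rw [coactC_inclC, Category.assoc, chi_inclC, ← MonoidalCategory.whiskerLeft_comp_assoc,
      coactC_inclC]
    exact LeftComodule.hom_ext (LinearMap.ext fun t => (interchange_regAct M.coact N.coact t).symm))

theorem coactC_cotensC (X : HopfTrimodule k B) (N : LeftComodule k B) :
    cotensCMap (lunitInv X) (𝟙 N) ≫ assocC (unit k B) X N = coactC (cotensC X N) :=
  LeftComodule.cancel (inclCL_injective _ _ _) (by
    rw [Category.assoc, assocC_inclCL, inclCR, Category.assoc, reassoc_of% cotensCMap_inclC,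
      reassoc_of% outerCMap_comp, lunitInv_incl, inclCL, ← Category.assoc (coactC _),
      coactC_inclC]
    exact LeftComodule.hom_ext (LinearMap.ext fun p => (inclC X N).comm p))

theorem unit_triangleC (X : HopfTrimodule k B) (N : LeftComodule k B) :
    cotensCMap (runitInv X) (𝟙 N) ≫ assocC X (unit k B) N = cotensCMap (𝟙 X) (coactC N) :=
  LeftComodule.cancel (inclCL_injective _ _ _) (by
    rw [Category.assoc, assocC_inclCL, inclCR, Category.assoc, reassoc_of% cotensCMap_inclC,
      reassoc_of% outerCMap_comp, runitInv_incl, inclCL, reassoc_of% cotensCMap_inclC,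
      outerCMap_comp, coactC_inclC]
    exact LeftComodule.hom_ext (LinearMap.ext fun p =>
      (mem_cotensor (k := k) (B := B) (ρ := X.rcoact) (δ := N.coact)).1 p.2))

/-- The isomorphism of the identity with `B □ -`. -/
noncomputable def sigmaUnit (k B : Type u) [Field k] [Ring B] [Bialgebra k B] :
    LaxModEnd.unit (LeftComodule k B) ≅ laxFunctor (unit k B) :=
  LaxModEnd.isoMk (NatIso.ofComponents (F := 𝟭 _) (G := (laxFunctor (unit k B)).functor)
      (fun N => LeftComodule.isoOfBijective (coactC N) (coactC_bijective N))
      (fun f => coactC_naturality f))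
    (fun M N => (Category.id_comp _).trans (coactC_chi M N))

/-- The isomorphism of `(X □ Y) □ -` with the composite of `X □ -` and `Y □ -`. -/
noncomputable def sigmaTensor (X Y : HopfTrimodule k B) :
    laxFunctor (cotens X Y) ≅ LaxModEnd.comp (laxFunctor X) (laxFunctor Y) :=
  LaxModEnd.isoMk (NatIso.ofComponents (F := (laxFunctor (cotens X Y)).functor)
      (G := (laxFunctor Y).functor ⋙ (laxFunctor X).functor)
      (fun N => LeftComodule.isoOfBijective (assocC X Y N) (assocC_bijective X Y N))
      (fun {N N'} f => by
        change cotensCMap (𝟙 (cotens X Y)) f ≫ assocC X Y N' =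
          assocC X Y N ≫ cotensCMap (𝟙 X) (cotensCMap (𝟙 Y) f)
        rw [← cotensMap_id, assocC_naturality]))
    (fun M N => chi_assocC X Y M N)

/-- The strong monoidal structure of `X ↦ (X □ -, χ)`. -/
noncomputable def sigmaCoreMonoidal (k B : Type u) [Field k] [Ring B] [Bialgebra k B] :
    (sigma k B).CoreMonoidal :=
  Functor.CoreMonoidal.mk' (sigmaUnit k B) (fun X Y => (sigmaTensor X Y).symm)
    (fun {X Y} f Z => LaxModEnd.hom_ext_app fun N => by
      rw [LaxModEnd.comp_app, LaxModEnd.comp_app, LaxModEnd.whiskerRight_app]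
      change assocC X Z N ≫ cotensCMap f (𝟙 (cotensC Z N)) =
        cotensCMap (cotensMap f (𝟙 Z)) (𝟙 N) ≫ assocC Y Z N
      rw [assocC_naturality, cotensCMap_id])
    (fun {X Y} Z f => LaxModEnd.hom_ext_app fun N => by
      rw [LaxModEnd.comp_app, LaxModEnd.comp_app, LaxModEnd.whiskerLeft_app]
      change assocC Z X N ≫ cotensCMap (𝟙 Z) (cotensCMap f (𝟙 N)) =
        cotensCMap (cotensMap (𝟙 Z) f) (𝟙 N) ≫ assocC Z Y N
      rw [assocC_naturality])
    (fun X Y Z => LaxModEnd.hom_ext_app fun N => by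
      rw [LaxModEnd.comp_app, LaxModEnd.comp_app, LaxModEnd.whiskerRight_app,
        LaxModEnd.associator_app, LaxModEnd.comp_app, LaxModEnd.comp_app,
        LaxModEnd.whiskerLeft_app]
      change assocC (cotens X Y) Z N ≫ assocC X Y (cotensC Z N) ≫ 𝟙 _ =
        cotensCMap (assocHom X Y Z) (𝟙 N) ≫ assocC X (cotens Y Z) N ≫
          cotensCMap (𝟙 X) (assocC Y Z N)
      rw [assocC_pentagon, Category.comp_id])
    (fun X => LaxModEnd.hom_ext_app fun N => by
      rw [LaxModEnd.comp_app, LaxModEnd.comp_app, LaxModEnd.whiskerRight_app]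
      change 𝟙 (cotensC X N) = cotensCMap (lunitInv X) (𝟙 N) ≫ assocC (unit k B) X N ≫
        (LeftComodule.isoOfBijective (coactC (cotensC X N)) (coactC_bijective _)).inv
      rw [← Category.assoc, coactC_cotensC]
      exact (LeftComodule.isoOfBijective (coactC (cotensC X N))
        (coactC_bijective _)).hom_inv_id.symm)
    (fun X => LaxModEnd.hom_ext_app fun N => by
      rw [LaxModEnd.comp_app, LaxModEnd.comp_app, LaxModEnd.whiskerLeft_app]
      change 𝟙 (cotensC X N) = cotensCMap (runitInv X) (𝟙 N) ≫ assocC X (unit k B) N ≫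
        cotensCMap (𝟙 X) (LeftComodule.isoOfBijective (coactC N) (coactC_bijective _)).inv
      rw [← Category.assoc, unit_triangleC, cotensCMap_comp, Category.comp_id]
      refine (cotensCMap_id X N).symm.trans (congrArg _ ?_)
      exact (LeftComodule.isoOfBijective (coactC N) (coactC_bijective _)).hom_inv_id.symm)

/-- The strong monoidal structure of the functor `Σ` into left exact finitary functors. -/
noncomputable def sigmaLexCoreMonoidal (k B : Type u) [Field k] [Ring B] [Bialgebra k B]
    (h : ∀ X, LaxModEnd.IsLexFinitary ((sigma k B).obj X)) :
    (LaxModEnd.IsLexFinitary.lift (sigma k B) h).CoreMonoidal where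
  εIso := ObjectProperty.isoMk _ (sigmaCoreMonoidal k B).εIso
  μIso X Y := ObjectProperty.isoMk _ ((sigmaCoreMonoidal k B).μIso X Y)
  μIso_hom_natural_left f X' := ObjectProperty.hom_ext _
    ((sigmaCoreMonoidal k B).μIso_hom_natural_left f X')
  μIso_hom_natural_right X' f := ObjectProperty.hom_ext _
    ((sigmaCoreMonoidal k B).μIso_hom_natural_right X' f)
  associativity X Y Z := ObjectProperty.hom_ext _ ((sigmaCoreMonoidal k B).associativity X Y Z)
  left_unitality X := ObjectProperty.hom_ext _ ((sigmaCoreMonoidal k B).left_unitality X)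
  right_unitality X := ObjectProperty.hom_ext _ ((sigmaCoreMonoidal k B).right_unitality X)

theorem sigma_monoidal (h : ∀ X, LaxModEnd.IsLexFinitary ((sigma k B).obj X)) :
    ∃ _ : (LaxModEnd.IsLexFinitary.lift (sigma k B) h).Monoidal,
      (∀ (X Y : HopfTrimodule k B) (N : LeftComodule k B)
        (t : (cotensC X (cotensC Y N)).carrier),
        TensorProduct.assoc k X.carrier Y.carrier N.carrier
          (nestR X Y N (((Functor.LaxMonoidal.μ
            (LaxModEnd.IsLexFinitary.lift (sigma k B) h) X Y).hom.nat.app N).toLin t)) =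
          nestL X Y N t) ∧
      (∀ (N : LeftComodule k B) (n : N.carrier),
        (inclC (unit k B) N).toLin
          (((Functor.LaxMonoidal.ε (LaxModEnd.IsLexFinitary.lift
            (sigma k B) h)).hom.nat.app N).toLin n) = N.coact n) := by
  refine ⟨(sigmaLexCoreMonoidal k B h).toMonoidal, fun X Y N t => ?_, fun N n =>
    congr_hom (coactC_inclC N) n⟩
  let e := LeftComodule.isoOfBijective (assocC X Y N) (assocC_bijective X Y N)
  have h1 := congr_hom (assocC_inclCL X Y N) (e.inv.toLin t)
  have h2 : (assocC X Y N).toLin (e.inv.toLin t) = t := congr_hom e.inv_hom_id t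
  exact h1.symm.trans (congrArg (inclCL X Y N).toLin h2)

end HopfTrimodule

end HopfTri

/-! ### Lax module functors and trivial comodules -/

namespace HopfTri

/-- Linear functionals on the left factor separate the elements of a tensor product. -/
theorem eq_of_rTensor_functional {k V W : Type*} [Field k] [AddCommGroup V] [Module k V]
    [AddCommGroup W] [Module k W] {s t : V ⊗[k] W}
    (h : ∀ φ : V →ₗ[k] k, TensorProduct.lid k W (φ.rTensor W s) =
      TensorProduct.lid k W (φ.rTensor W t)) : s = t := by
  classical
  apply (TensorProduct.equivFinsuppOfBasisLeft (N := W) (Module.Basis.ofVectorSpace k V)).injective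
  ext i
  rw [TensorProduct.equivFinsuppOfBasisLeft_apply, TensorProduct.equivFinsuppOfBasisLeft_apply, h]

namespace LeftComodule

open Limits MonoidalCategory

variable {k B : Type u} [Field k] [Ring B] [Bialgebra k B]
variable {V W : Type u} [AddCommGroup V] [Module k V] [AddCommGroup W] [Module k W]

/-- The trivial comodule on a vector space, with coaction `v ↦ 1 ⊗ v`. -/
noncomputable def triv (k B : Type u) [Field k] [Ring B] [Bialgebra k B] (V : Type u)
    [AddCommGroup V] [Module k V] : LeftComodule k B where
  carrier := V
  coact := TensorProduct.mk k B V 1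
  isLeftCoaction :=
    { coassoc := fun c => by simp [Algebra.TensorProduct.one_def]
      counit := fun c => by simp }

/-- A linear map as a morphism of trivial comodules. -/
noncomputable def trivMap (B : Type u) [Ring B] [Bialgebra k B] (f : V →ₗ[k] W) :
    triv k B V ⟶ triv k B W where
  toLin := f
  comm v := (LinearMap.lTensor_tmul B f 1 v).symm

/-- A linear functional as a morphism from a trivial comodule to the unit. -/
noncomputable def trivFunctional (B : Type u) [Ring B] [Bialgebra k B] (φ : V →ₗ[k] k) :
    triv k B V ⟶ 𝟙_ (LeftComodule k B) where
  toLin := φ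
  comm v := (LinearMap.lTensor_tmul B φ 1 v).symm

/-- A vector as a morphism from the unit to a trivial comodule. -/
noncomputable def trivElement (B : Type u) [Ring B] [Bialgebra k B] (v : V) :
    𝟙_ (LeftComodule k B) ⟶ triv k B V where
  toLin := LinearMap.toSpanSingleton k V v
  comm c := (LinearMap.lTensor_tmul B (LinearMap.toSpanSingleton k V v) 1 c).symm

/-- The morphism `m ↦ v ⊗ m`. -/
noncomputable def insertVec (v : V) (M : LeftComodule k B) : M ⟶ triv k B V ⊗ M :=
  (λ_ M).inv ≫ trivElement B v ▷ M

theorem insertVec_apply (v : V) (M : LeftComodule k B) (m : M.carrier) :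
    (insertVec v M).toLin m = v ⊗ₜ[k] m :=
  congrArg (· ⊗ₜ[k] m) (one_smul k v)

/-- The morphism `v ⊗ m ↦ φ(v) m`. -/
noncomputable def evaluate (φ : V →ₗ[k] k) (M : LeftComodule k B) : triv k B V ⊗ M ⟶ M :=
  trivFunctional B φ ▷ M ≫ (λ_ M).hom

/-- The diagram of the comodules `V' ⊗ M`, for `V'` the span of a finite subset of `V`. -/
noncomputable def spanDiagram (V : Type u) [AddCommGroup V] [Module k V] (M : LeftComodule k B) :
    Finset V ⥤ LeftComodule k B where
  obj S := triv k B (Submodule.span k (S : Set V)) ⊗ M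
  map f := trivMap B (Submodule.inclusion (Submodule.span_mono
    (Finset.coe_subset.2 (leOfHom f)))) ▷ M
  map_id _ := hom_ext (TensorProduct.ext' fun _ _ => rfl)
  map_comp _ _ := hom_ext (TensorProduct.ext' fun _ _ => rfl)

/-- The cocone with vertex `V ⊗ M` over the comodules `V' ⊗ M`, for `V'` the span of a finite
subset of `V`. -/
noncomputable def spanCocone (V : Type u) [AddCommGroup V] [Module k V] (M : LeftComodule k B) :
    Cocone (spanDiagram V M) where
  pt := triv k B V ⊗ M
  ι :=
    { app := fun S => trivMap B (Submodule.span k (S : Set V)).subtype ▷ M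
      naturality := fun _ _ _ => hom_ext (TensorProduct.ext' fun _ _ => rfl) }

/-- The comodule `V ⊗ M` is the filtered colimit of the comodules `V' ⊗ M`, for `V'` the span of
a finite subset of `V`. -/
theorem spanCocone_isColimit (V : Type u) [AddCommGroup V] [Module k V] (M : LeftComodule k B) :
    Nonempty (IsColimit (spanCocone V M)) := by
  classical
  have hinj : ∀ S : Finset V, Function.Injective
      (TensorProduct.map (Submodule.span k (S : Set V)).subtype
        (LinearMap.id : M.carrier →ₗ[k] M.carrier)) := fun S =>
    HopfTri.map_injective (Submodule.injective_subtype _) (fun _ _ h => h)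
  have hsurj : ∀ x : V ⊗[k] M.carrier, ∃ (S : Finset V)
      (y : Submodule.span k (S : Set V) ⊗[k] M.carrier),
      TensorProduct.map (Submodule.span k (S : Set V)).subtype LinearMap.id y = x := by
    intro x
    induction x with
    | zero => exact ⟨∅, 0, map_zero _⟩
    | tmul v m =>
      exact ⟨{v}, ⟨v, Submodule.subset_span (by simp)⟩ ⊗ₜ m, rfl⟩
    | add x x' hx hx' =>
      obtain ⟨S, y, rfl⟩ := hx
      obtain ⟨S', y', rfl⟩ := hx'
      have h1 : (S : Set V) ⊆ (S ∪ S' : Finset V) := by simp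
      have h2 : (S' : Set V) ⊆ (S ∪ S' : Finset V) := by simp
      refine ⟨S ∪ S', TensorProduct.map (Submodule.inclusion (Submodule.span_mono h1))
        LinearMap.id y + TensorProduct.map (Submodule.inclusion (Submodule.span_mono h2))
        LinearMap.id y', ?_⟩
      rw [map_add, ← LinearMap.comp_apply, ← LinearMap.comp_apply, ← TensorProduct.map_comp,
        ← TensorProduct.map_comp, Submodule.subtype_comp_inclusion,
        Submodule.subtype_comp_inclusion]
      rfl
  refine isColimit_of_elements (fun x => hsurj x) (fun S y hy => ⟨S, 𝟙 S, ?_⟩)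
  have : y = 0 := hinj S (hy.trans (map_zero _).symm)
  rw [this, map_zero]

end LeftComodule

namespace LaxModEnd

open Limits MonoidalCategory LeftComodule

variable {k B : Type u} [Field k] [Ring B] [Bialgebra k B]
variable {V W : Type u} [AddCommGroup V] [Module k V] [AddCommGroup W] [Module k W]
variable (F : LaxModEnd (LeftComodule k B))

/-- The linear map underlying the structure morphism `M ⊗ F N ⟶ F (M ⊗ N)`. -/
noncomputable def strMap (M N : LeftComodule k B) :
    M.carrier ⊗[k] (F.functor.obj N).carrier →ₗ[k] (F.functor.obj (M ⊗ N)).carrier :=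
  (F.str M N).toLin

/-- The linear map underlying the structure morphism `V ⊗ F N ⟶ F (V ⊗ N)` for the trivial
comodule on `V`. -/
noncomputable def strTriv (V : Type u) [AddCommGroup V] [Module k V] (N : LeftComodule k B) :
    V ⊗[k] (F.functor.obj N).carrier →ₗ[k] (F.functor.obj (triv k B V ⊗ N)).carrier :=
  (F.str (triv k B V) N).toLin

/-- The linear map underlying the value of the functor at a morphism. -/
noncomputable def mapLin {M N : LeftComodule k B} (f : M ⟶ N) :
    (F.functor.obj M).carrier →ₗ[k] (F.functor.obj N).carrier := (F.functor.map f).toLin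

theorem mapLin_comp {M N P : LeftComodule k B} (f : M ⟶ N) (g : N ⟶ P)
    (x : (F.functor.obj M).carrier) : F.mapLin (f ≫ g) x = F.mapLin g (F.mapLin f x) :=
  congr_hom (F.functor.map_comp f g) x

theorem mapLin_id (M : LeftComodule k B) (x : (F.functor.obj M).carrier) :
    F.mapLin (𝟙 M) x = x := congr_hom (F.functor.map_id M) x

theorem strMap_left {M M' : LeftComodule k B} (f : M ⟶ M') (N : LeftComodule k B)
    (s : M.carrier ⊗[k] (F.functor.obj N).carrier) :
    F.strMap M' N (f.toLin.rTensor _ s) = F.mapLin (f ▷ N) (F.strMap M N s) :=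
  congr_hom (F.str_left f N) s

theorem strMap_right (M : LeftComodule k B) {N N' : LeftComodule k B} (f : N ⟶ N')
    (s : M.carrier ⊗[k] (F.functor.obj N).carrier) :
    F.strMap M N' ((F.mapLin f).lTensor _ s) = F.mapLin (M ◁ f) (F.strMap M N s) :=
  congr_hom (F.str_right M f) s

theorem strTriv_left (f : V →ₗ[k] W) (N : LeftComodule k B)
    (s : V ⊗[k] (F.functor.obj N).carrier) :
    F.strTriv W N (f.rTensor _ s) = F.mapLin (trivMap B f ▷ N) (F.strTriv V N s) :=
  F.strMap_left (trivMap B f) N s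

theorem strTriv_right {N N' : LeftComodule k B} (f : N ⟶ N')
    (s : V ⊗[k] (F.functor.obj N).carrier) :
    F.strTriv V N' ((F.mapLin f).lTensor _ s) = F.mapLin (triv k B V ◁ f) (F.strTriv V N s) :=
  F.strMap_right (triv k B V) f s

theorem strMap_assoc (M M' N : LeftComodule k B) (m : M.carrier) (m' : M'.carrier)
    (x : (F.functor.obj N).carrier) :
    F.mapLin (α_ M M' N).hom (F.strMap (M ⊗ M') N ((m ⊗ₜ[k] m' : M.carrier ⊗[k] M'.carrier) ⊗ₜ x)) =
      F.strMap M (M' ⊗ N) (m ⊗ₜ F.strMap M' N (m' ⊗ₜ x)) :=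
  congr_hom (F.str_assoc M M' N) ((m ⊗ₜ[k] m') ⊗ₜ[k] x)

theorem strMap_assoc_inv (M M' N : LeftComodule k B) (m : M.carrier) (m' : M'.carrier)
    (x : (F.functor.obj N).carrier) :
    F.mapLin (α_ M M' N).inv (F.strMap M (M' ⊗ N) (m ⊗ₜ F.strMap M' N (m' ⊗ₜ x))) =
      F.strMap (M ⊗ M') N ((m ⊗ₜ[k] m' : M.carrier ⊗[k] M'.carrier) ⊗ₜ x) := by
  rw [← strMap_assoc, ← mapLin_comp, Iso.hom_inv_id, mapLin_id]

theorem strMap_unit (N : LeftComodule k B) (c : k) (x : (F.functor.obj N).carrier) :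
    F.mapLin (λ_ N).hom (F.strMap (𝟙_ _) N (c ⊗ₜ x)) = c • x :=
  (congr_hom (F.str_unit N) (c ⊗ₜ[k] x)).symm

/-- On a trivial comodule the structure morphism is `v ⊗ x ↦ F(n ↦ v ⊗ n)(x)`. -/
theorem strTriv_tmul (N : LeftComodule k B) (v : V) (x : (F.functor.obj N).carrier) :
    F.strTriv V N (v ⊗ₜ x) = F.mapLin (insertVec v N) x := by
  have h1 : F.mapLin (λ_ N).inv x = F.strMap (𝟙_ _) N ((1 : k) ⊗ₜ x) := by
    have h0 : F.mapLin (λ_ N).hom (F.strMap (𝟙_ _) N ((1 : k) ⊗ₜ x)) = x :=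
      (F.strMap_unit N 1 x).trans (one_smul k x)
    refine (congrArg _ h0.symm).trans ?_
    rw [← mapLin_comp, Iso.hom_inv_id, mapLin_id]
  rw [insertVec, mapLin_comp, h1, ← strMap_left]
  exact congrArg (fun w : V => F.strTriv V N (w ⊗ₜ[k] x)) (one_smul k v).symm

theorem mapLin_evaluate_strTriv (N : LeftComodule k B) (φ : V →ₗ[k] k)
    (s : V ⊗[k] (F.functor.obj N).carrier) :
    F.mapLin (evaluate φ N) (F.strTriv V N s) =
      TensorProduct.lid k _ (φ.rTensor _ s) := by
  induction s with
  | zero => simp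
  | add x y hx hy => simp only [map_add, hx, hy]
  | tmul v x =>
    rw [evaluate, mapLin_comp]
    refine (congrArg _ (F.strMap_left (trivFunctional B φ) N (v ⊗ₜ[k] x)).symm).trans ?_
    exact F.strMap_unit N (φ v) x

theorem strTriv_injective (V : Type u) [AddCommGroup V] [Module k V] (N : LeftComodule k B) :
    Function.Injective (F.strTriv V N) := by
  intro s t h
  refine eq_of_rTensor_functional fun φ => ?_
  rw [← mapLin_evaluate_strTriv, ← mapLin_evaluate_strTriv, h]

theorem strTriv_surjective_of_finite [PreservesFiniteLimits F.functor] (V : Type u)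
    [AddCommGroup V] [Module k V] [FiniteDimensional k V] (N : LeftComodule k B) :
    Function.Surjective (F.strTriv V N) := by
  intro y
  have := additive_of_lex F.functor
  let b := Module.finBasis k V
  have h0 : ∀ (v : V) (n : N.carrier), v ⊗ₜ[k] n = ∑ i, b i ⊗ₜ[k] (b.coord i v • n) := by
    intro v n
    simp_rw [← TensorProduct.smul_tmul, ← TensorProduct.sum_tmul, Module.Basis.coord_apply,
      b.sum_repr]
  have h : 𝟙 (triv k B V ⊗ N) = ∑ i, evaluate (b.coord i) N ≫ insertVec (b i) N := by
    refine LeftComodule.hom_ext (TensorProduct.ext' fun v n => ?_)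
    have h1 : (∑ i, evaluate (b.coord i) N ≫ insertVec (b i) N).toLin (v ⊗ₜ[k] n) =
        ∑ i, (b i ⊗ₜ[k] (b.coord i v • n) : V ⊗[k] N.carrier) := by
      rw [sum_toLin]
      refine (LinearMap.sum_apply _ _ _).trans (Finset.sum_congr rfl fun i _ => ?_)
      exact insertVec_apply (b i) N _
    exact (h0 v n).trans h1.symm
  refine ⟨∑ i, b i ⊗ₜ F.mapLin (evaluate (b.coord i) N) y, ?_⟩
  have h2 : F.mapLin (𝟙 (triv k B V ⊗ N)) y =
      ∑ i, F.mapLin (evaluate (b.coord i) N ≫ insertVec (b i) N) y := by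
    rw [h, mapLin, F.functor.map_sum, sum_toLin]
    exact LinearMap.sum_apply _ _ _
  rw [mapLin_id] at h2
  rw [map_sum]
  refine Eq.trans ?_ h2.symm
  refine Finset.sum_congr rfl fun i _ => ?_
  rw [mapLin_comp, ← strTriv_tmul]

variable {F}

/-- For a left exact finitary lax module functor, the structure morphism `V ⊗ F N ⟶ F (V ⊗ N)`
is bijective for `V` a trivial comodule: both sides are finitary in `V`, and for finite
dimensional `V` the statement is the additivity of `F`. -/
theorem strTriv_bijective (hF : IsLexFinitary F) (V : Type u) [AddCommGroup V] [Module k V]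
    (N : LeftComodule k B) : Function.Bijective (F.strTriv V N) := by
  classical
  refine ⟨F.strTriv_injective V N, fun y => ?_⟩
  obtain ⟨_, _⟩ := hF
  obtain ⟨c⟩ := spanCocone_isColimit V N
  obtain ⟨S, y', hy'⟩ := exists_rep_apply (isColimitOfPreserves F.functor c) y
  obtain ⟨s, rfl⟩ := F.strTriv_surjective_of_finite (Submodule.span k (S : Set V)) N y'
  exact ⟨_, (F.strTriv_left (Submodule.span k (S : Set V)).subtype N s).trans hy'⟩

end LaxModEnd

end HopfTri

/-! ### The Hopf trimodule structure on the value at `B` -/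

namespace HopfTri

section LinearAlgebra

variable {k B : Type u} [Field k] [Ring B] [Bialgebra k B]
variable {X M N V : Type u} [AddCommGroup X] [Module k X] [AddCommGroup M] [Module k M]
  [AddCommGroup N] [Module k N] [AddCommGroup V] [Module k V]

theorem tensorCoact_triv_comm {δ : M →ₗ[k] B ⊗[k] M} (hδ : IsLeftCoaction δ) (m : M) :
    tensorCoact (TensorProduct.mk k B M 1) (Coalgebra.comul (R := k))
      (TensorProduct.comm k B M (δ m)) =
    ((TensorProduct.comm k B M).toLinearMap ∘ₗ δ).lTensor B (δ m) := by
  have h : ∀ s : B ⊗[k] M, tensorCoact (TensorProduct.mk k B M 1) (Coalgebra.comul (R := k))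
      (TensorProduct.comm k B M s) = (TensorProduct.comm k B M).toLinearMap.lTensor B
        (TensorProduct.assoc k B B M ((Coalgebra.comul (R := k) (A := B)).rTensor M s)) := by
    intro s
    induction s with
    | zero => simp
    | add x y hx hy => simp only [map_add, hx, hy]
    | tmul b m =>
      simp only [tensorCoact, TensorProduct.comm_tmul, LinearMap.comp_apply, LinearEquiv.coe_coe,
        TensorProduct.map_tmul, LinearMap.rTensor_tmul]
      generalize (Coalgebra.comul (R := k) b) = d
      induction d with
      | zero => simp
      | add x y hx hy =>
        simp only [TensorProduct.add_tmul, TensorProduct.tmul_add, map_add, hx, hy]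
      | tmul b c => simp
  rw [h, hδ.coassoc, LinearMap.lTensor_comp_apply]

theorem tensorCoact_triv_assoc (δ : N →ₗ[k] B ⊗[k] N) (t : M ⊗[k] (V ⊗[k] N)) :
    tensorCoact (TensorProduct.mk k B (M ⊗[k] V) 1) δ ((TensorProduct.assoc k M V N).symm t) =
      (TensorProduct.assoc k M V N).symm.toLinearMap.lTensor B
        (tensorCoact (TensorProduct.mk k B M 1)
          (tensorCoact (TensorProduct.mk k B V 1) δ) t) := by
  induction t with
  | zero => simp
  | add x y hx hy => simp only [map_add, hx, hy]
  | tmul m s =>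
  induction s with
  | zero => simp
  | add x y hx hy => simp only [TensorProduct.tmul_add, map_add, hx, hy]
  | tmul v n =>
    simp only [tensorCoact, LinearMap.comp_apply, LinearEquiv.coe_coe,
      TensorProduct.map_tmul, TensorProduct.assoc_symm_tmul]
    generalize δ n = s
    induction s with
    | zero => simp
    | add x y hx hy => simp only [TensorProduct.tmul_add, map_add, hx, hy]
    | tmul b n => simp

/-- The map `(m ⊗ b) ⊗ (n ⊗ c) ↦ (m ⊗ n) ⊗ b c`. -/
noncomputable def mulRight (B M N : Type u) [Ring B] [Bialgebra k B] [AddCommGroup M]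
    [Module k M] [AddCommGroup N] [Module k N] :
    (M ⊗[k] B) ⊗[k] (N ⊗[k] B) →ₗ[k] (M ⊗[k] N) ⊗[k] B :=
  (LinearMap.mul' k B).lTensor (M ⊗[k] N) ∘ₗ
    (TensorProduct.tensorTensorTensorComm k M B N B).toLinearMap

theorem tensorCoact_mulRight (t : (M ⊗[k] B) ⊗[k] (N ⊗[k] B)) :
    tensorCoact (TensorProduct.mk k B (M ⊗[k] N) 1) (Coalgebra.comul (R := k))
      (mulRight B M N t) =
    (mulRight B M N).lTensor B (tensorCoact
      (tensorCoact (TensorProduct.mk k B M 1) (Coalgebra.comul (R := k)))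
      (tensorCoact (TensorProduct.mk k B N 1) (Coalgebra.comul (R := k))) t) := by
  induction t with
  | zero => simp
  | add x y hx hy => simp only [map_add, hx, hy]
  | tmul s r =>
  induction s with
  | zero => simp
  | add x y hx hy => simp only [TensorProduct.add_tmul, map_add, hx, hy]
  | tmul m b =>
  induction r with
  | zero => simp
  | add x y hx hy => simp only [TensorProduct.tmul_add, map_add, hx, hy]
  | tmul n c =>
    simp only [tensorCoact, mulRight, LinearMap.comp_apply, LinearEquiv.coe_coe,
      TensorProduct.map_tmul, TensorProduct.tensorTensorTensorComm_tmul, LinearMap.lTensor_tmul,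
      LinearMap.mul'_apply, Bialgebra.comul_mul]
    generalize (Coalgebra.comul (R := k) b) = d
    generalize (Coalgebra.comul (R := k) c) = e
    induction d with
    | zero => simp
    | add x y hx hy =>
      simp only [TensorProduct.add_tmul, TensorProduct.tmul_add, add_mul, map_add, hx, hy]
    | tmul b b' =>
    induction e with
    | zero => simp
    | add x y hx hy =>
      simp only [TensorProduct.tmul_add, mul_add, map_add, hx, hy]
    | tmul c c' => simp

theorem comm_coact_mul (δ : M →ₗ[k] B ⊗[k] M) (γ : N →ₗ[k] B ⊗[k] N) (t : M ⊗[k] N) :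
    TensorProduct.comm k B (M ⊗[k] N) (tensorCoact δ γ t) =
      mulRight B M N (TensorProduct.map ((TensorProduct.comm k B M).toLinearMap ∘ₗ δ)
        ((TensorProduct.comm k B N).toLinearMap ∘ₗ γ) t) := by
  induction t with
  | zero => simp
  | add x y hx hy => simp only [map_add, hx, hy]
  | tmul m n =>
    simp only [tensorCoact, TensorProduct.map_tmul, LinearMap.comp_apply, LinearEquiv.coe_coe]
    generalize δ m = s
    generalize γ n = r
    induction s with
    | zero => simp
    | add x y hx hy => simp only [TensorProduct.add_tmul, map_add, hx, hy]
    | tmul b m =>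
    induction r with
    | zero => simp
    | add x y hx hy => simp only [TensorProduct.tmul_add, map_add, hx, hy]
    | tmul c n => simp [mulRight]

/-- The cotensor condition after exchanging the two factors. -/
theorem mem_cotensor_iff_comm (ρ : X →ₗ[k] X ⊗[k] B) (δ : M →ₗ[k] B ⊗[k] M) (t : X ⊗[k] M) :
    t ∈ cotensor ρ δ ↔
      ((TensorProduct.comm k B M).toLinearMap ∘ₗ δ).rTensor X (TensorProduct.comm k X M t) =
      (TensorProduct.assoc k M B X).symm (((TensorProduct.comm k X B).toLinearMap ∘ₗ ρ).lTensor M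
        (TensorProduct.comm k X M t)) := by
  let E : X ⊗[k] (B ⊗[k] M) ≃ₗ[k] (M ⊗[k] B) ⊗[k] X :=
    TensorProduct.comm k X (B ⊗[k] M) ≪≫ₗ (TensorProduct.comm k B M).rTensor X
  have h1 : ∀ t : X ⊗[k] M, E (δ.lTensor X t) =
      ((TensorProduct.comm k B M).toLinearMap ∘ₗ δ).rTensor X (TensorProduct.comm k X M t) := by
    intro t
    induction t with
    | zero => simp
    | add x y hx hy => simp only [map_add, hx, hy]
    | tmul x m => simp [E]
  have h2 : ∀ t : X ⊗[k] M, E (TensorProduct.assoc k X B M (ρ.rTensor M t)) =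
      (TensorProduct.assoc k M B X).symm (((TensorProduct.comm k X B).toLinearMap ∘ₗ ρ).lTensor M
        (TensorProduct.comm k X M t)) := by
    intro t
    induction t with
    | zero => simp
    | add x y hx hy => simp only [map_add, hx, hy]
    | tmul x m =>
      simp only [LinearMap.rTensor_tmul, TensorProduct.comm_tmul, LinearMap.lTensor_tmul,
        LinearMap.comp_apply, LinearEquiv.coe_coe]
      generalize ρ x = s
      induction s with
      | zero => simp
      | add x y hx hy =>
        simp only [TensorProduct.add_tmul, TensorProduct.tmul_add, map_add, hx, hy]
      | tmul x b => simp [E]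
  rw [mem_cotensor, ← E.injective.eq_iff, h1, h2, eq_comm]

theorem outerL_comm (l : X →ₗ[k] B ⊗[k] X) (s : M ⊗[k] X) :
    outerL l M (TensorProduct.comm k M X s) =
      (TensorProduct.comm k M X).toLinearMap.lTensor B
        (tensorCoact (TensorProduct.mk k B M 1) l s) := by
  induction s with
  | zero => simp
  | add x y hx hy => simp only [map_add, hx, hy]
  | tmul m x =>
    simp only [outerL, tensorCoact, TensorProduct.comm_tmul, LinearMap.comp_apply,
      LinearEquiv.coe_coe, LinearMap.rTensor_tmul, TensorProduct.map_tmul]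
    generalize l x = e
    induction e with
    | zero => simp
    | add x y hx hy =>
      simp only [TensorProduct.add_tmul, TensorProduct.tmul_add, map_add, hx, hy]
    | tmul a b => simp

theorem lTensor_act_tensorCoact (a : B →ₐ[k] Module.End k X) (f : B ⊗[k] X →ₗ[k] X)
    (hf : ∀ b x, f (b ⊗ₜ x) = a b x) (l : X →ₗ[k] B ⊗[k] X) (b : B) (x : X) :
    f.lTensor B (tensorCoact (Coalgebra.comul (R := k)) l (b ⊗ₜ x)) =
      diagAct regAct a b (l x) := by
  simp only [tensorCoact, TensorProduct.map_tmul, LinearMap.comp_apply, LinearEquiv.coe_coe,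
    diagAct_apply]
  generalize (Coalgebra.comul (R := k) b) = d
  generalize l x = e
  induction d with
  | zero => simp
  | add x y hx hy => simp only [TensorProduct.add_tmul, map_add, LinearMap.add_apply, hx, hy]
  | tmul b c =>
  induction e with
  | zero => simp
  | add x y hx hy => simp only [TensorProduct.tmul_add, map_add, hx, hy]
  | tmul b' x => simp [regAct, hf]

theorem lTensor_mul_interchange (a : B →ₐ[k] Module.End k X) (b : B) (s : X ⊗[k] B) :
    (LinearMap.mul' k B).lTensor X (interchange (Coalgebra.comul (R := k)) a B (b ⊗ₜ s)) =
      diagAct a regAct b s := by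
  induction s with
  | zero => simp
  | add x y hx hy => simp only [TensorProduct.tmul_add, map_add, hx, hy]
  | tmul x c =>
    rw [interchange_tmul, diagAct_apply]
    generalize (Coalgebra.comul (R := k) b) = d
    induction d with
    | zero => simp
    | add x y hx hy => simp only [map_add, LinearMap.add_apply, hx, hy]
    | tmul b b' => simp [regAct]

/-- Linear functionals on the right factor separate the elements of a tensor product. -/
theorem eq_of_lTensor_functional {s t : X ⊗[k] V}
    (h : ∀ φ : V →ₗ[k] k, TensorProduct.rid k X (φ.lTensor X s) =
      TensorProduct.rid k X (φ.lTensor X t)) : s = t := by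
  have h1 : ∀ (φ : V →ₗ[k] k) (s : X ⊗[k] V), TensorProduct.lid k X
      (φ.rTensor X (TensorProduct.comm k X V s)) = TensorProduct.rid k X (φ.lTensor X s) := by
    intro φ s
    induction s with
    | zero => simp
    | add x y hx hy => simp only [map_add, hx, hy]
    | tmul x v => simp
  apply (TensorProduct.comm k X V).injective
  exact eq_of_rTensor_functional fun φ => by rw [h1, h1, h]

end LinearAlgebra

namespace LeftComodule

open MonoidalCategory

variable {k B : Type u} [Field k] [Ring B] [Bialgebra k B]

/-- The coaction as a comodule morphism `M → M ⊗ B`, `m ↦ m₀ ⊗ m₋₁`, where `M` on the right hand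
side carries the trivial coaction. -/
noncomputable def spread (M : LeftComodule k B) : M ⟶ triv k B M.carrier ⊗ regular k B where
  toLin := (TensorProduct.comm k B M.carrier).toLinearMap ∘ₗ M.coact
  comm := tensorCoact_triv_comm (B := B) (M := M.carrier) (δ := M.coact) M.isLeftCoaction

theorem spread_naturality {M N : LeftComodule k B} (f : M ⟶ N) :
    f ≫ spread N = spread M ≫ trivMap B f.toLin ▷ regular k B := by
  refine hom_ext (LinearMap.ext fun m => ?_)
  change TensorProduct.comm k B N.carrier (N.coact (f.toLin m)) =
    f.toLin.rTensor B (TensorProduct.comm k B M.carrier (M.coact m))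
  rw [f.comm]
  generalize M.coact m = s
  induction s with
  | zero => simp
  | add x y hx hy => simp only [map_add, hx, hy]
  | tmul b m => simp

theorem spread_injective (M : LeftComodule k B) : Function.Injective (spread M).toLin := by
  intro x y h
  have : M.coact x = M.coact y := (TensorProduct.comm k B M.carrier).injective h
  rw [← M.isLeftCoaction.counit x, this, M.isLeftCoaction.counit]

/-- The associativity `V ⊗ (W ⊗ N) → (V ⊗ W) ⊗ N` for trivial comodules on `V`, `W` and
`V ⊗ W`. -/
noncomputable def trivAssoc (V W : Type u) [AddCommGroup V] [Module k V] [AddCommGroup W]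
    [Module k W] (N : LeftComodule k B) :
    triv k B V ⊗ (triv k B W ⊗ N) ⟶ triv k B (V ⊗[k] W) ⊗ N where
  toLin := (TensorProduct.assoc k V W N.carrier).symm.toLinearMap
  comm := tensorCoact_triv_assoc N.coact

/-- The first of the two morphisms `M ⊗ B → (M ⊗ B) ⊗ B` whose equaliser is `M`,
`m ⊗ b ↦ (m₀ ⊗ m₋₁) ⊗ b`. -/
noncomputable def spreadFst (M : LeftComodule k B) :
    triv k B M.carrier ⊗ regular k B ⟶ triv k B (M.carrier ⊗[k] B) ⊗ regular k B :=
  trivMap B ((TensorProduct.comm k B M.carrier).toLinearMap ∘ₗ M.coact) ▷ regular k B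

/-- The second of the two morphisms `M ⊗ B → (M ⊗ B) ⊗ B` whose equaliser is `M`,
`m ⊗ b ↦ (m ⊗ b₂) ⊗ b₁`. -/
noncomputable def spreadSnd (M : LeftComodule k B) :
    triv k B M.carrier ⊗ regular k B ⟶ triv k B (M.carrier ⊗[k] B) ⊗ regular k B :=
  triv k B M.carrier ◁ spread (regular k B) ≫ trivAssoc M.carrier B (regular k B)

theorem spreadFst_eq_iff (M : LeftComodule k B) (t : B ⊗[k] M.carrier) :
    (spreadFst M).toLin (TensorProduct.comm k B M.carrier t) =
      (spreadSnd M).toLin (TensorProduct.comm k B M.carrier t) ↔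
    t ∈ cotensor (Coalgebra.comul (R := k) (A := B)) M.coact :=
  (mem_cotensor_iff_comm (Coalgebra.comul (R := k) (A := B)) M.coact t).symm

theorem spread_condition (M : LeftComodule k B) :
    spread M ≫ spreadFst M = spread M ≫ spreadSnd M :=
  hom_ext (LinearMap.ext fun m =>
    (spreadFst_eq_iff M (M.coact m)).2 (coact_mem_cotensor M.isLeftCoaction m))

/-- Every comodule `M` is the equaliser of `spreadFst M` and `spreadSnd M`. -/
theorem spread_exact (M : LeftComodule k B)
    (s : (triv k B M.carrier ⊗ regular k B : LeftComodule k B).carrier)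
    (hs : (spreadFst M).toLin s = (spreadSnd M).toLin s) :
    s ∈ LinearMap.range (spread M).toLin := by
  obtain ⟨t, rfl⟩ := (TensorProduct.comm k B M.carrier).surjective s
  exact ⟨_, congrArg (TensorProduct.comm k B M.carrier)
    (coact_counit ((spreadFst_eq_iff M t).1 hs))⟩

/-- The comodule morphism `(m ⊗ b) ⊗ (n ⊗ c) ↦ (m ⊗ n) ⊗ b c`. -/
noncomputable def mulRightHom (M N : Type u) [AddCommGroup M] [Module k M] [AddCommGroup N]
    [Module k N] : (triv k B M ⊗ regular k B) ⊗ (triv k B N ⊗ regular k B) ⟶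
      triv k B (M ⊗[k] N) ⊗ regular k B where
  toLin := mulRight (k := k) B M N
  comm := tensorCoact_mulRight (k := k) (B := B) (M := M) (N := N)

/-- The morphism `M → M ⊗ B` is multiplicative in `M`. -/
theorem spread_tensor (M N : LeftComodule k B) :
    spread (M ⊗ N) = M ◁ spread N ≫ spread M ▷ _ ≫ mulRightHom M.carrier N.carrier := by
  refine hom_ext (TensorProduct.ext' fun m n => ?_)
  exact comm_coact_mul M.coact N.coact (m ⊗ₜ n)

/-- Restricted to `m ⊗ B` and `n ⊗ B`, the morphism `mulRightHom` is the multiplication of `B`. -/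
theorem insertVec_mulRightHom {M N : Type u} [AddCommGroup M] [Module k M] [AddCommGroup N]
    [Module k N] (m : M) (n : N) :
    insertVec m (regular k B ⊗ regular k B) ≫ (α_ (triv k B M) (regular k B) (regular k B)).inv ≫
      (triv k B M ⊗ regular k B) ◁ insertVec n (regular k B) ≫ mulRightHom M N =
    mulHom k B ≫ insertVec (m ⊗ₜ[k] n) (regular k B) := by
  refine hom_ext (TensorProduct.ext' fun (b c : B) => ?_)
  have h1 := insertVec_apply m (regular k B ⊗ regular k B) (b ⊗ₜ[k] c)
  have h2 := insertVec_apply n (regular k B) c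
  have h3 := insertVec_apply (m ⊗ₜ[k] n) (regular k B) (b * c)
  refine Eq.trans ?_ h3.symm
  refine (congrArg (fun z => (mulRightHom M N).toLin
    (((triv k B M ⊗ regular k B) ◁ insertVec n (regular k B)).toLin
      ((α_ (triv k B M) (regular k B) (regular k B)).inv.toLin z))) h1).trans ?_
  exact congrArg (fun z => mulRight B M N ((m ⊗ₜ[k] b) ⊗ₜ[k] z)) h2

theorem insertVec_insertVec {V W : Type u} [AddCommGroup V] [Module k V] [AddCommGroup W]
    [Module k W] (v : V) (w : W) (N : LeftComodule k B) :
    insertVec w N ≫ insertVec v (triv k B W ⊗ N) ≫ trivAssoc V W N =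
      insertVec (v ⊗ₜ[k] w) N := by
  refine hom_ext (LinearMap.ext fun n => ?_)
  refine Eq.trans ?_ (insertVec_apply (v ⊗ₜ[k] w) N n).symm
  refine (congrArg (trivAssoc V W N).toLin (insertVec_apply v (triv k B W ⊗ N) _)).trans ?_
  exact congrArg (fun z => (TensorProduct.assoc k V W N.carrier).symm (v ⊗ₜ[k] z))
    (insertVec_apply w N n)

/-- The unit of `B` as a morphism of comodules. -/
noncomputable def oneHom (k B : Type u) [Field k] [Ring B] [Bialgebra k B] :
    𝟙_ (LeftComodule k B) ⟶ regular k B where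
  toLin := LinearMap.toSpanSingleton k B 1
  comm := fun (c : k) => by
    change Coalgebra.comul (R := k) (c • (1 : B)) =
      (LinearMap.toSpanSingleton k B 1).lTensor B ((1 : B) ⊗ₜ[k] c)
    rw [map_smul, Bialgebra.comul_one, Algebra.TensorProduct.one_def, LinearMap.lTensor_tmul,
      LinearMap.toSpanSingleton_apply, TensorProduct.tmul_smul]

theorem oneHom_mulHom : (λ_ (regular k B)).inv ≫ oneHom k B ▷ regular k B ≫ mulHom k B =
    𝟙 (regular k B) := by
  refine hom_ext (LinearMap.ext fun (b : B) => ?_)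
  change ((1 : k) • (1 : B)) * b = b
  rw [one_smul, one_mul]

theorem mulHom_assoc : mulHom k B ▷ regular k B ≫ mulHom k B =
    (α_ _ _ _).hom ≫ regular k B ◁ mulHom k B ≫ mulHom k B :=
  hom_ext (TensorProduct.ext_threefold fun (a b c : B) => mul_assoc a b c)

theorem spread_evaluate (φ : B →ₗ[k] k) :
    spread (regular k B) ≫ evaluate φ (regular k B) = translate φ := by
  refine hom_ext (LinearMap.ext fun (b : B) => ?_)
  have h : ∀ s : B ⊗[k] B, TensorProduct.lid k B (φ.rTensor B (TensorProduct.comm k B B s)) =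
      TensorProduct.rid k B (φ.lTensor B s) := by
    intro s
    induction s with
    | zero => simp
    | add x y hx hy => simp only [map_add, hx, hy]
    | tmul b c => simp
  exact h (Coalgebra.comul (R := k) b)

end LeftComodule

end HopfTri

/-! ### Coordinates of a lax module functor in its value at `B` -/

namespace HopfTri

/-- The interchange map, written through the multiplication of the factors in `B`. -/
theorem comm_interchange {k B X M N : Type u} [Field k] [Ring B] [Bialgebra k B]
    [AddCommGroup X] [Module k X] [AddCommGroup M] [Module k M] [AddCommGroup N] [Module k N]
    (δ : M →ₗ[k] B ⊗[k] M) (a : B →ₐ[k] Module.End k X) (m : M) (s : X ⊗[k] N) :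
    TensorProduct.comm k X (M ⊗[k] N) (interchange δ a N (m ⊗ₜ s)) =
      (TensorProduct.lift a.toLinearMap).lTensor (M ⊗[k] N)
        (TensorProduct.tensorTensorTensorComm k M B N X
          (TensorProduct.comm k B M (δ m) ⊗ₜ TensorProduct.comm k X N s)) := by
  induction s with
  | zero => simp
  | add x y hx hy => simp only [TensorProduct.tmul_add, map_add, hx, hy]
  | tmul x n =>
    rw [interchange_tmul]
    generalize δ m = r
    induction r with
    | zero => simp
    | add x y hx hy => simp only [TensorProduct.add_tmul, map_add, hx, hy]
    | tmul b m => simp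

namespace LaxModEnd

open Limits MonoidalCategory LeftComodule

variable {k B : Type u} [Field k] [Ring B] [Bialgebra k B]

/-- The vector space underlying the value of a lax module endofunctor at `B`. -/
abbrev valB (F : LaxModEnd (LeftComodule k B)) : Type u :=
  (F.functor.obj (regular k B)).carrier

section

variable (F : LaxModEnd (LeftComodule k B))

theorem strTriv_assoc_tmul {V W : Type u} [AddCommGroup V] [Module k V] [AddCommGroup W]
    [Module k W] (N : LeftComodule k B) (v : V) (r : W ⊗[k] (F.functor.obj N).carrier) :
    F.strTriv (V ⊗[k] W) N ((TensorProduct.assoc k V W _).symm (v ⊗ₜ r)) =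
      F.mapLin (trivAssoc V W N) (F.mapLin (insertVec v (triv k B W ⊗ N)) (F.strTriv W N r)) := by
  induction r with
  | zero => simp
  | add x y hx hy => simp only [TensorProduct.tmul_add, map_add, hx, hy]
  | tmul w x =>
    rw [TensorProduct.assoc_symm_tmul, strTriv_tmul, strTriv_tmul, ← mapLin_comp, ← mapLin_comp,
      insertVec_insertVec]

/-- The action map `B ⊗ F(B) → F(B ⊗ B) → F(B)` as a morphism of comodules. -/
noncomputable def actHom : regular k B ⊗ F.functor.obj (regular k B) ⟶
    F.functor.obj (regular k B) :=
  F.str (regular k B) (regular k B) ≫ F.functor.map (mulHom k B)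

theorem evalAct_one (x : F.valB) : evalAct F 1 x = x := by
  have h1 : F.strMap (regular k B) (regular k B) ((1 : B) ⊗ₜ[k] x) =
      F.mapLin ((λ_ (regular k B)).inv ≫ oneHom k B ▷ regular k B) x := by
    have h2 : F.mapLin (λ_ (regular k B)).hom
        (F.strMap (𝟙_ _) (regular k B) ((1 : k) ⊗ₜ x)) = x :=
      (F.strMap_unit (regular k B) 1 x).trans (one_smul k x)
    have h3 := F.strMap_left (oneHom k B) (regular k B) ((1 : k) ⊗ₜ[k] x)
    have h4 : F.mapLin (λ_ (regular k B)).inv x =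
        F.strMap (𝟙_ _) (regular k B) ((1 : k) ⊗ₜ x) := by
      refine (congrArg _ h2.symm).trans ?_
      rw [← mapLin_comp, Iso.hom_inv_id, mapLin_id]
    rw [mapLin_comp, h4, ← h3]
    exact congrArg (fun c : B => F.strMap (regular k B) (regular k B) (c ⊗ₜ[k] x))
      (one_smul k (1 : B)).symm
  refine (congrArg (F.mapLin (mulHom k B)) h1).trans ?_
  rw [← mapLin_comp, Category.assoc, oneHom_mulHom, mapLin_id]

theorem evalAct_mul (b c : B) (x : F.valB) :
    evalAct F (b * c) x = evalAct F b (evalAct F c x) := by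
  have h1 := F.strMap_left (mulHom k B) (regular k B) ((b ⊗ₜ[k] c : B ⊗[k] B) ⊗ₜ[k] x)
  have h2 := F.strMap_right (regular k B) (mulHom k B)
    (b ⊗ₜ[k] F.strMap (regular k B) (regular k B) (c ⊗ₜ[k] x))
  refine (congrArg (F.mapLin (mulHom k B)) h1).trans (Eq.trans ?_
    (congrArg (F.mapLin (mulHom k B)) h2).symm)
  rw [← mapLin_comp, ← mapLin_comp, mulHom_assoc, mapLin_comp]
  exact congrArg (F.mapLin (regular k B ◁ mulHom k B ≫ mulHom k B))
    (F.strMap_assoc (regular k B) (regular k B) (regular k B) b c x)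

/-- The action `evalAct` of `B` on `F(B)`, as an algebra homomorphism. -/
noncomputable def actB : B →ₐ[k] Module.End k F.valB :=
  AlgHom.ofLinearMap (TensorProduct.curry F.actHom.toLin)
    (LinearMap.ext fun x => F.evalAct_one x)
    (fun b c => LinearMap.ext fun x => F.evalAct_mul b c x)

/-- The multiplication `(m ⊗ b) ⊗ (n ⊗ c) ↦ (m ⊗ n) ⊗ b c` turns the structure morphism into the
action of `B` on `F(B)`. -/
theorem mapLin_mulRightHom {M N : Type u} [AddCommGroup M] [Module k M] [AddCommGroup N]
    [Module k N] (r : M ⊗[k] B) (s : N ⊗[k] F.valB) :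
    F.mapLin (mulRightHom M N) (F.strMap (triv k B M ⊗ regular k B) (triv k B N ⊗ regular k B)
      (r ⊗ₜ F.strTriv N (regular k B) s)) =
    F.strTriv (M ⊗[k] N) (regular k B) ((TensorProduct.lift F.actB.toLinearMap).lTensor (M ⊗[k] N)
      (TensorProduct.tensorTensorTensorComm k M B N F.valB (r ⊗ₜ s))) := by
  let Φ : (M ⊗[k] B) ⊗[k] (N ⊗[k] F.valB) →ₗ[k]
      (F.functor.obj (triv k B (M ⊗[k] N) ⊗ regular k B)).carrier :=
    F.mapLin (mulRightHom M N) ∘ₗ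
      F.strMap (triv k B M ⊗ regular k B) (triv k B N ⊗ regular k B) ∘ₗ
        (F.strTriv N (regular k B)).lTensor (M ⊗[k] B)
  let Ψ : (M ⊗[k] B) ⊗[k] (N ⊗[k] F.valB) →ₗ[k]
      (F.functor.obj (triv k B (M ⊗[k] N) ⊗ regular k B)).carrier :=
    F.strTriv (M ⊗[k] N) (regular k B) ∘ₗ
      (TensorProduct.lift F.actB.toLinearMap).lTensor (M ⊗[k] N) ∘ₗ
        (TensorProduct.tensorTensorTensorComm k M B N F.valB).toLinearMap
  have key : Φ = Ψ := by
    refine TensorProduct.ext_fourfold' fun m b n x => ?_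
    have h1 := F.strMap_assoc_inv (triv k B M) (regular k B) (regular k B) m b x
    have h2 := F.strMap_right (triv k B M ⊗ regular k B) (insertVec n (regular k B))
      ((m ⊗ₜ[k] b : M ⊗[k] B) ⊗ₜ[k] x)
    have h3 := F.strTriv_tmul (regular k B ⊗ regular k B) m
      (F.strMap (regular k B) (regular k B) (b ⊗ₜ[k] x))
    have h4 : F.mapLin (mulHom k B ≫ insertVec (m ⊗ₜ[k] n) (regular k B))
        (F.strMap (regular k B) (regular k B) (b ⊗ₜ[k] x)) =
        F.strTriv (M ⊗[k] N) (regular k B) ((m ⊗ₜ[k] n) ⊗ₜ[k] F.actB b x) := by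
      rw [mapLin_comp, strTriv_tmul]
      rfl
    change F.mapLin (mulRightHom M N) (F.strMap (triv k B M ⊗ regular k B)
      (triv k B N ⊗ regular k B) ((m ⊗ₜ[k] b) ⊗ₜ[k] F.strTriv N (regular k B) (n ⊗ₜ[k] x))) =
      F.strTriv (M ⊗[k] N) (regular k B) ((m ⊗ₜ[k] n) ⊗ₜ[k] F.actB b x)
    rw [strTriv_tmul]
    refine Eq.trans ?_ h4
    rw [← insertVec_mulRightHom, mapLin_comp, mapLin_comp, mapLin_comp, ← h3]
    exact congrArg (F.mapLin (mulRightHom M N)) (h2.trans (congrArg _ h1.symm))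
  exact LinearMap.congr_fun key (r ⊗ₜ[k] s)

end

variable {F : LaxModEnd (LeftComodule k B)} (hF : IsLexFinitary F)

/-- The morphism `F(M) → F(M ⊗ B) ≅ M ⊗ F(B)`, where `M` on the right hand side carries the
trivial coaction. -/
noncomputable def coordHom (M : LeftComodule k B) :
    F.functor.obj M ⟶ triv k B M.carrier ⊗ F.functor.obj (regular k B) :=
  F.functor.map (spread M) ≫ (isoOfBijective (F.str (triv k B M.carrier) (regular k B))
    (strTriv_bijective hF M.carrier (regular k B))).inv

/-- The linear map `F(M) → F(B) ⊗ M` underlying `coordHom`, with the factors exchanged. -/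
noncomputable def coord (M : LeftComodule k B) :
    (F.functor.obj M).carrier →ₗ[k] F.valB ⊗[k] M.carrier :=
  (TensorProduct.comm k M.carrier F.valB).toLinearMap ∘ₗ (coordHom hF M).toLin

theorem comm_coord (M : LeftComodule k B) (y : (F.functor.obj M).carrier) :
    TensorProduct.comm k F.valB M.carrier (coord hF M y) = (coordHom hF M).toLin y :=
  (TensorProduct.comm k M.carrier F.valB).symm_apply_apply _

theorem strTriv_coord (M : LeftComodule k B) (y : (F.functor.obj M).carrier) :
    F.strTriv M.carrier (regular k B) (TensorProduct.comm k F.valB M.carrier (coord hF M y)) =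
      F.mapLin (spread M) y := by
  rw [comm_coord]
  have h : coordHom hF M ≫ F.str (triv k B M.carrier) (regular k B) = F.functor.map (spread M) := by
    rw [coordHom, Category.assoc]
    exact (congrArg (F.functor.map (spread M) ≫ ·) (isoOfBijective
      (F.str (triv k B M.carrier) (regular k B))
      (strTriv_bijective hF M.carrier (regular k B))).inv_hom_id).trans (Category.comp_id _)
  exact congr_hom h y

/-- The coordinates of `y` are characterised by their image in `F(M ⊗ B)`. -/
theorem coord_eq_of {M : LeftComodule k B} {y : (F.functor.obj M).carrier}
    {t : F.valB ⊗[k] M.carrier}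
    (h : F.strTriv M.carrier (regular k B) (TensorProduct.comm k F.valB M.carrier t) =
      F.mapLin (spread M) y) : coord hF M y = t := by
  apply (TensorProduct.comm k F.valB M.carrier).injective
  apply F.strTriv_injective M.carrier (regular k B)
  rw [strTriv_coord, h]

theorem coord_injective (M : LeftComodule k B) : Function.Injective (coord hF M) := by
  intro x y h
  have := hF.1
  refine LeftComodule.map_injective F.functor (spread M) (spread_injective M) ?_
  exact (strTriv_coord hF M x).symm.trans ((congrArg (fun t => F.strTriv M.carrier (regular k B)
    (TensorProduct.comm k F.valB M.carrier t)) h).trans (strTriv_coord hF M y))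

theorem coord_naturality {M N : LeftComodule k B} (f : M ⟶ N) (y : (F.functor.obj M).carrier) :
    coord hF N (F.mapLin f y) = f.toLin.lTensor F.valB (coord hF M y) := by
  apply coord_eq_of
  have h : ∀ t : F.valB ⊗[k] M.carrier, TensorProduct.comm k F.valB N.carrier
      (f.toLin.lTensor F.valB t) =
      f.toLin.rTensor F.valB (TensorProduct.comm k F.valB M.carrier t) := by
    intro t
    induction t with
    | zero => simp
    | add x y hx hy => simp only [map_add, hx, hy]
    | tmul x m => simp
  rw [h, strTriv_left, strTriv_coord, ← mapLin_comp, ← mapLin_comp, spread_naturality]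

theorem coord_coact (M : LeftComodule k B) (y : (F.functor.obj M).carrier) :
    outerL (F.functor.obj (regular k B)).coact M.carrier (coord hF M y) =
      (coord hF M).lTensor B ((F.functor.obj M).coact y) := by
  have h := (coordHom hF M).comm y
  refine (outerL_comm (F.functor.obj (regular k B)).coact ((coordHom hF M).toLin y)).trans ?_
  exact (congrArg ((TensorProduct.comm k M.carrier F.valB).toLinearMap.lTensor B) h).trans
    (LinearMap.lTensor_comp_apply B _ (coordHom hF M).toLin ((F.functor.obj M).coact y)).symm

/-- The right coaction on `F(B)`. -/
noncomputable def rho : F.valB →ₗ[k] F.valB ⊗[k] B := coord hF (regular k B)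

/-- Contracting the right coaction with a functional `φ` gives the value of `F` at
`b ↦ b₁ φ(b₂)`. -/
theorem contract_rho (φ : B →ₗ[k] k) (x : F.valB) :
    contract (rho hF) φ x = F.mapLin (translate φ) x := by
  have h : ∀ s : F.valB ⊗[k] B, TensorProduct.rid k F.valB (φ.lTensor F.valB s) =
      F.mapLin (evaluate φ (regular k B))
        (F.strTriv B (regular k B) (TensorProduct.comm k F.valB B s)) := by
    intro s
    rw [mapLin_evaluate_strTriv]
    induction s with
    | zero => simp
    | add x y hx hy => simp only [map_add, hx, hy]
    | tmul x b => simp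
  refine (h (rho hF x)).trans ((congrArg _ (strTriv_coord hF (regular k B) x)).trans ?_)
  exact (F.mapLin_comp _ _ x).symm.trans (congrArg (fun f => F.mapLin f x) (spread_evaluate φ))

/-- Under `M ⊗ F(B) ≅ F(M ⊗ B)`, the second morphism of the equaliser of `M` is the right coaction
of `F(B)`. -/
theorem strTriv_assoc_rho (M : LeftComodule k B) (s : M.carrier ⊗[k] F.valB) :
    F.strTriv (M.carrier ⊗[k] B) (regular k B) ((TensorProduct.assoc k M.carrier B F.valB).symm
      (((TensorProduct.comm k F.valB B).toLinearMap ∘ₗ rho hF).lTensor M.carrier s)) =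
    F.mapLin (spreadSnd M) (F.strTriv M.carrier (regular k B) s) := by
  induction s with
  | zero => simp
  | add x y hx hy => simp only [map_add, hx, hy]
  | tmul m x =>
    let z : (F.functor.obj (triv k B B ⊗ regular k B)).carrier :=
      F.strTriv B (regular k B) (TensorProduct.comm k F.valB B (rho hF x))
    have hz : F.mapLin (spread (regular k B)) x = z := (strTriv_coord hF (regular k B) x).symm
    have h1 : F.mapLin (spreadSnd M) (F.strTriv M.carrier (regular k B) (m ⊗ₜ x)) =
        F.mapLin (trivAssoc M.carrier B (regular k B)) (F.strTriv M.carrier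
          (triv k B B ⊗ regular k B) (m ⊗ₜ z)) :=
      (F.mapLin_comp _ _ _).trans (congrArg (F.mapLin (trivAssoc M.carrier B (regular k B)))
        ((F.strTriv_right (spread (regular k B)) (m ⊗ₜ[k] x)).symm.trans
          (congrArg (fun z => F.strTriv M.carrier (triv k B B ⊗ regular k B) (m ⊗ₜ[k] z)) hz)))
    rw [h1, strTriv_tmul, LinearMap.lTensor_tmul, strTriv_assoc_tmul]
    rfl

/-- The map `coord` identifies `F(M)` with the cotensor product of `F(B)` and `M`: `F` preserves
the equaliser `M → M ⊗ B ⇉ (M ⊗ B) ⊗ B`. -/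
theorem mem_range_coord (M : LeftComodule k B) (t : F.valB ⊗[k] M.carrier) :
    t ∈ LinearMap.range (coord hF M) ↔ t ∈ cotensor (rho hF) M.coact := by
  have key : t ∈ cotensor (rho hF) M.coact ↔
      F.mapLin (spreadFst M) (F.strTriv M.carrier (regular k B)
        (TensorProduct.comm k F.valB M.carrier t)) =
      F.mapLin (spreadSnd M) (F.strTriv M.carrier (regular k B)
        (TensorProduct.comm k F.valB M.carrier t)) := by
    rw [mem_cotensor_iff_comm, ← (F.strTriv_injective (M.carrier ⊗[k] B) (regular k B)).eq_iff,
      strTriv_assoc_rho, strTriv_left]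
    rfl
  rw [key]
  constructor
  · rintro ⟨y, rfl⟩
    rw [strTriv_coord, ← mapLin_comp, ← mapLin_comp, spread_condition]
  · intro h
    have := hF.1
    obtain ⟨y, hy⟩ := map_exact F.functor (spread M) (spread_condition M) (spread_injective M)
      (spread_exact M) _ h
    exact ⟨y, coord_eq_of hF hy.symm⟩

/-- In coordinates, the structure morphism `M ⊗ F(N) → F(M ⊗ N)` is the interchange map. -/
theorem coord_strMap (M N : LeftComodule k B) (t : M.carrier ⊗[k] (F.functor.obj N).carrier) :
    coord hF (M ⊗ N) (F.strMap M N t) =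
      interchange M.coact F.actB N.carrier ((coord hF N).lTensor M.carrier t) := by
  let Φ : M.carrier ⊗[k] (F.functor.obj N).carrier →ₗ[k] F.valB ⊗[k] (M.carrier ⊗[k] N.carrier) :=
    coord hF (M ⊗ N) ∘ₗ F.strMap M N
  let Ψ : M.carrier ⊗[k] (F.functor.obj N).carrier →ₗ[k] F.valB ⊗[k] (M.carrier ⊗[k] N.carrier) :=
    interchange M.coact F.actB N.carrier ∘ₗ (coord hF N).lTensor M.carrier
  have key : Φ = Ψ := by
    refine TensorProduct.ext' fun m y => ?_
    refine coord_eq_of hF (M := M ⊗ N) ?_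
    have h1 := comm_interchange M.coact F.actB m (coord hF N y)
    have h2 := F.strMap_right M (spread N) (m ⊗ₜ[k] y)
    have h3 := F.strMap_left (spread M) (triv k B N.carrier ⊗ regular k B)
      (m ⊗ₜ[k] F.mapLin (spread N) y)
    have h4 := F.mapLin_mulRightHom (TensorProduct.comm k B M.carrier (M.coact m))
      (TensorProduct.comm k F.valB N.carrier (coord hF N y))
    rw [strTriv_coord] at h4
    refine (congrArg (F.strTriv (M.carrier ⊗[k] N.carrier) (regular k B)) h1).trans ?_
    have h5 : F.mapLin (spread (M ⊗ N)) (F.strMap M N (m ⊗ₜ y)) =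
        F.mapLin (mulRightHom M.carrier N.carrier) (F.mapLin (spread M ▷ _)
          (F.mapLin (M ◁ spread N) (F.strMap M N (m ⊗ₜ y)))) := by
      refine (congrArg (fun f => F.mapLin f (F.strMap M N (m ⊗ₜ y))) (spread_tensor M N)).trans ?_
      exact (F.mapLin_comp _ _ _).trans (F.mapLin_comp _ _ _)
    refine (h4.symm.trans (congrArg (F.mapLin (mulRightHom M.carrier N.carrier)) ?_)).trans h5.symm
    exact h3.trans (congrArg (F.mapLin (spread M ▷ _)) h2)
  exact LinearMap.congr_fun key t

/-- The Hopf trimodule structure on `F(B)`. -/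
noncomputable def trimodule : HopfTrimodule k B where
  carrier := F.valB
  lcoact := (F.functor.obj (regular k B)).coact
  rcoact := rho hF
  act := F.actB
  isLeftCoaction := (F.functor.obj (regular k B)).isLeftCoaction
  isRightCoaction :=
    { coassoc := fun x => (mem_range_coord hF (regular k B) (rho hF x)).1 ⟨x, rfl⟩
      counit := fun x => by
        refine (contract_rho hF Coalgebra.counit x).trans ?_
        have h : LeftComodule.translate (Coalgebra.counit (R := k) (A := B)) = 𝟙 (regular k B) :=
          LeftComodule.hom_ext (LinearMap.ext fun (b : B) => by
            change TensorProduct.rid k B ((Coalgebra.counit (R := k) (A := B)).lTensor B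
              (Coalgebra.comul b)) = b
            simp)
        rw [h, mapLin_id] }
  bicomodule x := coord_coact hF (regular k B) x
  lcoact_act b x := (F.actHom.comm (b ⊗ₜ[k] x)).trans
    (lTensor_act_tensorCoact F.actB F.actHom.toLin (fun _ _ => rfl)
      (F.functor.obj (regular k B)).coact b x)
  rcoact_act b x := by
    have h := coord_strMap hF (regular k B) (regular k B) (b ⊗ₜ[k] x)
    refine (coord_naturality hF (mulHom k B) _).trans ?_
    refine (congrArg ((LinearMap.mul' k B).lTensor F.valB) h).trans ?_
    exact lTensor_mul_interchange F.actB b (rho hF x)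

/-- The coordinates as a morphism into the comodule `F(B) ⊗ M`. -/
noncomputable def coordOuter (M : LeftComodule k B) :
    F.functor.obj M ⟶ HopfTrimodule.outerC (trimodule hF) M where
  toLin := coord hF M
  comm := coord_coact hF M

/-- The comparison morphism `F(M) → F(B) □ M`. -/
noncomputable def comparison (M : LeftComodule k B) :
    F.functor.obj M ⟶ HopfTrimodule.cotensC (trimodule hF) M :=
  LeftComodule.lift (HopfTrimodule.inclC (trimodule hF) M) (HopfTrimodule.inclC_injective _ _)
    (coordOuter hF M)
    (fun y => HopfTrimodule.mem_range_inclC.2 ((mem_range_coord hF M _).1 ⟨y, rfl⟩))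

theorem comparison_inclC (M : LeftComodule k B) :
    comparison hF M ≫ HopfTrimodule.inclC (trimodule hF) M = coordOuter hF M :=
  LeftComodule.lift_comp _ _ _ _

theorem comparison_bijective (M : LeftComodule k B) :
    Function.Bijective (comparison hF M).toLin := by
  have h := fun p => congr_hom (comparison_inclC hF M) p
  constructor
  · intro p q hpq
    exact coord_injective hF M ((h p).symm.trans ((congrArg
      (HopfTrimodule.inclC (trimodule hF) M).toLin hpq).trans (h q)))
  · intro q
    have hq : (HopfTrimodule.inclC (trimodule hF) M).toLin q ∈ cotensor (rho hF) M.coact := q.2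
    obtain ⟨p, hp⟩ := (mem_range_coord hF M _).2 hq
    exact ⟨p, HopfTrimodule.inclC_injective _ _ ((h p).trans hp)⟩

/-- A left exact finitary lax module functor is the cotensor product with its value at `B`. -/
noncomputable def comparisonIso : F ≅ HopfTrimodule.laxFunctor (trimodule hF) :=
  LaxModEnd.isoMk (NatIso.ofComponents (F := F.functor)
      (G := (HopfTrimodule.laxFunctor (trimodule hF)).functor)
      (fun M => isoOfBijective (comparison hF M) (comparison_bijective hF M))
      (fun {M N} f => by
        change F.functor.map f ≫ comparison hF N =
          comparison hF M ≫ HopfTrimodule.cotensCMap (𝟙 (trimodule hF)) f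
        refine LeftComodule.cancel (HopfTrimodule.inclC_injective _ _) ?_
        rw [Category.assoc, comparison_inclC, Category.assoc, HopfTrimodule.cotensCMap_inclC,
          ← Category.assoc, comparison_inclC]
        exact LeftComodule.hom_ext (LinearMap.ext fun y => coord_naturality hF f y)))
    (fun M N => by
      change F.str M N ≫ comparison hF (M ⊗ N) =
        M ◁ comparison hF N ≫ HopfTrimodule.chi (trimodule hF) M N
      refine LeftComodule.cancel (HopfTrimodule.inclC_injective _ _) ?_
      rw [Category.assoc, comparison_inclC, Category.assoc, HopfTrimodule.chi_inclC,
        ← MonoidalCategory.whiskerLeft_comp_assoc, comparison_inclC]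
      exact LeftComodule.hom_ext (LinearMap.ext fun t => coord_strMap hF M N t))

end LaxModEnd

end HopfTri

/-! ### The equivalence -/

namespace HopfTri

/-- The right coaction intertwines contraction with `φ` on `X` and `b ↦ b₁ φ(b₂)` on `B`. -/
theorem rcoact_contract {k B X : Type u} [Field k] [Ring B] [Bialgebra k B]
    [AddCommGroup X] [Module k X] {ρ : X →ₗ[k] X ⊗[k] B} (hρ : IsRightCoaction ρ)
    (φ : B →ₗ[k] k) (x : X) :
    ρ (contract ρ φ x) = (contract (Coalgebra.comul (R := k) (A := B)) φ).lTensor X (ρ x) := by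
  have h : ∀ s : X ⊗[k] B, ρ (TensorProduct.rid k X (φ.lTensor X s)) =
      ((TensorProduct.rid k B).toLinearMap ∘ₗ φ.lTensor B).lTensor X
        (TensorProduct.assoc k X B B (ρ.rTensor B s)) := by
    intro s
    induction s with
    | zero => simp
    | add x y hx hy => simp only [map_add, hx, hy]
    | tmul x b =>
      simp only [LinearMap.lTensor_tmul, TensorProduct.rid_tmul, map_smul, LinearMap.rTensor_tmul]
      generalize ρ x = r
      induction r with
      | zero => simp
      | add x y hx hy => simp only [TensorProduct.add_tmul, smul_add, map_add, hx, hy]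
      | tmul x c => simp
  refine (h (ρ x)).trans ?_
  rw [hρ.coassoc, ← LinearMap.lTensor_comp_apply]
  rfl

theorem rid_lTensor_rTensor {k B X Y : Type u} [Field k] [AddCommGroup B] [Module k B]
    [AddCommGroup X] [Module k X] [AddCommGroup Y] [Module k Y] (φ : B →ₗ[k] k) (f : X →ₗ[k] Y)
    (s : X ⊗[k] B) : TensorProduct.rid k Y (φ.lTensor Y (f.rTensor B s)) =
      f (TensorProduct.rid k X (φ.lTensor X s)) := by
  induction s with
  | zero => simp
  | add x y hx hy => simp only [map_add, hx, hy]
  | tmul x b => simp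

namespace LaxModEnd

open MonoidalCategory LeftComodule

variable {k B : Type u} [Field k] [Ring B] [Bialgebra k B]
variable {F G : LaxModEnd (LeftComodule k B)}

theorem app_mapLin (α : F ⟶ G) {M N : LeftComodule k B} (f : M ⟶ N)
    (y : (F.functor.obj M).carrier) :
    (α.nat.app N).toLin (F.mapLin f y) = G.mapLin f ((α.nat.app M).toLin y) :=
  congr_hom (α.nat.naturality f) y

theorem app_strMap (α : F ⟶ G) (M N : LeftComodule k B)
    (t : M.carrier ⊗[k] (F.functor.obj N).carrier) :
    (α.nat.app (M ⊗ N)).toLin (F.strMap M N t) =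
      G.strMap M N ((α.nat.app N).toLin.lTensor M.carrier t) :=
  congr_hom (α.comm M N) t

theorem app_evalAct (α : F ⟶ G) (b : B) (x : F.valB) :
    (α.nat.app (regular k B)).toLin (evalAct F b x) =
      evalAct G b ((α.nat.app (regular k B)).toLin x) :=
  (app_mapLin α (mulHom k B) _).trans
    (congrArg (G.mapLin (mulHom k B)) (app_strMap α (regular k B) (regular k B) (b ⊗ₜ[k] x)))

theorem coord_app (hF : IsLexFinitary F) (hG : IsLexFinitary G) (α : F ⟶ G)
    (M : LeftComodule k B) (y : (F.functor.obj M).carrier) :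
    coord hG M ((α.nat.app M).toLin y) =
      (α.nat.app (regular k B)).toLin.rTensor M.carrier (coord hF M y) := by
  apply coord_eq_of
  have h : ∀ t : F.valB ⊗[k] M.carrier, TensorProduct.comm k G.valB M.carrier
      ((α.nat.app (regular k B)).toLin.rTensor M.carrier t) =
      (α.nat.app (regular k B)).toLin.lTensor M.carrier
        (TensorProduct.comm k F.valB M.carrier t) := by
    intro t
    induction t with
    | zero => simp
    | add x y hx hy => simp only [map_add, hx, hy]
    | tmul x m => simp
  rw [h, ← app_mapLin, ← strTriv_coord hF]
  exact (app_strMap α (triv k B M.carrier) (regular k B) _).symm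

/-- Module transformations between left exact finitary lax module functors are determined by
their component at `B`. -/
theorem hom_ext_valB (hF : IsLexFinitary F) (hG : IsLexFinitary G) {α β : F ⟶ G}
    (h : α.nat.app (regular k B) = β.nat.app (regular k B)) : α = β :=
  LaxModEnd.hom_ext_app fun M => LeftComodule.hom_ext (LinearMap.ext fun y =>
    coord_injective hG M (by rw [coord_app hF, coord_app hF, h]))

end LaxModEnd

namespace HopfTrimodule

open MonoidalCategory LeftComodule

variable {k B : Type u} [Field k] [Ring B] [Bialgebra k B]

/-- The right coaction as a morphism of left comodules `X → X ⊗ B`. -/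
noncomputable def rcoactOuter (X : HopfTrimodule k B) :
    X.toLeftComodule ⟶ outerC X (regular k B) where
  toLin := X.rcoact
  comm := X.bicomodule

/-- The right coaction as a morphism of left comodules `X → X □ B`. -/
noncomputable def rcoactC (X : HopfTrimodule k B) :
    X.toLeftComodule ⟶ cotensC X (regular k B) :=
  LeftComodule.lift (inclC X (regular k B)) (inclC_injective _ _) (rcoactOuter X)
    (fun x => mem_range_inclC.2 (rcoact_mem_cotensor X.isRightCoaction x))

theorem rcoactC_inclC (X : HopfTrimodule k B) : rcoactC X ≫ inclC X (regular k B) =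
    rcoactOuter X := LeftComodule.lift_comp _ _ _ _

theorem inclC_rcoactC (X : HopfTrimodule k B) (x : X.carrier) :
    (inclC X (regular k B)).toLin ((rcoactC X).toLin x) = X.rcoact x :=
  congr_hom (rcoactC_inclC X) x

theorem rcoactC_bijective (X : HopfTrimodule k B) : Function.Bijective (rcoactC X).toLin := by
  constructor
  · intro p q hpq
    have : X.rcoact p = X.rcoact q :=
      (inclC_rcoactC X p).symm.trans ((congrArg (inclC X (regular k B)).toLin hpq).trans
        (inclC_rcoactC X q))
    exact (X.isRightCoaction.counit p).symm.trans ((congrArg (fun r => TensorProduct.rid k X.carrier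
      ((Coalgebra.counit (R := k) (A := B)).lTensor X.carrier r)) this).trans
        (X.isRightCoaction.counit q))
  · intro q
    exact ⟨_, inclC_injective _ _ ((inclC_rcoactC X _).trans
      (rcoact_counit (k := k) (B := B) (ρ := X.rcoact) q.2))⟩

/-- The isomorphism `X ≅ X □ B` of left comodules. -/
noncomputable def rcoactIso (X : HopfTrimodule k B) :
    X.toLeftComodule ≅ cotensC X (regular k B) :=
  isoOfBijective (rcoactC X) (rcoactC_bijective X)

/-- The morphism of left comodules underlying a morphism of Hopf trimodules. -/
def toComoduleHom {X Y : HopfTrimodule k B} (f : X ⟶ Y) : X.toLeftComodule ⟶ Y.toLeftComodule :=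
  ⟨f.toLin, f.lcomm⟩

/-- The component at `B` of a module transformation `X □ - → Y □ -`. -/
noncomputable def appB {X Y : HopfTrimodule k B} (α : laxFunctor X ⟶ laxFunctor Y) :
    cotensC X (regular k B) ⟶ cotensC Y (regular k B) := α.nat.app (regular k B)

theorem rcoactC_naturality {X Y : HopfTrimodule k B} (f : X ⟶ Y) :
    toComoduleHom f ≫ rcoactC Y = rcoactC X ≫ cotensCMap f (𝟙 (regular k B)) :=
  LeftComodule.cancel (inclC_injective _ _) (by
    rw [Category.assoc, rcoactC_inclC, Category.assoc, cotensCMap_inclC, ← Category.assoc,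
      rcoactC_inclC]
    exact LeftComodule.hom_ext (LinearMap.ext f.rcomm))

theorem rcoactC_act (X : HopfTrimodule k B) (b : B) (x : X.carrier) :
    (rcoactC X).toLin (X.act b x) = evalAct (laxFunctor X) b ((rcoactC X).toLin x) := by
  apply inclC_injective
  have h1 := congr_hom (cotensCMap_inclC (𝟙 X) (mulHom k B))
    ((chi X (regular k B) (regular k B)).toLin (b ⊗ₜ[k] (rcoactC X).toLin x))
  have h2 := congr_hom (chi_inclC X (regular k B) (regular k B)) (b ⊗ₜ[k] (rcoactC X).toLin x)
  have h3 : interchange (Coalgebra.comul (R := k) (A := B)) X.act B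
      (b ⊗ₜ[k] (inclC X (regular k B)).toLin ((rcoactC X).toLin x)) =
      interchange (Coalgebra.comul (R := k) (A := B)) X.act B (b ⊗ₜ[k] X.rcoact x) := by
    rw [inclC_rcoactC]
  rw [inclC_rcoactC, X.rcoact_act, ← lTensor_mul_interchange]
  exact ((h1.trans (congrArg ((LinearMap.mul' k B).lTensor X.carrier) (h2.trans h3)))).symm

theorem rcoactC_contract (X : HopfTrimodule k B) (φ : B →ₗ[k] k) (x : X.carrier) :
    (rcoactC X).toLin (contract X.rcoact φ x) =
      (laxFunctor X).mapLin (LeftComodule.translate φ) ((rcoactC X).toLin x) := by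
  apply inclC_injective
  have h1 := congr_hom (cotensCMap_inclC (𝟙 X) (LeftComodule.translate φ)) ((rcoactC X).toLin x)
  rw [inclC_rcoactC, rcoact_contract X.isRightCoaction]
  exact (h1.trans (congrArg ((contract (Coalgebra.comul (R := k) (A := B)) φ).lTensor X.carrier)
    (inclC_rcoactC X x))).symm

/-- The morphism of trimodules underlying a module transformation `X □ - → Y □ -`. -/
noncomputable def preimage {X Y : HopfTrimodule k B} (α : laxFunctor X ⟶ laxFunctor Y) : X ⟶ Y :=
  let f : X.toLeftComodule ⟶ Y.toLeftComodule :=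
    rcoactC X ≫ appB α ≫ (rcoactIso Y).inv
  have hf : ∀ x : X.carrier, (rcoactC Y).toLin (f.toLin x) =
      (α.nat.app (regular k B)).toLin ((rcoactC X).toLin x) := fun x =>
    congr_hom (rcoactIso Y).inv_hom_id _
  { toLin := f.toLin
    lcomm := f.comm
    rcomm := fun x => eq_of_lTensor_functional fun φ => by
      refine Eq.trans ?_ (rid_lTensor_rTensor φ (X := X.carrier) (Y := Y.carrier) f.toLin
        (X.rcoact x)).symm
      apply (rcoactC_bijective Y).1
      refine (rcoactC_contract Y φ (f.toLin x)).trans ?_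
      rw [hf]
      refine (LaxModEnd.app_mapLin α (LeftComodule.translate φ) _).symm.trans ?_
      exact ((hf _).trans (congrArg _ (rcoactC_contract X φ x))).symm
    acomm := fun b x => (rcoactC_bijective Y).1 (by
      refine (hf _).trans ?_
      refine (congrArg _ (rcoactC_act X b x)).trans ?_
      refine (LaxModEnd.app_evalAct α b _).trans ?_
      exact (congrArg (evalAct (laxFunctor Y) b) (hf x).symm).trans
        (rcoactC_act Y b (f.toLin x)).symm) }

theorem rcoactC_preimage {X Y : HopfTrimodule k B} (α : laxFunctor X ⟶ laxFunctor Y) :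
    toComoduleHom (preimage α) ≫ rcoactC Y = rcoactC X ≫ appB α := by
  have h : toComoduleHom (preimage α) = rcoactC X ≫ appB α ≫ (rcoactIso Y).inv := rfl
  have h' : (rcoactIso Y).inv ≫ rcoactC Y = 𝟙 _ := (rcoactIso Y).inv_hom_id
  rw [h, Category.assoc, Category.assoc, h', Category.comp_id]

theorem cotensCMap_preimage {X Y : HopfTrimodule k B} (α : laxFunctor X ⟶ laxFunctor Y) :
    cotensCMap (preimage α) (𝟙 (regular k B)) = appB α := by
  have h : rcoactC X ≫ cotensCMap (preimage α) (𝟙 (regular k B)) = rcoactC X ≫ appB α := by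
    rw [← rcoactC_naturality, rcoactC_preimage]
  exact (cancel_epi (rcoactIso X).hom).1 h

/-- A morphism of trimodules is determined by its value on `X ≅ X □ B`. -/
instance : (sigma k B).Faithful where
  map_injective {X Y} f g h := by
    have h1 : cotensCMap f (𝟙 (regular k B)) = cotensCMap g (𝟙 (regular k B)) :=
      congrArg (fun α : laxFunctor X ⟶ laxFunctor Y => appB α) h
    have h2 : toComoduleHom f ≫ rcoactC Y = toComoduleHom g ≫ rcoactC Y := by
      rw [rcoactC_naturality, rcoactC_naturality, h1]
    exact HopfTrimodule.hom_ext
      (congrArg LeftComodule.Hom.toLin (LeftComodule.cancel (rcoactC_bijective Y).1 h2))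

/-- A module transformation agrees at `B`, hence everywhere, with the one induced by its
`preimage`. -/
instance : (sigma k B).Full where
  map_surjective {X Y} α := ⟨preimage α,
    LaxModEnd.hom_ext_valB (sigma_isLexFinitary X) (sigma_isLexFinitary Y)
      (cotensCMap_preimage α)⟩

theorem sigma_isEquivalence (h : ∀ X, LaxModEnd.IsLexFinitary ((sigma k B).obj X)) :
    (LaxModEnd.IsLexFinitary.lift (sigma k B) h).IsEquivalence where
  full := inferInstance
  faithful := inferInstance
  essSurj := ⟨fun F => ⟨LaxModEnd.trimodule F.property,
    ⟨ObjectProperty.isoMk _ (LaxModEnd.comparisonIso F.property).symm⟩⟩⟩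

/-- The morphism `X → X □ B → F(B)` induced by a module transformation `X □ - → F`. -/
noncomputable def evalHom {X : HopfTrimodule k B} {F : LaxModEnd (LeftComodule k B)}
    (α : laxFunctor X ⟶ F) : X.toLeftComodule ⟶ F.functor.obj (regular k B) :=
  rcoactC X ≫ α.nat.app (regular k B)

theorem evalHom_act {X : HopfTrimodule k B} {F : LaxModEnd (LeftComodule k B)}
    (α : laxFunctor X ⟶ F) (b : B) (x : X.carrier) :
    (evalHom α).toLin (X.act b x) = evalAct F b ((evalHom α).toLin x) :=
  (congrArg _ (rcoactC_act X b x)).trans (LaxModEnd.app_evalAct α b _)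

theorem evalHom_contract {X : HopfTrimodule k B} {F : LaxModEnd (LeftComodule k B)}
    (α : laxFunctor X ⟶ F) (φ : B →ₗ[k] k) (x : X.carrier) :
    (evalHom α).toLin (contract X.rcoact φ x) =
      (F.functor.map (LeftComodule.translate φ)).toLin ((evalHom α).toLin x) :=
  (congrArg _ (rcoactC_contract X φ x)).trans
    (LaxModEnd.app_mapLin α (LeftComodule.translate φ) _)

theorem evalHom_naturality {X Y : HopfTrimodule k B} {F G : LaxModEnd (LeftComodule k B)}
    (α : laxFunctor X ⟶ F) (β : laxFunctor Y ⟶ G) (f : X ⟶ Y) (g : F ⟶ G)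
    (h : cotensCMap f (𝟙 (regular k B)) ≫ β.nat.app (regular k B) =
      (α ≫ g).nat.app (regular k B)) :
    toComoduleHom f ≫ evalHom β = evalHom α ≫ g.nat.app (regular k B) := by
  have h1 : toComoduleHom f ≫ evalHom β =
      (toComoduleHom f ≫ rcoactC Y) ≫ β.nat.app (regular k B) := (Category.assoc _ _ _).symm
  rw [h1, rcoactC_naturality]
  exact (Category.assoc _ _ _).trans ((congrArg (rcoactC X ≫ ·) h).trans
    (Category.assoc _ _ _).symm)

end HopfTrimodule

end HopfTri

theorem theorem9p2 (k B : Type u) [Field k] [Ring B] [Bialgebra k B] :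
    -- every `(X □ -, χ)` is left exact and finitary, and with the resulting functor `Σ`:
    ∃ h : ∀ X : HopfTri.HopfTrimodule k B,
      HopfTri.LaxModEnd.IsLexFinitary ((HopfTri.HopfTrimodule.sigma k B).obj X),
    -- `Σ` is strong monoidal, through `x ⊗ (y ⊗ n) ↦ (x ⊗ y) ⊗ n` and `n ↦ n₋₁ ⊗ n₀`,
    (∃ _ : (HopfTri.LaxModEnd.IsLexFinitary.lift (HopfTri.HopfTrimodule.sigma k B) h).Monoidal,
      (∀ (X Y : HopfTri.HopfTrimodule k B) (N : HopfTri.LeftComodule k B)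
        (t : (HopfTri.HopfTrimodule.cotensC X (HopfTri.HopfTrimodule.cotensC Y N)).carrier),
        TensorProduct.assoc k X.carrier Y.carrier N.carrier
          (HopfTri.nestR X Y N (((Functor.LaxMonoidal.μ
            (HopfTri.LaxModEnd.IsLexFinitary.lift (HopfTri.HopfTrimodule.sigma k B) h)
              X Y).hom.nat.app N).toLin t)) = HopfTri.nestL X Y N t) ∧
      (∀ (N : HopfTri.LeftComodule k B) (n : N.carrier),
        (HopfTri.HopfTrimodule.inclC (HopfTri.HopfTrimodule.unit k B) N).toLin
          (((Functor.LaxMonoidal.ε (HopfTri.LaxModEnd.IsLexFinitary.lift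
            (HopfTri.HopfTrimodule.sigma k B) h)).hom.nat.app N).toLin n) = N.coact n)) ∧
    -- and `Σ` is an equivalence,
    ∃ e : HopfTri.HopfTrimodule k B ≌ HopfTri.LexLaxModEnd (HopfTri.LeftComodule k B),
      e.functor = HopfTri.LaxModEnd.IsLexFinitary.lift (HopfTri.HopfTrimodule.sigma k B) h ∧
      -- whose quasi-inverse is evaluation at `B`, with the trimodule structure induced by `F`.
      ∃ θ : e.inverse ⋙ HopfTri.HopfTrimodule.forgetC k B ≅ HopfTri.evalB k B,
        ∀ (F : HopfTri.LexLaxModEnd (HopfTri.LeftComodule k B))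
          (x : (e.inverse.obj F).carrier),
          (∀ b : B, (θ.hom.app F).toLin ((e.inverse.obj F).act b x) =
            HopfTri.evalAct F.obj b ((θ.hom.app F).toLin x)) ∧
          (∀ φ : B →ₗ[k] k,
            (θ.hom.app F).toLin (HopfTri.contract (e.inverse.obj F).rcoact φ x) =
              (F.obj.functor.map (HopfTri.LeftComodule.translate φ)).toLin
                ((θ.hom.app F).toLin x)) := by
  refine ⟨HopfTri.HopfTrimodule.sigma_isLexFinitary, HopfTri.HopfTrimodule.sigma_monoidal _, ?_⟩
  have := HopfTri.HopfTrimodule.sigma_isEquivalence (k := k) (B := B)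
    HopfTri.HopfTrimodule.sigma_isLexFinitary
  let S := HopfTri.LaxModEnd.IsLexFinitary.lift (HopfTri.HopfTrimodule.sigma k B)
    HopfTri.HopfTrimodule.sigma_isLexFinitary
  let e := S.asEquivalence
  -- the counit of the equivalence, as a module transformation
  let c : ∀ F : HopfTri.LexLaxModEnd (HopfTri.LeftComodule k B),
      HopfTri.HopfTrimodule.laxFunctor (e.inverse.obj F) ⟶ F.obj :=
    fun F => (e.counitIso.hom.app F).hom
  refine ⟨e, rfl, NatIso.ofComponents (fun F =>
    HopfTri.HopfTrimodule.rcoactIso (e.inverse.obj F) ≪≫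
      (HopfTri.evalB k B).mapIso (e.counitIso.app F)) (fun {F G} f => ?_), fun F x =>
    ⟨fun b => HopfTri.HopfTrimodule.evalHom_act (c F) b x,
      fun φ => HopfTri.HopfTrimodule.evalHom_contract (c F) φ x⟩⟩
  refine HopfTri.HopfTrimodule.evalHom_naturality (c F) (c G) (e.inverse.map f) f.hom ?_
  exact congrArg (fun g => g.hom.nat.app (HopfTri.LeftComodule.regular k B))
    (e.counitIso.hom.naturality f)
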